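/- Let $k$ be a field and let $A$ be a dg algebra over $k$. Let $D(A)$ be the derived category of right dg $A$-modules (dg modules up to quasi-isomorphism), and let $\mathrm{Perf}(A)\subset D(A)$ be the smallest full triangulated subcategory that contains $A$ and is closed under direct summands. Write $\mathrm{Hom}^m(X,Y)=\mathrm{Hom}(X,Y[m])$. For an object $E$ of a triangulated category, let $[E]_0$ be the class of finite direct sums of shifts of $E$, let $[E]_n=[E]_0\star\cdots\star[E]_0$ ($n+1$ factors), where $\mathcal P\star\mathcal Q$ is the class of objects $F$ that fit into a distinguished triangle $X\to F\to Y\to X[1]$ with $X\in\mathcal P$ and $Y\in\mathcal Q$, and let $\langle E\rangle_n$ be the class of direct summands of objects of $[E]_n$. The diagonal dimension $\mathrm{Ddim}\,\mathrm{Perf}(A)$ is the least $n\ge 0$ for which there exist $F\in\mathrm{Perf}(A^{\mathrm{op}})$ and $G\in\mathrm{Perf}(A)$ such that the diagonal bimodule $A$ lies in $\langle F\boxtimes G\rangle_n\subset\mathrm{Perf}(A^{\mathrm{op}}\otimes_k A)$; it is $\infty$ if there is no such $n$. Suppose that $A$ is smooth, that is, the diagonal bimodule $A$ lies in $\mathrm{Perf}(A^{\mathrm{op}}\otimes_k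 A)$. Let $n\ge 0$, and suppose that $\mathrm{Perf}(A)$ has a full exceptional collection with $n+1$ blocks: objects $E_{i,j}\in\mathrm{Perf}(A)$ ($0\le i\le n$, $1\le j\le d_i$) such that - each $E_{i,j}$ is exceptional: $\mathrm{Hom}^0(E_{i,j},E_{i,j})=k$ and $\mathrm{Hom}^m(E_{i,j},E_{i,j})=0$ for $m\ne 0$; - distinct objects in a block are mutually orthogonal: $\mathrm{Hom}^m(E_{i,j},E_{i,j'})=0$ for all $m\in\mathbb Z$ and $j\ne j'$; - $\mathrm{Hom}^m(E_{i',j'},E_{i,j})=0$ for all $m\in\mathbb Z$, all $i'>i$ and all $j,j'$; - the $E_{i,j}$ generate $\mathrm{Perf}(A)$ as a triangulated category closed under direct summands. Then $$\mathrm{Ddim}\,\mathrm{Perf}(A)\le n.$$ -/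

import Mathlib

universe u v w z

noncomputable section

open CategoryTheory DirectSum TensorProduct

/-- The Koszul sign `(-1)^n`, as an element of the base field. -/
def koszulSign (k : Type u) [Field k] (n : ℤ) : k := ((n.negOnePow : ℤ) : k)

section Sign

variable (k : Type u) [Field k]

lemma koszulSign_add (m n : ℤ) : koszulSign k (m + n) = koszulSign k m * koszulSign k n := by
  simp [koszulSign, Int.negOnePow_add]

@[simp] lemma koszulSign_zero : koszulSign k 0 = 1 := by simp [koszulSign]

@[simp] lemma koszulSign_one : koszulSign k 1 = -1 := by simp [koszulSign]

@[simp] lemma koszulSign_mul_self (n : ℤ) : koszulSign k n * koszulSign k n = 1 := by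
  rw [koszulSign, ← Int.cast_mul, ← Units.val_mul]
  simp

@[simp] lemma koszulSign_mul_self_assoc (n : ℤ) (x : k) :
    koszulSign k n * (koszulSign k n * x) = x := by
  rw [← mul_assoc, koszulSign_mul_self, one_mul]

lemma koszulSign_ne_zero (n : ℤ) : koszulSign k n ≠ 0 := fun h => by
  simpa [h] using koszulSign_mul_self k n

lemma units_smul_eq_koszulSign {M : Type v} [AddCommGroup M] [Module k M] (n : ℤ) (x : M) :
    ((-1 : ℤˣ) ^ n) • x = koszulSign k n • x := by
  rw [koszulSign, Int.cast_smul_eq_zsmul]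
  rfl

end Sign

section TensorGrading

variable {k : Type u} [Field k] {M : Type v} [AddCommGroup M] [Module k M]
  {N : Type w} [AddCommGroup N] [Module k N] (ℳ : ℤ → Submodule k M) (𝒩 : ℤ → Submodule k N)

/-- The grading on a tensor product: the component of degree `n` is spanned by the `m ⊗ x` with
`m`, `x` homogeneous of degrees adding up to `n`. -/
def tensorGrading (n : ℤ) :
    Submodule k (M ⊗[k] N) :=
  Submodule.span k {t | ∃ i j : ℤ, i + j = n ∧ ∃ m ∈ ℳ i, ∃ x ∈ 𝒩 j, m ⊗ₜ[k] x = t}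

lemma tmul_mem_tensorGrading {i j n : ℤ} (h : i + j = n) {m : M} (hm : m ∈ ℳ i) {x : N}
    (hx : x ∈ 𝒩 j) : m ⊗ₜ[k] x ∈ tensorGrading ℳ 𝒩 n :=
  Submodule.subset_span ⟨i, j, h, m, hm, x, hx, rfl⟩

lemma tensorGrading_le {n : ℤ} {S : Submodule k (M ⊗[k] N)}
    (h : ∀ i j : ℤ, i + j = n → ∀ m ∈ ℳ i, ∀ x ∈ 𝒩 j, m ⊗ₜ[k] x ∈ S) :
    tensorGrading ℳ 𝒩 n ≤ S :=
  Submodule.span_le.2 (by rintro _ ⟨i, j, hij, m, hm, x, hx, rfl⟩; exact h i j hij m hm x hx)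

end TensorGrading

section Glue

variable {k : Type u} [Field k] {M : Type v} [AddCommGroup M] [Module k M]
  {P : Type z} [AddCommMonoid P] [Module k P]
  (ℳ : ℤ → Submodule k M) [Decomposition ℳ]

/-- The linear map on a graded vector space that restricts to `φ i` on the component of
degree `i`. -/
def gradedGlue (φ : ∀ i : ℤ, ℳ i →ₗ[k] P) : M →ₗ[k] P :=
  DirectSum.toModule k ℤ P φ ∘ₗ (decomposeLinearEquiv ℳ).toLinearMap

lemma gradedGlue_of_mem (φ : ∀ i : ℤ, ℳ i →ₗ[k] P) {i : ℤ} {m : M} (hm : m ∈ ℳ i) :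
    gradedGlue ℳ φ m = φ i ⟨m, hm⟩ := by
  lift m to ℳ i using hm
  simp [gradedGlue]

lemma graded_hom_ext {f g : M →ₗ[k] P} (h : ∀ i, ∀ m ∈ ℳ i, f m = g m) : f = g :=
  decompose_lhom_ext ℳ fun i => LinearMap.ext fun m => h i m m.2

/-- The operator that multiplies an element of degree `i` by `(-1)^(i * j)`. -/
def signOp (j : ℤ) : M →ₗ[k] M := gradedGlue ℳ fun i => koszulSign k (i * j) • (ℳ i).subtype

lemma signOp_of_mem (j : ℤ) {i : ℤ} {m : M} (hm : m ∈ ℳ i) :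
    signOp ℳ j m = koszulSign k (i * j) • m := by
  rw [signOp, gradedGlue_of_mem ℳ _ hm]; rfl

/-- A family of subspaces together with a linear map to the direct sum that splits it is a
decomposition. -/
@[reducible] def gradedDecompositionOf (f : M →ₗ[k] ⨁ i, ℳ i)
    (h : ∀ m, DirectSum.coeLinearMap ℳ (f m) = m)
    (h' : ∀ i (m : M) (hm : m ∈ ℳ i), f m = DirectSum.lof k ℤ (fun i => ℳ i) i ⟨m, hm⟩) :
    Decomposition ℳ :=
  Decomposition.ofLinearMap ℳ f (LinearMap.ext h) (by
    apply DirectSum.linearMap_ext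
    intro i
    ext1 m
    simp [h' i m m.2])

lemma lof_congr (𝒩 : ℤ → Submodule k M) {i j : ℤ} (h : i = j) {m : M} (hi : m ∈ 𝒩 i)
    (hj : m ∈ 𝒩 j) :
    DirectSum.lof k ℤ (fun i => 𝒩 i) i ⟨m, hi⟩ = DirectSum.lof k ℤ (fun i => 𝒩 i) j ⟨m, hj⟩ := by
  subst h; rfl

/-- The grading `i ↦ ℳ (i + n)`. -/
@[reducible] def gradedDecompositionShift (n : ℤ) : Decomposition fun i => ℳ (i + n) :=
  gradedDecompositionOf _
    (gradedGlue ℳ fun j =>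
      DirectSum.lof k ℤ (fun i => ℳ (i + n)) (j - n) ∘ₗ
        Submodule.inclusion (le_of_eq (by rw [sub_add_cancel])))
    (fun m => by
      refine LinearMap.congr_fun (f := DirectSum.coeLinearMap (fun i => ℳ (i + n)) ∘ₗ
        gradedGlue ℳ _) (g := LinearMap.id) (graded_hom_ext ℳ fun i m hm => ?_) m
      simp [gradedGlue_of_mem ℳ _ hm])
    (fun i m hm => by
      rw [gradedGlue_of_mem ℳ _ hm]
      exact lof_congr (fun i => ℳ (i + n)) (by ring) _ _)

/-- The splitting of the direct sum of two graded vector spaces into its components. -/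
def gradedProdMap {N : Type w} [AddCommGroup N] [Module k N]
    (𝒩 : ℤ → Submodule k N) [Decomposition 𝒩] :
    M × N →ₗ[k] ⨁ i, ((ℳ i).prod (𝒩 i) : Submodule k (M × N)) :=
  LinearMap.coprod
    (gradedGlue ℳ fun i =>
      DirectSum.lof k ℤ (fun i => ((ℳ i).prod (𝒩 i) : Submodule k (M × N))) i ∘ₗ
        (LinearMap.inl k M N).restrict (q := (ℳ i).prod (𝒩 i))
          (fun _ hm => Submodule.mem_prod.2 ⟨hm, zero_mem _⟩))
    (gradedGlue 𝒩 fun i =>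
      DirectSum.lof k ℤ (fun i => ((ℳ i).prod (𝒩 i) : Submodule k (M × N))) i ∘ₗ
        (LinearMap.inr k M N).restrict (q := (ℳ i).prod (𝒩 i))
          (fun _ hm => Submodule.mem_prod.2 ⟨zero_mem _, hm⟩))

/-- The grading on the direct sum of two graded vector spaces. -/
@[reducible] def gradedDecompositionProd {N : Type w} [AddCommGroup N] [Module k N]
    (𝒩 : ℤ → Submodule k N) [Decomposition 𝒩] :
    Decomposition fun i => (ℳ i).prod (𝒩 i) :=
  gradedDecompositionOf _ (gradedProdMap ℳ 𝒩)
    (fun m => by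
      refine LinearMap.congr_fun (f := DirectSum.coeLinearMap (fun i => (ℳ i).prod (𝒩 i)) ∘ₗ
        gradedProdMap ℳ 𝒩) (g := LinearMap.id) (LinearMap.prod_ext
          (graded_hom_ext ℳ fun i m hm => ?_) (graded_hom_ext 𝒩 fun i m hm => ?_)) m
      · simp [gradedProdMap, gradedGlue_of_mem ℳ _ hm, LinearMap.restrict_apply]
      · simp [gradedProdMap, gradedGlue_of_mem 𝒩 _ hm, LinearMap.restrict_apply])
    (fun i m hm => by
      obtain ⟨h1, h2⟩ := Submodule.mem_prod.1 hm
      rw [gradedProdMap, LinearMap.coprod_apply, gradedGlue_of_mem ℳ _ h1,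
        gradedGlue_of_mem 𝒩 _ h2, LinearMap.comp_apply, LinearMap.comp_apply, ← map_add]
      congr 1
      ext <;> simp [LinearMap.restrict_apply])

section

variable {N : Type w} [AddCommGroup N] [Module k N] (𝒩 : ℤ → Submodule k N) [Decomposition 𝒩]

lemma graded_tensor_hom_ext {f g : M ⊗[k] N →ₗ[k] P}
    (h : ∀ i, ∀ m ∈ ℳ i, ∀ j, ∀ x ∈ 𝒩 j, f (m ⊗ₜ x) = g (m ⊗ₜ x)) : f = g :=
  TensorProduct.ext (graded_hom_ext ℳ fun i m hm => graded_hom_ext 𝒩 fun j x hx => h i m hm j x hx)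

/-- The splitting of a tensor product of graded vector spaces into its components. -/
def tensorGradingMap : M ⊗[k] N →ₗ[k] ⨁ n, tensorGrading ℳ 𝒩 n :=
  DirectSum.toModule k (ℤ × ℤ) _ (fun p =>
    DirectSum.lof k ℤ (fun n => tensorGrading ℳ 𝒩 n) (p.1 + p.2) ∘ₗ
      LinearMap.codRestrict _ (TensorProduct.map (ℳ p.1).subtype (𝒩 p.2).subtype) (fun t => by
        induction t using TensorProduct.induction_on with
        | zero => simp
        | tmul m x => exact tmul_mem_tensorGrading ℳ 𝒩 rfl m.2 x.2
        | add a b ha hb => rw [map_add]; exact add_mem ha hb)) ∘ₗ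
  (TensorProduct.directSum k k (fun i => ℳ i) (fun j => 𝒩 j)).toLinearMap ∘ₗ
  (TensorProduct.congr (decomposeLinearEquiv ℳ) (decomposeLinearEquiv 𝒩)).toLinearMap

lemma tensorGradingMap_tmul {i j n : ℤ} (h : i + j = n) {m : M} (hm : m ∈ ℳ i) {x : N}
    (hx : x ∈ 𝒩 j) :
    tensorGradingMap ℳ 𝒩 (m ⊗ₜ x) = DirectSum.lof k ℤ (fun n => tensorGrading ℳ 𝒩 n) n
      ⟨m ⊗ₜ x, tmul_mem_tensorGrading ℳ 𝒩 h hm hx⟩ := by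
  subst h
  lift m to ℳ i using hm
  lift x to 𝒩 j using hx
  simp [tensorGradingMap, TensorProduct.directSum_lof_tmul_lof]
  rfl

instance tensorGradingDecomposition : Decomposition (tensorGrading ℳ 𝒩) :=
  gradedDecompositionOf _ (tensorGradingMap ℳ 𝒩)
    (fun t => by
      refine LinearMap.congr_fun (f := DirectSum.coeLinearMap (tensorGrading ℳ 𝒩) ∘ₗ
        tensorGradingMap ℳ 𝒩) (g := LinearMap.id) (graded_tensor_hom_ext ℳ 𝒩
          fun i m hm j x hx => ?_) t
      simp [tensorGradingMap_tmul ℳ 𝒩 rfl hm hx])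
    (fun n t ht => by
      have key : tensorGradingMap ℳ 𝒩 ∘ₗ (tensorGrading ℳ 𝒩 n).subtype =
          DirectSum.lof k ℤ (fun n => tensorGrading ℳ 𝒩 n) n := by
        ext1 ⟨t, ht⟩
        induction ht using Submodule.span_induction with
        | mem t h =>
          obtain ⟨i, j, h, m, hm, x, hx, rfl⟩ := h
          exact tensorGradingMap_tmul ℳ 𝒩 h hm hx
        | zero => exact (map_zero _).trans (map_zero _).symm
        | add a b ha hb h1 h2 =>
          exact (map_add (tensorGradingMap ℳ 𝒩) a b).trans
            ((congrArg₂ (· + ·) h1 h2).trans (map_add _ _ _).symm)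
        | smul c a ha h1 =>
          exact (map_smul (tensorGradingMap ℳ 𝒩) c a).trans
            ((congrArg (c • ·) h1).trans (map_smul _ _ _).symm)
      exact LinearMap.congr_fun key ⟨t, ht⟩)

/-- The transport of a grading along a linear isomorphism. -/
@[reducible] def gradedDecompositionMap (e : M ≃ₗ[k] N) :
    Decomposition fun i => (ℳ i).map e.toLinearMap :=
  gradedDecompositionOf _
    (gradedGlue ℳ (fun i =>
      DirectSum.lof k ℤ (fun i => (ℳ i).map e.toLinearMap) i ∘ₗ
        e.toLinearMap.restrict (fun _ hm => Submodule.mem_map_of_mem hm)) ∘ₗ e.symm.toLinearMap)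
    (fun x => by
      obtain ⟨m, rfl⟩ := e.surjective x
      refine LinearMap.congr_fun (f := DirectSum.coeLinearMap (fun i => (ℳ i).map e.toLinearMap) ∘ₗ
        gradedGlue ℳ _ ∘ₗ e.symm.toLinearMap ∘ₗ e.toLinearMap) (g := e.toLinearMap)
          (graded_hom_ext ℳ fun i m hm => ?_) m
      simp [gradedGlue_of_mem ℳ _ hm, LinearMap.restrict_apply])
    (fun i x hx => by
      obtain ⟨m, hm, rfl⟩ := hx
      simp [gradedGlue_of_mem ℳ _ hm, LinearMap.restrict_apply])

end

end Glue

/-- A (unital, associative) dg algebra over a field `k`, with differential of degree `1`. -/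
structure DGAlgebra (k : Type u) [Field k] where
  carrier : Type v
  [ring : Ring carrier]
  [algebra : Algebra k carrier]
  /-- the homogeneous components -/
  grading : ℤ → Submodule k carrier
  [graded : GradedAlgebra grading]
  /-- the differential -/
  d : carrier →ₗ[k] carrier
  d_mem : ∀ {i : ℤ} {a : carrier}, a ∈ grading i → d a ∈ grading (i + 1)
  d_d : ∀ a, d (d a) = 0
  d_mul : ∀ {i : ℤ} {a : carrier}, a ∈ grading i → ∀ b,
    d (a * b) = d a * b + koszulSign k i • (a * d b)

attribute [instance] DGAlgebra.ring DGAlgebra.algebra DGAlgebra.graded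

/-- A right dg module over the dg algebra `A`; the (unital) right action `m ↦ m a` is recorded as
the `k`-bilinear map `act`. -/
structure DGModule {k : Type u} [Field k] (A : DGAlgebra.{u, v} k) where
  carrier : Type v
  [addCommGroup : AddCommGroup carrier]
  [module : Module k carrier]
  /-- the homogeneous components -/
  grading : ℤ → Submodule k carrier
  [decomposition : Decomposition grading]
  /-- the right action `m a` -/
  act : carrier →ₗ[k] A.carrier →ₗ[k] carrier
  act_one : ∀ m, act m 1 = m
  act_mul : ∀ m a b, act m (a * b) = act (act m a) b
  act_mem : ∀ {i j : ℤ} {m : carrier} {a : A.carrier}, m ∈ grading i → a ∈ A.grading j →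
    act m a ∈ grading (i + j)
  /-- the differential -/
  d : carrier →ₗ[k] carrier
  d_mem : ∀ {i : ℤ} {m : carrier}, m ∈ grading i → d m ∈ grading (i + 1)
  d_d : ∀ m, d (d m) = 0
  d_act : ∀ {i : ℤ} {m : carrier}, m ∈ grading i → ∀ a,
    d (act m a) = act (d m) a + koszulSign k i • act m (A.d a)

attribute [instance] DGModule.addCommGroup DGModule.module DGModule.decomposition

namespace DGModule

variable {k : Type u} [Field k] {A : DGAlgebra.{u, v} k}

/-- Morphisms of dg modules: closed morphisms of degree zero. -/
@[ext]
structure Hom (M N : DGModule A) where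
  f : M.carrier →ₗ[k] N.carrier
  map_mem : ∀ {i : ℤ} {m : M.carrier}, m ∈ M.grading i → f m ∈ N.grading i
  map_act : ∀ m a, f (M.act m a) = N.act (f m) a
  map_d : ∀ m, f (M.d m) = N.d (f m)

instance : Category (DGModule A) where
  Hom := Hom
  id M := ⟨LinearMap.id, fun h => h, fun _ _ => rfl, fun _ => rfl⟩
  comp f g := ⟨g.f ∘ₗ f.f, fun h => g.map_mem (f.map_mem h),
    fun m a => by simp [f.map_act, g.map_act], fun m => by simp [f.map_d, g.map_d]⟩

@[ext] lemma hom_ext {M N : DGModule A} {f g : M ⟶ N} (h : ∀ m, f.f m = g.f m) : f = g :=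
  Hom.ext (LinearMap.ext h)

@[simp] lemma id_f (M : DGModule A) (m : M.carrier) : Hom.f (𝟙 M) m = m := rfl

@[simp] lemma comp_f {M N K : DGModule A} (f : M ⟶ N) (g : N ⟶ K) (m : M.carrier) :
    (f ≫ g).f m = g.f (f.f m) := rfl

/-- Multiplication by a scalar, as an endomorphism of a dg module. -/
def scalar (M : DGModule A) (c : k) : M ⟶ M where
  f := c • LinearMap.id
  map_mem h := (M.grading _).smul_mem c h
  map_act m a := by simp
  map_d m := by simp

/-! ### Cohomology and quasi-isomorphisms -/

/-- The cocycles of degree `i`. -/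
def cocycles (M : DGModule A) (i : ℤ) : Submodule k M.carrier :=
  M.grading i ⊓ LinearMap.ker M.d

/-- The coboundaries of degree `i`. -/
def coboundaries (M : DGModule A) (i : ℤ) : Submodule k M.carrier :=
  (M.grading (i - 1)).map M.d

/-- The cohomology `H^i(M)`. -/
abbrev Cohomology (M : DGModule A) (i : ℤ) : Type v :=
  M.cocycles i ⧸ (M.coboundaries i).comap (M.cocycles i).subtype

lemma Hom.map_cocycles {M N : DGModule A} (f : M ⟶ N) (i : ℤ) :
    ∀ m ∈ M.cocycles i, f.f m ∈ N.cocycles i := fun m hm =>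
  ⟨f.map_mem hm.1, by
    have h : M.d m = 0 := hm.2
    change N.d (f.f m) = 0
    rw [← f.map_d, h, map_zero]⟩

/-- The map `H^i(M) → H^i(N)` induced by a morphism of dg modules. -/
def Hom.cohomologyMap {M N : DGModule A} (f : M ⟶ N) (i : ℤ) :
    M.Cohomology i →ₗ[k] N.Cohomology i :=
  Submodule.mapQ _ _ (f.f.restrict (Hom.map_cocycles f i)) (by
    rintro ⟨m, hm⟩ ⟨x, hx, hxm⟩
    exact ⟨f.f x, f.map_mem hx, by
      rw [← f.map_d, hxm]; rfl⟩)

variable (A) in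
/-- Quasi-isomorphisms: the morphisms inducing isomorphisms on all cohomology spaces. -/
def quasiIso : MorphismProperty (DGModule A) := fun _ _ f =>
  ∀ i : ℤ, Function.Bijective (Hom.cohomologyMap f i)

/-! ### Shifts -/

/-- The shift `M[n]`: `M[n]^i = M^(n + i)`, with differential `(-1)^n d` and the same right
action. -/
def shift (n : ℤ) (M : DGModule A) : DGModule A where
  carrier := M.carrier
  grading i := M.grading (i + n)
  decomposition := gradedDecompositionShift M.grading n
  act := M.act
  act_one := M.act_one
  act_mul := M.act_mul
  act_mem := fun {i j m a} hm ha => by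
    have := M.act_mem hm ha
    rwa [show i + j + n = i + n + j by ring]
  d := koszulSign k n • M.d
  d_mem := fun {i m} hm => by
    rw [show i + 1 + n = i + n + 1 by ring]
    exact (M.grading _).smul_mem _ (M.d_mem hm)
  d_d m := by simp [M.d_d]
  d_act := fun {i m} hm a => by
    have := M.d_act hm a
    simp only [LinearMap.smul_apply, this, map_smul, smul_add, koszulSign_add, smul_smul]
    rw [mul_left_comm, koszulSign_mul_self, mul_one]

/-- The shift of a morphism: the same underlying map. -/
def shiftMap (n : ℤ) {M N : DGModule A} (f : M ⟶ N) : M.shift n ⟶ N.shift n where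
  f := f.f
  map_mem h := f.map_mem h
  map_act := f.map_act
  map_d m := by
    have h := congrArg (koszulSign k n • ·) (f.map_d m)
    exact (map_smul f.f _ _).trans h

variable (A) in
/-- The shift functor `M ↦ M[n]`. -/
def shiftFun (n : ℤ) : DGModule A ⥤ DGModule A where
  obj := shift n
  map := shiftMap n

/-- The identification `M[0] ≅ M`, with the identity as underlying map. -/
def shiftZeroIso (M : DGModule A) : M.shift 0 ≅ M where
  hom := { f := LinearMap.id
           map_mem := fun {i} m (h : m ∈ M.grading (i + 0)) => by
             rw [add_zero] at h
             exact h
           map_act := fun _ _ => rfl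
           map_d := fun (m : M.carrier) => by
             change koszulSign k 0 • M.d m = M.d m
             simp }
  inv := { f := LinearMap.id
           map_mem := fun {i m} h => by
             change m ∈ M.grading (i + 0)
             rw [add_zero]
             exact h
           map_act := fun _ _ => rfl
           map_d := fun (m : M.carrier) => by
             change M.d m = koszulSign k 0 • M.d m
             simp }

/-- The identification `M[p + q] ≅ M[p][q]`, with the identity as underlying map. -/
def shiftAddIso (p q : ℤ) (M : DGModule A) : M.shift (p + q) ≅ (M.shift p).shift q where
  hom := { f := LinearMap.id
           map_mem := fun {i m} (h : m ∈ M.grading (i + (p + q))) => by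
             change m ∈ M.grading (i + q + p)
             rwa [show i + q + p = i + (p + q) by ring]
           map_act := fun _ _ => rfl
           map_d := fun (m : M.carrier) => by
             change koszulSign k (p + q) • M.d m = koszulSign k q • koszulSign k p • M.d m
             simp [koszulSign_add, smul_smul, mul_comm] }
  inv := { f := LinearMap.id
           map_mem := fun {i m} (h : m ∈ M.grading (i + q + p)) => by
             change m ∈ M.grading (i + (p + q))
             rwa [show i + (p + q) = i + q + p by ring]
           map_act := fun _ _ => rfl
           map_d := fun (m : M.carrier) => by
             change koszulSign k q • koszulSign k p • M.d m = koszulSign k (p + q) • M.d m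
             simp [koszulSign_add, smul_smul, mul_comm] }

lemma eqToHom_shift_f {p q : ℤ} (h : p = q) (M : DGModule A)
    (h' : M.shift p = M.shift q) (m : M.carrier) : (eqToHom h').f m = m := by
  subst h; rfl

instance : HasShift (DGModule A) ℤ := hasShiftMk (DGModule A) ℤ
  { F := shiftFun A
    zero := NatIso.ofComponents shiftZeroIso
    add := fun p q => NatIso.ofComponents (shiftAddIso p q)
    assoc_hom_app := fun p q r M => by
      ext m
      exact (eqToHom_shift_f (add_assoc p q r) M _ m).symm
    zero_add_hom_app := fun p M => by
      ext m
      exact (eqToHom_shift_f (zero_add p) M _ m).symm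
    add_zero_hom_app := fun p M => by
      ext m
      exact (eqToHom_shift_f (add_zero p) M _ m).symm }

lemma bijective_cohomologyMap_iff {M N : DGModule A} (f : M ⟶ N) (i : ℤ) :
    Function.Bijective (Hom.cohomologyMap f i) ↔
      (∀ m ∈ M.cocycles i, f.f m ∈ N.coboundaries i → m ∈ M.coboundaries i) ∧
      ∀ n ∈ N.cocycles i, ∃ m ∈ M.cocycles i, f.f m - n ∈ N.coboundaries i := by
  refine and_congr ?_ ?_
  · rw [injective_iff_map_eq_zero]
    constructor
    · intro h m hm hb
      have := h (Submodule.Quotient.mk ⟨m, hm⟩)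
        ((Submodule.Quotient.mk_eq_zero _).2 hb)
      exact (Submodule.Quotient.mk_eq_zero ((M.coboundaries i).comap (M.cocycles i).subtype)).1 this
    · intro h x
      induction x using Submodule.Quotient.induction_on with | _ x
      intro hx
      exact (Submodule.Quotient.mk_eq_zero _).2
        (h x.1 x.2 ((Submodule.Quotient.mk_eq_zero ((N.coboundaries i).comap (N.cocycles i).subtype)).1 hx))
  · constructor
    · intro h n hn
      obtain ⟨x, hx⟩ := h (Submodule.Quotient.mk ⟨n, hn⟩)
      induction x using Submodule.Quotient.induction_on with | _ x
      exact ⟨x.1, x.2, (Submodule.Quotient.eq ((N.coboundaries i).comap (N.cocycles i).subtype)).1 hx⟩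
    · intro h y
      induction y using Submodule.Quotient.induction_on with | _ y
      obtain ⟨m, hm, hb⟩ := h y.1 y.2
      exact ⟨Submodule.Quotient.mk ⟨m, hm⟩, (Submodule.Quotient.eq _).2 hb⟩

lemma cocycles_shift (M : DGModule A) (n i : ℤ) :
    (M.shift n).cocycles i = M.cocycles (i + n) := by
  ext m
  change (_ ∧ koszulSign k n • M.d m = 0) ↔ (_ ∧ M.d m = 0)
  rw [smul_eq_zero_iff_right (koszulSign_ne_zero k n)]
  rfl

lemma coboundaries_shift (M : DGModule A) (n i : ℤ) :
    (M.shift n).coboundaries i = M.coboundaries (i + n) := by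
  ext m
  change (∃ x ∈ M.grading (i - 1 + n), koszulSign k n • M.d x = m) ↔
    ∃ x ∈ M.grading (i + n - 1), M.d x = m
  rw [show i - 1 + n = i + n - 1 by ring]
  constructor
  · rintro ⟨x, hx, rfl⟩
    exact ⟨koszulSign k n • x, (M.grading _).smul_mem _ hx, map_smul _ _ _⟩
  · rintro ⟨x, hx, rfl⟩
    exact ⟨koszulSign k n • x, (M.grading _).smul_mem _ hx, by simp [smul_smul]⟩

instance : (quasiIso A).IsCompatibleWithShift ℤ where
  condition n := by
    ext M N f
    change (∀ i, Function.Bijective (Hom.cohomologyMap (shiftMap n f) i)) ↔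
      ∀ i, Function.Bijective (Hom.cohomologyMap f i)
    have key : ∀ i, Function.Bijective (Hom.cohomologyMap (shiftMap n f) i) ↔
        Function.Bijective (Hom.cohomologyMap f (i + n)) := fun i => by
      rw [bijective_cohomologyMap_iff, bijective_cohomologyMap_iff, cocycles_shift,
        cocycles_shift, coboundaries_shift, coboundaries_shift]
      rfl
    simp_rw [key]
    exact ⟨fun h i => by
      have := h (i - n)
      rwa [sub_add_cancel] at this, fun h i => h (i + n)⟩

/-! ### Cones -/

/-- The cone of `f : M ⟶ N`: the graded module `M[1] ⊕ N` with differential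
`(m, n) ↦ (-d m, f m + d n)`. -/
def cone {M N : DGModule A} (f : M ⟶ N) : DGModule A where
  carrier := M.carrier × N.carrier
  grading i := (M.grading (i + 1)).prod (N.grading i)
  decomposition :=
    letI := gradedDecompositionShift M.grading 1
    gradedDecompositionProd (fun i => M.grading (i + 1)) N.grading
  act := LinearMap.mk₂ k (fun x a => (M.act x.1 a, N.act x.2 a))
    (by simp) (by simp) (by simp) (by simp)
  act_one x := by simp [M.act_one, N.act_one]
  act_mul x a b := by simp [M.act_mul, N.act_mul]
  act_mem := fun {i j x a} hx ha => ⟨by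
    have := M.act_mem hx.1 ha
    rwa [show i + 1 + j = i + j + 1 by ring] at this, N.act_mem hx.2 ha⟩
  d := (-(M.d ∘ₗ LinearMap.fst k M.carrier N.carrier)).prod (f.f ∘ₗ LinearMap.fst k M.carrier N.carrier +
    N.d ∘ₗ LinearMap.snd k M.carrier N.carrier)
  d_mem := fun {i x} hx => ⟨neg_mem (M.d_mem hx.1), add_mem (f.map_mem hx.1) (N.d_mem hx.2)⟩
  d_d x := by simp [M.d_d, N.d_d, f.map_d]
  d_act := fun {i x} hx a => by
    have h1 := M.d_act hx.1 a
    have h2 := N.d_act hx.2 a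
    ext
    · simp [h1, koszulSign_add]; abel
    · simp [h2, f.map_act]; abel

/-- The inclusion `N ⟶ cone f`. -/
def coneInr {M N : DGModule A} (f : M ⟶ N) : N ⟶ cone f where
  f := LinearMap.inr k M.carrier N.carrier
  map_mem := fun h => ⟨zero_mem _, h⟩
  map_act := fun m a => by
    change ((0 : M.carrier), N.act m a) = (M.act 0 a, N.act m a)
    simp
  map_d := fun m => by
    change ((0 : M.carrier), N.d m) = (-(M.d 0), f.f 0 + N.d m)
    simp

/-- The morphism `cone f ⟶ M[1]`, `(m, n) ↦ -m`. -/
def coneDelta {M N : DGModule A} (f : M ⟶ N) : cone f ⟶ M.shift 1 where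
  f := -LinearMap.fst k M.carrier N.carrier
  map_mem := fun h => neg_mem (S := Submodule k M.carrier) h.1
  map_act := fun (m : M.carrier × N.carrier) a => by
    change -(M.act m.1 a) = M.act (-m.1) a
    simp
  map_d := fun (m : M.carrier × N.carrier) => by
    change -(-(M.d m.1)) = koszulSign k 1 • M.d (-m.1)
    simp

/-- The standard triangle `M ⟶ N ⟶ cone f ⟶ M[1]`, whose last morphism is `(m, n) ↦ -m`. -/
def coneTriangle {M N : DGModule A} (f : M ⟶ N) : Pretriangulated.Triangle (DGModule A) :=
  Pretriangulated.Triangle.mk f (coneInr f) (coneDelta f)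

end DGModule

section

variable {k : Type u} [Field k]

lemma koszulSign_cases (n : ℤ) : koszulSign k n = 1 ∨ koszulSign k n = -1 := by
  have h := koszulSign_mul_self k n
  rwa [mul_self_eq_one_iff] at h

/-- The free dg module of rank one: `A` as a right dg module over itself. -/
def DGAlgebra.regular (A : DGAlgebra.{u, v} k) : DGModule A where
  carrier := A.carrier
  grading := A.grading
  act := LinearMap.mul k A.carrier
  act_one := mul_one
  act_mul m a b := (mul_assoc m a b).symm
  act_mem hm ha := SetLike.mul_mem_graded hm ha
  d := A.d
  d_mem := A.d_mem
  d_d := A.d_d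
  d_act := A.d_mul

/-! ### The opposite dg algebra -/

namespace DGAlgebra

variable (A : DGAlgebra.{u, v} k)

/-- The underlying vector space of the opposite dg algebra. -/
def OpCarrier : Type v := A.carrier

instance : AddCommGroup A.OpCarrier := inferInstanceAs (AddCommGroup A.carrier)

instance : Module k A.OpCarrier := inferInstanceAs (Module k A.carrier)

/-- The multiplication `(a, b) ↦ (-1)^(|a| |b|) b a`. -/
def opMul : A.carrier →ₗ[k] A.carrier →ₗ[k] A.carrier :=
  gradedGlue A.grading fun i =>
    (LinearMap.mul k A.carrier).flip.compl₂ (signOp A.grading i) ∘ₗ (A.grading i).subtype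

variable {A} in
lemma opMul_of_mem {i j : ℤ} {a b : A.carrier} (ha : a ∈ A.grading i) (hb : b ∈ A.grading j) :
    A.opMul a b = koszulSign k (i * j) • (b * a) := by
  rw [opMul, gradedGlue_of_mem A.grading _ ha]
  simp [signOp_of_mem A.grading i hb, mul_comm i j]

lemma opMul_one (a : A.carrier) : A.opMul a 1 = a := by
  induction a using Decomposition.inductionOn A.grading with
  | zero => simp
  | @homogeneous i a =>
    rw [opMul_of_mem a.2 SetLike.GradedOne.one_mem]
    simp
  | add a b ha hb => simp [ha, hb]

lemma one_opMul (a : A.carrier) : A.opMul 1 a = a := by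
  induction a using Decomposition.inductionOn A.grading with
  | zero => simp
  | @homogeneous i a =>
    rw [opMul_of_mem SetLike.GradedOne.one_mem a.2]
    simp
  | add a b ha hb => simp [ha, hb]

lemma opMul_assoc (a b c : A.carrier) : A.opMul (A.opMul a b) c = A.opMul a (A.opMul b c) := by
  induction a using Decomposition.inductionOn A.grading with
  | zero => simp
  | add a b ha hb => simp [ha, hb]
  | @homogeneous i a =>
  induction b using Decomposition.inductionOn A.grading with
  | zero => simp
  | add a b ha hb => simp [ha, hb]
  | @homogeneous j b =>
  induction c using Decomposition.inductionOn A.grading with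
  | zero => simp
  | add a b ha hb => simp [ha, hb]
  | @homogeneous l c =>
    rw [opMul_of_mem a.2 b.2, opMul_of_mem b.2 c.2, map_smul, LinearMap.smul_apply, map_smul,
      opMul_of_mem (SetLike.mul_mem_graded b.2 a.2) c.2,
      opMul_of_mem a.2 (SetLike.mul_mem_graded c.2 b.2), mul_assoc, smul_smul, smul_smul]
    congr 1
    simp only [mul_add, add_mul, koszulSign_add]
    ring

instance : Ring A.OpCarrier :=
  { (inferInstance : AddCommGroup A.OpCarrier) with
    mul := fun a b => A.opMul a b
    one := (1 : A.carrier)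
    one_mul := A.one_opMul
    mul_one := A.opMul_one
    mul_assoc := A.opMul_assoc
    left_distrib := fun a b c => map_add (A.opMul a) b c
    right_distrib := fun a b c => LinearMap.map_add₂ A.opMul a b c
    zero_mul := fun a => LinearMap.map_zero₂ A.opMul a
    mul_zero := fun a => map_zero (A.opMul a) }

instance : Algebra k A.OpCarrier :=
  Algebra.ofModule (fun r a b => LinearMap.map_smul₂ A.opMul r a b)
    (fun r a b => map_smul (A.opMul a) r b)

/-- The opposite dg algebra `A^op`: the same graded vector space and differential, with the
multiplication `(a, b) ↦ (-1)^(|a| |b|) b a`. -/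
def op : DGAlgebra.{u, v} k where
  carrier := A.OpCarrier
  grading := A.grading
  graded :=
    { (inferInstance : Decomposition A.grading) with
      one_mem := (SetLike.GradedOne.one_mem : (1 : A.carrier) ∈ A.grading 0)
      mul_mem := fun {i j a b} ha hb => by
        change A.opMul a b ∈ A.grading (i + j)
        rw [opMul_of_mem ha hb, add_comm]
        exact Submodule.smul_mem _ _ (SetLike.mul_mem_graded hb ha) }
  d := A.d
  d_mem := A.d_mem
  d_d := A.d_d
  d_mul := fun {i a} ha b => by
    change A.d (A.opMul a b) = A.opMul (A.d a) b + koszulSign k i • A.opMul a (A.d b)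
    change A.carrier at a
    change A.carrier at b
    induction b using Decomposition.inductionOn A.grading with
    | zero => simp
    | add b c hb hc =>
      simp only [map_add, hb, hc, smul_add]
      abel
    | @homogeneous j b =>
      have ha : a ∈ A.grading i := ha
      rw [opMul_of_mem ha b.2, opMul_of_mem (A.d_mem ha) b.2, opMul_of_mem ha (A.d_mem b.2),
        map_smul, A.d_mul b.2]
      simp only [mul_add, add_mul, koszulSign_add, mul_one, one_mul, smul_add, smul_smul]
      rcases koszulSign_cases (k := k) i with h | h <;>
      rcases koszulSign_cases (k := k) j with h' | h' <;> simp [h, h', add_comm]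

end DGAlgebra

/-! ### Tensor products -/

section Tensor

variable {A B : DGAlgebra.{u, v} k}

/-- The differential `m ⊗ x ↦ d m ⊗ x + (-1)^|m| m ⊗ d x` on `M ⊗ N`. -/
def tensorD {M N : Type v} [AddCommGroup M] [Module k M] [AddCommGroup N] [Module k N]
    (ℳ : ℤ → Submodule k M) [Decomposition ℳ] (dM : M →ₗ[k] M) (dN : N →ₗ[k] N) :
    M ⊗[k] N →ₗ[k] M ⊗[k] N :=
  TensorProduct.map dM LinearMap.id + TensorProduct.map (signOp ℳ 1) dN

/-- The right action `(m ⊗ x) (a ⊗ b) = (-1)^(|x| |a|) m a ⊗ x b` of `A ⊗ B` on `M ⊗ N`. -/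
def tensorAct (M : DGModule A) (N : DGModule B) :
    M.carrier ⊗[k] N.carrier →ₗ[k] A.carrier ⊗[k] B.carrier →ₗ[k] M.carrier ⊗[k] N.carrier :=
  (TensorProduct.lift (gradedGlue A.grading fun i =>
    (TensorProduct.mapBilinear (RingHom.id k) M.carrier N.carrier M.carrier N.carrier).compl₁₂
      (M.act.flip ∘ₗ (A.grading i).subtype)
      (LinearMap.lcomp k N.carrier (signOp N.grading i) ∘ₗ N.act.flip))).flip

lemma tensorAct_tmul (M : DGModule A) (N : DGModule B) {i j : ℤ} (m : M.carrier) {x : N.carrier}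
    (hx : x ∈ N.grading j) {a : A.carrier} (ha : a ∈ A.grading i) (b : B.carrier) :
    tensorAct M N (m ⊗ₜ x) (a ⊗ₜ b) = koszulSign k (j * i) • (M.act m a ⊗ₜ N.act x b) := by
  simp [tensorAct, gradedGlue_of_mem A.grading _ ha, signOp_of_mem N.grading _ hx]

/-- Induction principle for statements about elements of a tensor product of graded spaces. -/
lemma graded_tensor_induction {M N : Type v} [AddCommGroup M] [Module k M] [AddCommGroup N]
    [Module k N] (ℳ : ℤ → Submodule k M) [Decomposition ℳ] (𝒩 : ℤ → Submodule k N)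
    [Decomposition 𝒩] {p : M ⊗[k] N → Prop} (t : M ⊗[k] N) (zero : p 0)
    (tmul : ∀ i, ∀ m ∈ ℳ i, ∀ j, ∀ x ∈ 𝒩 j, p (m ⊗ₜ x))
    (add : ∀ a b, p a → p b → p (a + b)) : p t := by
  induction t using TensorProduct.induction_on with
  | zero => exact zero
  | add a b ha hb => exact add a b ha hb
  | tmul m x =>
  induction m using Decomposition.inductionOn ℳ with
  | zero => simpa using zero
  | add a b ha hb => rw [TensorProduct.add_tmul]; exact add _ _ ha hb
  | @homogeneous i m =>
  induction x using Decomposition.inductionOn 𝒩 with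
  | zero => simpa using zero
  | add a b ha hb => rw [TensorProduct.tmul_add]; exact add _ _ ha hb
  | @homogeneous j x => exact tmul i m m.2 j x x.2

lemma tensorD_tmul {M N : Type v} [AddCommGroup M] [Module k M] [AddCommGroup N] [Module k N]
    (ℳ : ℤ → Submodule k M) [Decomposition ℳ] (dM : M →ₗ[k] M) (dN : N →ₗ[k] N)
    {i : ℤ} {m : M} (hm : m ∈ ℳ i) (x : N) :
    tensorD ℳ dM dN (m ⊗ₜ x) = dM m ⊗ₜ x + koszulSign k i • (m ⊗ₜ dN x) := by
  simp [tensorD, signOp_of_mem ℳ 1 hm, TensorProduct.smul_tmul']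

lemma tensorD_mem (M : DGModule A) (N : DGModule B) {n : ℤ} {t : M.carrier ⊗[k] N.carrier}
    (ht : t ∈ tensorGrading M.grading N.grading n) :
    tensorD M.grading M.d N.d t ∈ tensorGrading M.grading N.grading (n + 1) := by
  refine tensorGrading_le (S := (tensorGrading M.grading N.grading (n + 1)).comap
    (tensorD M.grading M.d N.d)) M.grading N.grading ?_ ht
  intro i j hij m hm x hx
  rw [Submodule.mem_comap, tensorD_tmul M.grading _ _ hm]
  exact add_mem (tmul_mem_tensorGrading _ _ (by lia) (M.d_mem hm) hx)
    (Submodule.smul_mem _ _ (tmul_mem_tensorGrading _ _ (by lia) hm (N.d_mem hx)))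

lemma tensorD_tensorD (M : DGModule A) (N : DGModule B) (t : M.carrier ⊗[k] N.carrier) :
    tensorD M.grading M.d N.d (tensorD M.grading M.d N.d t) = 0 := by
  induction t using graded_tensor_induction M.grading N.grading with
  | zero => simp
  | add a b ha hb => simp [ha, hb]
  | tmul i m hm j x hx =>
    rw [tensorD_tmul M.grading _ _ hm, map_add, map_smul,
      tensorD_tmul M.grading _ _ (M.d_mem hm), tensorD_tmul M.grading _ _ hm, M.d_d, N.d_d]
    simp [koszulSign_add]

lemma tensorAct_mem (M : DGModule A) (N : DGModule B) {n r : ℤ} {t : M.carrier ⊗[k] N.carrier}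
    {p : A.carrier ⊗[k] B.carrier} (ht : t ∈ tensorGrading M.grading N.grading n)
    (hp : p ∈ tensorGrading A.grading B.grading r) :
    tensorAct M N t p ∈ tensorGrading M.grading N.grading (n + r) := by
  refine tensorGrading_le (S := (tensorGrading M.grading N.grading (n + r)).comap
    ((tensorAct M N).flip p)) M.grading N.grading ?_ ht
  intro i j hij m hm x hx
  refine tensorGrading_le (S := (tensorGrading M.grading N.grading (n + r)).comap
    (tensorAct M N (m ⊗ₜ x))) A.grading B.grading ?_ hp
  intro i' j' hij' a ha b hb
  rw [Submodule.mem_comap, tensorAct_tmul M N m hx ha b]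
  exact Submodule.smul_mem _ _
    (tmul_mem_tensorGrading _ _ (by lia) (M.act_mem hm ha) (N.act_mem hx hb))

lemma tensorD_tensorAct (M : DGModule A) (N : DGModule B) {n : ℤ} {t : M.carrier ⊗[k] N.carrier}
    (ht : t ∈ tensorGrading M.grading N.grading n) (p : A.carrier ⊗[k] B.carrier) :
    tensorD M.grading M.d N.d (tensorAct M N t p) =
      tensorAct M N (tensorD M.grading M.d N.d t) p +
        koszulSign k n • tensorAct M N t (tensorD A.grading A.d B.d p) := by
  induction p using graded_tensor_induction A.grading B.grading with
  | zero => simp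
  | add p q hp hq =>
    simp only [map_add, hp, hq, smul_add]
    abel
  | tmul r a ha s b hb =>
  refine tensorGrading_le (S := LinearMap.eqLocus
    (tensorD M.grading M.d N.d ∘ₗ (tensorAct M N).flip (a ⊗ₜ b))
    ((tensorAct M N).flip (a ⊗ₜ b) ∘ₗ tensorD M.grading M.d N.d +
      koszulSign k n • (tensorAct M N).flip (tensorD A.grading A.d B.d (a ⊗ₜ b))))
    M.grading N.grading ?_ ht
  intro i j hij m hm x hx
  rw [LinearMap.mem_eqLocus]
  simp only [LinearMap.comp_apply, LinearMap.add_apply, LinearMap.smul_apply,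
    LinearMap.flip_apply]
  rw [tensorD_tmul A.grading _ _ ha, tensorD_tmul M.grading _ _ hm, tensorAct_tmul M N m hx ha,
    map_add, map_add, map_smul, map_smul, map_smul, LinearMap.add_apply, LinearMap.smul_apply,
    tensorAct_tmul M N m hx ha, tensorAct_tmul M N m hx (A.d_mem ha),
    tensorAct_tmul M N (M.d m) hx ha, tensorAct_tmul M N m (N.d_mem hx) ha,
    tensorD_tmul M.grading _ _ (M.act_mem hm ha), M.d_act hm, N.d_act hx]
  subst hij
  simp only [mul_add, add_mul, koszulSign_add, mul_one, one_mul, smul_add, smul_smul,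
    TensorProduct.add_tmul, TensorProduct.tmul_add, TensorProduct.tmul_smul,
    ← TensorProduct.smul_tmul']
  rcases koszulSign_cases (k := k) i with h1 | h1 <;>
  rcases koszulSign_cases (k := k) j with h2 | h2 <;>
  rcases koszulSign_cases (k := k) r with h3 | h3 <;>
  simp only [h1, h2, h3] <;> module

lemma gtp_mul_of_mem {i j : ℤ} (a : A.carrier) {b : B.carrier} (hb : b ∈ B.grading j)
    {a' : A.carrier} (ha' : a' ∈ A.grading i) (b' : B.carrier) :
    GradedTensorProduct.of k A.grading B.grading (a ⊗ₜ b) *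
        GradedTensorProduct.of k A.grading B.grading (a' ⊗ₜ b') =
      koszulSign k (j * i) • GradedTensorProduct.of k A.grading B.grading ((a * a') ⊗ₜ (b * b')) := by
  lift b to B.grading j using hb
  lift a' to A.grading i using ha'
  rw [← units_smul_eq_koszulSign]
  exact GradedTensorProduct.tmul_coe_mul_coe_tmul A.grading B.grading a b a' b'

/-- The multiplication of `A ⊗ B`. -/
def tensorMul (A B : DGAlgebra.{u, v} k) :
    A.carrier ⊗[k] B.carrier →ₗ[k] A.carrier ⊗[k] B.carrier →ₗ[k] A.carrier ⊗[k] B.carrier :=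
  tensorAct A.regular B.regular

lemma tensorMul_tmul {i j : ℤ} (m : A.carrier) {x : B.carrier}
    (hx : x ∈ B.grading j) {a : A.carrier} (ha : a ∈ A.grading i) (b : B.carrier) :
    tensorMul A B (m ⊗ₜ x) (a ⊗ₜ b) = koszulSign k (j * i) • ((m * a) ⊗ₜ (x * b)) :=
  tensorAct_tmul A.regular B.regular m hx ha b

lemma tensorMul_mem {n r : ℤ} {t p : A.carrier ⊗[k] B.carrier}
    (ht : t ∈ tensorGrading A.grading B.grading n)
    (hp : p ∈ tensorGrading A.grading B.grading r) :
    tensorMul A B t p ∈ tensorGrading A.grading B.grading (n + r) :=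
  tensorAct_mem A.regular B.regular ht hp

lemma tensorD_tensorMul {n : ℤ} {t : A.carrier ⊗[k] B.carrier}
    (ht : t ∈ tensorGrading A.grading B.grading n) (p : A.carrier ⊗[k] B.carrier) :
    tensorD A.grading A.d B.d (tensorMul A B t p) =
      tensorMul A B (tensorD A.grading A.d B.d t) p +
        koszulSign k n • tensorMul A B t (tensorD A.grading A.d B.d p) :=
  tensorD_tensorAct A.regular B.regular ht p

lemma gtp_mul (t p : A.carrier ⊗[k] B.carrier) :
    GradedTensorProduct.of k A.grading B.grading t *
        GradedTensorProduct.of k A.grading B.grading p =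
      GradedTensorProduct.of k A.grading B.grading (tensorMul A B t p) := by
  induction t using graded_tensor_induction A.grading B.grading with
  | zero => simp
  | add t t' ht ht' => rw [map_add, map_add, add_mul, ht, ht', LinearMap.add_apply, map_add]
  | tmul i m hm j x hx =>
  induction p using graded_tensor_induction A.grading B.grading with
  | zero => simp
  | add p q hp hq => simp only [map_add, mul_add, hp, hq]
  | tmul r a ha s b hb =>
    rw [gtp_mul_of_mem m hx ha b, tensorMul_tmul m hx ha b, map_smul]

/-- The tensor product `A ⊗ B` of dg algebras, with multiplication
`(a ⊗ b) (a' ⊗ b') = (-1)^(|b| |a'|) a a' ⊗ b b'` and differential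
`a ⊗ b ↦ d a ⊗ b + (-1)^|a| a ⊗ d b`. -/
def DGAlgebra.tensor (A B : DGAlgebra.{u, v} k) : DGAlgebra.{u, v} k where
  carrier := GradedTensorProduct k A.grading B.grading
  grading n := (tensorGrading A.grading B.grading n).map
    (GradedTensorProduct.of k A.grading B.grading).toLinearMap
  graded :=
    { gradedDecompositionMap (tensorGrading A.grading B.grading)
        (GradedTensorProduct.of k A.grading B.grading) with
      one_mem := ⟨1 ⊗ₜ 1, tmul_mem_tensorGrading _ _ (add_zero 0) SetLike.GradedOne.one_mem
        SetLike.GradedOne.one_mem, rfl⟩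
      mul_mem := by
        rintro n r _ _ ⟨t, ht, rfl⟩ ⟨p, hp, rfl⟩
        exact ⟨_, tensorMul_mem ht hp, (gtp_mul t p).symm⟩ }
  d := (GradedTensorProduct.of k A.grading B.grading).toLinearMap ∘ₗ tensorD A.grading A.d B.d ∘ₗ
    (GradedTensorProduct.of k A.grading B.grading).symm.toLinearMap
  d_mem := by
    rintro n _ ⟨t, ht, rfl⟩
    exact ⟨_, tensorD_mem A.regular B.regular ht, rfl⟩
  d_d t := congrArg (GradedTensorProduct.of k A.grading B.grading)
    (tensorD_tensorD A.regular B.regular _)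
  d_mul := by
    rintro n _ ⟨t, ht, rfl⟩ q
    obtain ⟨p, rfl⟩ := (GradedTensorProduct.of k A.grading B.grading).surjective q
    have h := congrArg (GradedTensorProduct.of k A.grading B.grading)
      (tensorD_tensorMul ht p)
    rw [map_add, map_smul, ← gtp_mul, ← gtp_mul] at h
    refine Eq.trans ?_ h
    exact congrArg (fun y => GradedTensorProduct.of k A.grading B.grading
      (tensorD A.grading A.d B.d ((GradedTensorProduct.of k A.grading B.grading).symm y)))
      (gtp_mul t p)

lemma tensorAct_one (M : DGModule A) (N : DGModule B) (t : M.carrier ⊗[k] N.carrier) :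
    tensorAct M N t (1 ⊗ₜ 1) = t := by
  induction t using graded_tensor_induction M.grading N.grading with
  | zero => simp
  | add t t' ht ht' => simp only [map_add, ht, ht', LinearMap.add_apply]
  | tmul i m hm j x hx =>
    rw [tensorAct_tmul M N m hx (SetLike.GradedOne.one_mem : (1 : A.carrier) ∈ A.grading 0),
      M.act_one, N.act_one]
    simp

lemma tensorAct_tensorAct (M : DGModule A) (N : DGModule B) (t : M.carrier ⊗[k] N.carrier)
    (p q : A.carrier ⊗[k] B.carrier) :
    tensorAct M N t (tensorMul A B p q) =
      tensorAct M N (tensorAct M N t p) q := by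
  induction t using graded_tensor_induction M.grading N.grading with
  | zero => simp
  | add t t' ht ht' => simp only [map_add, ht, ht', LinearMap.add_apply]
  | tmul i m hm j x hx =>
  induction p using graded_tensor_induction A.grading B.grading with
  | zero => simp
  | add p q hp hq => simp only [map_add, hp, hq, LinearMap.add_apply]
  | tmul r a ha s b hb =>
  induction q using graded_tensor_induction A.grading B.grading with
  | zero => simp
  | add p q hp hq => simp only [map_add, hp, hq]
  | tmul r' a' ha' s' b' hb' =>
    rw [tensorMul_tmul a hb ha' b', map_smul, tensorAct_tmul M N m hx ha b,
      map_smul, LinearMap.smul_apply, tensorAct_tmul M N (M.act m a) (N.act_mem hx hb) ha' b']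
    rw [tensorAct_tmul M N m hx (SetLike.mul_mem_graded ha ha') (b * b'), M.act_mul, N.act_mul]
    simp only [mul_add, add_mul, koszulSign_add, smul_smul]
    congr 1
    ring

/-- The external product `M ⊠ N = M ⊗ N`, a right dg module over `A ⊗ B`, with action
`(m ⊗ x) (a ⊗ b) = (-1)^(|x| |a|) m a ⊗ x b` and differential
`m ⊗ x ↦ d m ⊗ x + (-1)^|m| m ⊗ d x`. -/
def DGModule.box (M : DGModule A) (N : DGModule B) : DGModule (A.tensor B) where
  carrier := M.carrier ⊗[k] N.carrier
  grading := tensorGrading M.grading N.grading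
  act := (tensorAct M N).compl₂ (GradedTensorProduct.of k A.grading B.grading).symm.toLinearMap
  act_one := tensorAct_one M N
  act_mul t p q := by
    obtain ⟨p, rfl⟩ := (GradedTensorProduct.of k A.grading B.grading).surjective p
    obtain ⟨q, rfl⟩ := (GradedTensorProduct.of k A.grading B.grading).surjective q
    exact (congrArg (fun y => tensorAct M N t
      ((GradedTensorProduct.of k A.grading B.grading).symm y)) (gtp_mul p q)).trans
      (tensorAct_tensorAct M N t p q)
  act_mem := by
    rintro n r t _ ht ⟨p, hp, rfl⟩
    exact tensorAct_mem M N ht hp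
  d := tensorD M.grading M.d N.d
  d_mem := tensorD_mem M N
  d_d := tensorD_tensorD M N
  d_act ht p := tensorD_tensorAct M N ht _

end Tensor

/-! ### The diagonal bimodule -/

namespace DGAlgebra

variable (A : DGAlgebra.{u, v} k)

/-- The identity map `A → A^op` of graded vector spaces. -/
def toOp : A.carrier ≃ₗ[k] A.op.carrier := LinearEquiv.refl k A.carrier

lemma toOp_mem {i : ℤ} {a : A.carrier} : A.toOp a ∈ A.op.grading i ↔ a ∈ A.grading i := Iff.rfl

lemma toOp_mul (a b : A.carrier) : A.toOp a * A.toOp b = A.toOp (A.opMul a b) := rfl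

lemma toOp_d (a : A.carrier) : A.op.d (A.toOp a) = A.toOp (A.d a) := rfl

/-- The right action `m (a ⊗ b) = (-1)^(|a| |m|) a m b` of `A^op ⊗ A` on `A`. -/
def diagonalAct : A.carrier →ₗ[k] A.op.carrier ⊗[k] A.carrier →ₗ[k] A.carrier :=
  (TensorProduct.lift (LinearMap.mk₂ k
    (fun a b => LinearMap.mulRight k b ∘ₗ A.opMul.flip (A.toOp.symm a))
    (by intros; ext; simp [add_mul]) (by intros; ext; simp)
    (by intros; ext; simp [mul_add]) (by intros; ext; simp))).flip

lemma diagonalAct_tmul (m a b : A.carrier) :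
    A.diagonalAct m (A.toOp a ⊗ₜ b) = A.opMul m a * b := by
  simp [diagonalAct]

lemma diagonalAct_of_mem {i r : ℤ} {m a : A.carrier} (hm : m ∈ A.grading i)
    (ha : a ∈ A.grading r) (b : A.carrier) :
    A.diagonalAct m (A.toOp a ⊗ₜ b) = koszulSign k (i * r) • (a * m * b) := by
  rw [diagonalAct_tmul, opMul_of_mem hm ha, smul_mul_assoc]

lemma diagonalAct_mul (m : A.carrier) (p q : A.op.carrier ⊗[k] A.carrier) :
    A.diagonalAct m (tensorMul A.op A p q) = A.diagonalAct (A.diagonalAct m p) q := by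
  induction m using Decomposition.inductionOn A.grading with
  | zero => simp
  | add m m' hm hm' => simp only [map_add, hm, hm', LinearMap.add_apply]
  | @homogeneous i m =>
  induction p using graded_tensor_induction A.op.grading A.grading with
  | zero => simp
  | add p q hp hq => simp only [map_add, hp, hq, LinearMap.add_apply]
  | tmul r a ha s b hb =>
  induction q using graded_tensor_induction A.op.grading A.grading with
  | zero => simp
  | add p q hp hq => simp only [map_add, hp, hq]
  | tmul r' a' ha' s' b' hb' =>
    obtain ⟨a, rfl⟩ := A.toOp.surjective a
    obtain ⟨a', rfl⟩ := A.toOp.surjective a'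
    rw [toOp_mem] at ha ha'
    rw [tensorMul_tmul (A.toOp a) hb (A.toOp_mem.2 ha') b', map_smul, toOp_mul,
      opMul_of_mem ha ha', A.diagonalAct_of_mem m.2 ha b, map_smul A.diagonalAct,
      LinearMap.smul_apply, A.diagonalAct_of_mem (SetLike.mul_mem_graded (SetLike.mul_mem_graded ha m.2) hb) ha' b',
      map_smul, ← TensorProduct.smul_tmul', map_smul,
      A.diagonalAct_of_mem m.2 (SetLike.mul_mem_graded ha' ha)]
    simp only [mul_add, add_mul, koszulSign_add, smul_smul, mul_assoc]
    congr 1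
    ring

lemma diagonalAct_mem {n r : ℤ} {m : A.carrier} {p : A.op.carrier ⊗[k] A.carrier}
    (hm : m ∈ A.grading n) (hp : p ∈ tensorGrading A.op.grading A.grading r) :
    A.diagonalAct m p ∈ A.grading (n + r) := by
  refine tensorGrading_le (S := (A.grading (n + r)).comap (A.diagonalAct m))
    A.op.grading A.grading ?_ hp
  intro i j hij a ha b hb
  obtain ⟨a, rfl⟩ := A.toOp.surjective a
  rw [toOp_mem] at ha
  rw [Submodule.mem_comap, A.diagonalAct_of_mem hm ha b]
  have := SetLike.mul_mem_graded (SetLike.mul_mem_graded ha hm) hb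
  rw [show i + n + j = n + r by lia] at this
  exact Submodule.smul_mem _ _ this

lemma d_diagonalAct {n : ℤ} {m : A.carrier} (hm : m ∈ A.grading n)
    (p : A.op.carrier ⊗[k] A.carrier) :
    A.d (A.diagonalAct m p) = A.diagonalAct (A.d m) p +
      koszulSign k n • A.diagonalAct m (tensorD A.op.grading A.op.d A.d p) := by
  induction p using graded_tensor_induction A.op.grading A.grading with
  | zero => simp
  | add p q hp hq =>
    simp only [map_add, hp, hq, smul_add]
    abel
  | tmul r a ha s b hb =>
    obtain ⟨a, rfl⟩ := A.toOp.surjective a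
    rw [tensorD_tmul A.op.grading _ _ ha, toOp_d]
    rw [toOp_mem] at ha
    rw [A.diagonalAct_of_mem hm ha b, A.diagonalAct_of_mem (A.d_mem hm) ha b, map_add, map_smul,
      A.diagonalAct_of_mem hm (A.d_mem ha) b, map_smul (A.diagonalAct m),
      A.diagonalAct_of_mem hm ha (A.d b),
      A.d_mul (SetLike.mul_mem_graded ha hm), A.d_mul ha]
    simp only [mul_add, add_mul, koszulSign_add, mul_one, one_mul, smul_add, smul_smul,
      smul_mul_assoc]
    rcases koszulSign_cases (k := k) n with h1 | h1 <;>
    rcases koszulSign_cases (k := k) r with h2 | h2 <;>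
    simp only [h1, h2] <;> module

/-- The diagonal bimodule: `A` as a right dg module over `A^op ⊗ A`, with action
`m (a ⊗ b) = (-1)^(|a| |m|) a m b`. -/
def diagonal : DGModule (A.op.tensor A) where
  carrier := A.carrier
  grading := A.grading
  act := A.diagonalAct.compl₂ (GradedTensorProduct.of k A.op.grading A.grading).symm.toLinearMap
  act_one m := by
    refine (A.diagonalAct_tmul m 1 1).trans ?_
    rw [opMul_one, mul_one]
  act_mul m p q := by
    obtain ⟨p, rfl⟩ := (GradedTensorProduct.of k A.op.grading A.grading).surjective p
    obtain ⟨q, rfl⟩ := (GradedTensorProduct.of k A.op.grading A.grading).surjective q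
    exact (congrArg (fun y => A.diagonalAct m
      ((GradedTensorProduct.of k A.op.grading A.grading).symm y)) (gtp_mul p q)).trans
      (A.diagonalAct_mul m p q)
  act_mem := by
    rintro n r m _ hm ⟨p, hp, rfl⟩
    exact A.diagonalAct_mem hm hp
  d := A.d
  d_mem := A.d_mem
  d_d := A.d_d
  d_act hm p := A.d_diagonalAct hm _

end DGAlgebra

end

/-! ### The derived category -/

section Derived

variable {k : Type u} [Field k]

/-- The derived category `D(A)`: the category of right dg modules over `A` with the
quasi-isomorphisms formally inverted. The shift functors are induced by those of dg modules. -/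
abbrev DerivedCat (A : DGAlgebra.{u, v} k) := (DGModule.quasiIso A).Localization

/-- A dg module, viewed as an object of the derived category. -/
abbrev DGModule.toD {A : DGAlgebra.{u, v} k} (M : DGModule A) : DerivedCat A :=
  (DGModule.quasiIso A).Q.obj M

namespace DerivedCat

variable {A : DGAlgebra.{u, v} k}

/-- The distinguished triangles of `D(A)`: those isomorphic to the image of a standard triangle
`M ⟶ N ⟶ cone f ⟶ M[1]`. -/
def IsDistinguished (T : Pretriangulated.Triangle (DerivedCat A)) : Prop :=
  ∃ (M N : DGModule A) (f : M ⟶ N),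
    Nonempty (T ≅ (DGModule.quasiIso A).Q.mapTriangle.obj (DGModule.coneTriangle f))

/-- `P ⋆ Q`: the objects `F` in a distinguished triangle `X ⟶ F ⟶ Y ⟶ X[1]` with `X` in `P` and
`Y` in `Q`. -/
def star (P Q : ObjectProperty (DerivedCat A)) : ObjectProperty (DerivedCat A) := fun F =>
  ∃ (X Y : DerivedCat A) (f : X ⟶ F) (g : F ⟶ Y) (h : Y ⟶ X⟦(1 : ℤ)⟧),
    IsDistinguished (Pretriangulated.Triangle.mk f g h) ∧ P X ∧ Q Y

/-- `[E]_0`: the finite direct sums (coproducts in `D(A)`) of shifts of `E`. -/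
def sumsOfShifts (E : DerivedCat A) : ObjectProperty (DerivedCat A) := fun X =>
  ∃ (r : ℕ) (s : Fin r → ℤ) (c : Limits.Cofan fun j => E⟦s j⟧),
    Nonempty (Limits.IsColimit c) ∧ Nonempty (c.pt ≅ X)

/-- `[E]_n = [E]_0 ⋆ ⋯ ⋆ [E]_0`, with `n + 1` factors. -/
def extensionsOf (E : DerivedCat A) : ℕ → ObjectProperty (DerivedCat A)
  | 0 => sumsOfShifts E
  | n + 1 => star (sumsOfShifts E) (extensionsOf E n)

/-- `⟨E⟩_n`: the direct summands of the objects of `[E]_n`. -/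
def generated (E : DerivedCat A) (n : ℕ) : ObjectProperty (DerivedCat A) := fun X =>
  ∃ Y, extensionsOf E n Y ∧ Nonempty (Retract X Y)

/-- Thick triangulated subcategories, as properties of objects: they contain the zero objects and
are closed under shifts, extensions and direct summands (hence under isomorphisms and cones). -/
structure IsThick (P : ObjectProperty (DerivedCat A)) : Prop where
  zero : ∀ X, Limits.IsZero X → P X
  shift : ∀ X (m : ℤ), P X → P (X⟦m⟧)
  ext : ∀ T, IsDistinguished T → P T.obj₁ → P T.obj₃ → P T.obj₂
  summand : ∀ X Y, Retract X Y → P Y → P X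

/-- The smallest thick triangulated subcategory containing the objects of `S`. -/
def thickClosure (S : ObjectProperty (DerivedCat A)) : ObjectProperty (DerivedCat A) := fun X =>
  ∀ P : ObjectProperty (DerivedCat A), IsThick P → S ≤ P → P X

variable (A) in
/-- `Perf(A)`: the thick triangulated subcategory of `D(A)` generated by the dg module `A`. -/
def perf : ObjectProperty (DerivedCat A) := thickClosure fun X => X = A.regular.toD

end DerivedCat

open DerivedCat

/-- A dg algebra `A` is (homologically) smooth if the diagonal bimodule is in
`Perf(A^op ⊗ A)`. -/
def DGAlgebra.IsSmooth (A : DGAlgebra.{u, v} k) : Prop :=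
  perf (A.op.tensor A) A.diagonal.toD

/-- The diagonal dimension `Ddim Perf(A)`: the least `n` for which there are `F` in `Perf(A^op)`
and `G` in `Perf(A)` with the diagonal bimodule in `⟨F ⊠ G⟩_n`, and `∞` if there is none. As `k` is
a field, `F ⊠ G` is computed by the tensor product of dg modules representing `F` and `G`. -/
def DGAlgebra.Ddim (A : DGAlgebra.{u, v} k) : ℕ∞ :=
  ⨅ n ∈ {n : ℕ | ∃ (F : DGModule A.op) (G : DGModule A),
    perf A.op F.toD ∧ perf A G.toD ∧ generated (F.box G).toD n A.diagonal.toD}, (n : ℕ∞)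

variable {A : DGAlgebra.{u, v} k}

/-- `E` is exceptional: `Hom(E, E) = k` (every endomorphism in `D(A)` is a unique scalar), and
`Hom(E, E[m]) = 0` for `m ≠ 0`. -/
structure DGModule.IsExceptional (E : DGModule A) : Prop where
  end_eq : Function.Bijective fun c : k => (DGModule.quasiIso A).Q.map (E.scalar c)
  hom_eq_zero : ∀ m : ℤ, m ≠ 0 → Subsingleton (E.toD ⟶ E.toD⟦m⟧)

/-- The objects `E i j` (`0 ≤ i ≤ n`, `1 ≤ j ≤ d i`) form a full exceptional collection in
`Perf(A)` with blocks `E i 1, …, E i (d i)`: each object is exceptional, different objects in the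
same block are mutually orthogonal, there are no nonzero morphisms (of any degree) from a later
block to an earlier one, and the objects generate `Perf(A)`. -/
structure IsFullExceptionalCollection {n : ℕ} {d : Fin (n + 1) → ℕ}
    (E : ∀ i : Fin (n + 1), Fin (d i) → DGModule A) : Prop where
  perfect : ∀ i j, perf A (E i j).toD
  exceptional : ∀ i j, (E i j).IsExceptional
  orthogonal : ∀ i j j', j ≠ j' → ∀ m : ℤ, Subsingleton ((E i j).toD ⟶ (E i j').toD⟦m⟧)
  semiorthogonal : ∀ i i', i < i' → ∀ j j', ∀ m : ℤ,
    Subsingleton ((E i' j').toD ⟶ (E i j).toD⟦m⟧)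
  full : ∀ X, perf A X → thickClosure (fun Y => ∃ i j, Y = (E i j).toD) X

end Derived

end

/-!
The diagonal bimodule is resolved by projecting it away from one block of the exceptional
collection after the other, starting with the last block. Each projection is the cone of a
morphism out of a sum of external products, and `n + 1` projections annihilate the diagonal.

Let `P_q` be `K`-projective resolutions of the exceptional objects (`exists_kproj`, by the bar
resolution). For a dg module `N` over `Aᵒᵖ ⊗ A`, the complex `Hom_A(P_q, N)` is a dg module over
`Aᵒᵖ`, and the projection of `N` away from a block is the cone of the evaluation `⨁ Hom_A(P_q, N)
⊠ P_q → N`, summed over the objects of the block (`blockCone`). Since `k` is a field, external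
products preserve acyclicity, so that all constructions are dg functors on dg modules that descend
to the derived categories (`DGFun`), and no derived functors are needed.

On bimodules of the form `V ⊠ P_q` the projections can be computed, because perfect dg modules are
compact. The form of compactness used here is `isCompactFor_of_perf`: every morphism from a
perfect dg module to `V ⊠ X` is fixed by an endomorphism of finite rank of the complex `V`. It is
evident for the free module of rank one, and is inherited by shifts, cones and summands. As a
consequence `Hom_A(P, V ⊠ X)` is acyclic if `P` is perfect and has no morphisms to the shifts of
`X` (`acyclic_homModule_box`), and it is `V` if `P = X` is exceptional
(`IsExc.quasiIso_constHom`). So a projection fixes `V ⊠ P_q` as long as the blocks projected away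
lie to the right of the block of `P_q` (`tower_iso`), and the projection away from the block of
`P_q` annihilates it (`tower_acyclic`).

By smoothness, the diagonal belongs to the thick subcategory generated by the free bimodule `A ⊠
A`, and by fullness the latter belongs to the one generated by the `A ⊠ P_q`. As the projections
are exact, this transfers two properties from `A ⊠ P_q` to the diagonal (`diagonal_of_box`): its
image `M_{n+1}` under all the projections is acyclic, and all coefficients `Hom_A(P_q, M_s)` of
the intermediate images `M_s` are perfect over `Aᵒᵖ`.

Let `F` be the direct sum of all these coefficients and `G` the direct sum of all `P_q`. Then
`M_{s+1}` is the cone of a morphism `K_s → M_s`, where `K_s` is a direct summand of `Z = F ⊠ G`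
(`exists_retract_box`). As `M_{n+1}` vanishes, this exhibits the diagonal `M_0` as an extension of
the `n + 1` objects `K_0, …, K_n`. To obtain an extension of copies of `Z` itself, the complement
of `K_s` in `Z` is added to both source and target of `K_s → M_s`, which does not change the cone
(`quasiIso_stepProj`); hence the diagonal is a direct summand of an `n`-fold extension of copies
of `Z` (`exists_extensionsOf`).
-/

noncomputable section

open CategoryTheory DirectSum TensorProduct

namespace DGModule

variable {k : Type u} [Field k] {A B : DGAlgebra.{u, v} k}

/-! ### Homogeneous linear maps between dg modules -/

lemma homogeneous_induction (M : DGModule A) {p : M.carrier → Prop} (m : M.carrier) (zero : p 0)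
    (hom : ∀ i, ∀ m ∈ M.grading i, p m) (add : ∀ m m', p m → p m' → p (m + m')) : p m := by
  induction m using Decomposition.inductionOn M.grading with
  | zero => exact zero
  | @homogeneous i m => exact hom i m m.2
  | add a b ha hb => exact add _ _ ha hb

/-- The `A`-linear maps `M → N` that are homogeneous of degree `r`. -/
structure IsDeg (M N : DGModule A) (r : ℤ) (f : M.carrier →ₗ[k] N.carrier) : Prop where
  mem : ∀ {i : ℤ} {m : M.carrier}, m ∈ M.grading i → f m ∈ N.grading (i + r)
  act : ∀ m a, f (M.act m a) = N.act (f m) a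

namespace IsDeg

variable {M N K : DGModule A} {r s : ℤ} {f f' : M.carrier →ₗ[k] N.carrier}
  {g : N.carrier →ₗ[k] K.carrier}

lemma mem' (hf : IsDeg M N r f) {i j : ℤ} (h : i + r = j) {m : M.carrier}
    (hm : m ∈ M.grading i) : f m ∈ N.grading j := h ▸ hf.mem hm

lemma cast (hf : IsDeg M N r f) (h : r = s) : IsDeg M N s f := h ▸ hf

lemma id (M : DGModule A) : IsDeg M M 0 LinearMap.id := ⟨fun h => by simpa using h, fun _ _ => rfl⟩

lemma zero : IsDeg M N r 0 := ⟨fun _ => zero_mem _, fun m a => by simp⟩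

lemma comp (hg : IsDeg N K s g) (hf : IsDeg M N r f) : IsDeg M K (r + s) (g ∘ₗ f) :=
  ⟨fun h => hg.mem' (by ring) (hf.mem h), fun m a => by simp [hf.act, hg.act]⟩

lemma add (hf : IsDeg M N r f) (hf' : IsDeg M N r f') : IsDeg M N r (f + f') :=
  ⟨fun h => add_mem (hf.mem h) (hf'.mem h), fun m a => by simp [hf.act, hf'.act]⟩

lemma smul (hf : IsDeg M N r f) (c : k) : IsDeg M N r (c • f) :=
  ⟨fun h => Submodule.smul_mem _ _ (hf.mem h), fun m a => by simp [hf.act]⟩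

lemma neg (hf : IsDeg M N r f) : IsDeg M N r (-f) :=
  ⟨fun h => neg_mem (hf.mem h), fun m a => by simp [hf.act]⟩

lemma sub (hf : IsDeg M N r f) (hf' : IsDeg M N r f') : IsDeg M N r (f - f') :=
  ⟨fun h => sub_mem (hf.mem h) (hf'.mem h), fun m a => by simp [hf.act, hf'.act]⟩

end IsDeg

lemma Hom.isDeg {M N : DGModule A} (f : M ⟶ N) : IsDeg M N 0 f.f :=
  ⟨fun h => by simpa using f.map_mem h, f.map_act⟩

/-- The differential `f ↦ d f - (-1)^r f d` on maps of degree `r`. -/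
def homD (M N : DGModule A) (r : ℤ) (f : M.carrier →ₗ[k] N.carrier) :
    M.carrier →ₗ[k] N.carrier :=
  N.d ∘ₗ f - koszulSign k r • (f ∘ₗ M.d)

section homD

variable {M N K : DGModule A} {r s : ℤ} {f f' : M.carrier →ₗ[k] N.carrier}
  {g : N.carrier →ₗ[k] K.carrier}

lemma homD_apply (m : M.carrier) :
    homD M N r f m = N.d (f m) - koszulSign k r • f (M.d m) := rfl

lemma homD_add : homD M N r (f + f') = homD M N r f + homD M N r f' := by
  ext m; simp [homD_apply]; abel

lemma homD_sub : homD M N r (f - f') = homD M N r f - homD M N r f' := by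
  ext m; simp [homD_apply, smul_sub]; abel

lemma homD_neg : homD M N r (-f) = -homD M N r f := by
  ext m; simp [homD_apply]; abel

lemma homD_smul (c : k) : homD M N r (c • f) = c • homD M N r f := by
  ext m; simp [homD_apply, smul_sub, smul_comm c]

lemma homD_zero : homD M N r 0 = 0 := by
  ext m; simp [homD_apply]

lemma homD_comp : homD M K (r + s) (g ∘ₗ f) =
    homD N K s g ∘ₗ f + koszulSign k s • (g ∘ₗ homD M N r f) := by
  ext m
  simp only [homD_apply, LinearMap.add_apply, LinearMap.smul_apply, LinearMap.comp_apply,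
    map_sub, map_smul, smul_sub, smul_smul, koszulSign_add, mul_comm]
  abel

lemma homD_homD : homD M N (r + 1) (homD M N r f) = 0 := by
  ext m
  simp only [homD_apply, map_sub, map_smul, M.d_d, N.d_d, koszulSign_add, koszulSign_one]
  simp

lemma isDeg_homD (hf : IsDeg M N r f) : IsDeg M N (r + 1) (homD M N r f) where
  mem {i m} h := by
    have h1 := N.d_mem (hf.mem h)
    have h2 := hf.mem (M.d_mem h)
    rw [show i + 1 + r = i + (r + 1) by ring] at h2
    rw [add_assoc] at h1
    exact sub_mem h1 (Submodule.smul_mem _ _ h2)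
  act m a := by
    induction m using homogeneous_induction with
    | zero => simp
    | add m m' h h' => simp only [map_add, LinearMap.add_apply, h, h']
    | hom i m hm =>
      simp only [homD_apply, hf.act, M.d_act hm, N.d_act (hf.mem hm), map_add, map_smul,
        map_sub, LinearMap.sub_apply, LinearMap.smul_apply, smul_add, smul_smul, koszulSign_add,
        mul_comm]
      abel

lemma Hom.homD_eq_zero (f : M ⟶ N) : homD M N 0 f.f = 0 := by
  ext m; simp [homD_apply, f.map_d]

/-- A closed map of degree zero is a morphism of dg modules. -/
def mkHom (hf : IsDeg M N 0 f) (h : homD M N 0 f = 0) : M ⟶ N where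
  f := f
  map_mem hm := hf.mem' (add_zero _) hm
  map_act := hf.act
  map_d m := by
    have := LinearMap.congr_fun h m
    simp only [homD_apply, koszulSign_zero, one_smul, LinearMap.zero_apply, sub_eq_zero] at this
    exact this.symm

@[simp] lemma mkHom_f (hf : IsDeg M N 0 f) (h : homD M N 0 f = 0) : (mkHom hf h).f = f := rfl

lemma d_of_homD_eq_zero (h : homD M N r f = 0) (m : M.carrier) :
    N.d (f m) = koszulSign k r • f (M.d m) := by
  have := LinearMap.congr_fun h m
  rwa [homD_apply, LinearMap.zero_apply, sub_eq_zero] at this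

end homD

/-! ### Homogeneous components and acyclicity -/

/-- The projection to the component of degree `i`. -/
def proj (M : DGModule A) (i : ℤ) : M.carrier →ₗ[k] M.carrier :=
  (M.grading i).subtype ∘ₗ DirectSum.component k ℤ (fun i => M.grading i) i ∘ₗ
    (decomposeLinearEquiv M.grading).toLinearMap

lemma proj_apply (M : DGModule A) (i : ℤ) (m : M.carrier) :
    M.proj i m = decompose M.grading m i := rfl

lemma proj_mem (M : DGModule A) (i : ℤ) (m : M.carrier) : M.proj i m ∈ M.grading i := by
  simp [proj]

lemma proj_of_mem (M : DGModule A) {i : ℤ} {m : M.carrier} (h : m ∈ M.grading i) :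
    M.proj i m = m := by
  rw [proj_apply, decompose_of_mem_same M.grading h]

lemma proj_of_mem_ne (M : DGModule A) {i j : ℤ} {m : M.carrier} (h : m ∈ M.grading i)
    (hij : i ≠ j) : M.proj j m = 0 := by
  rw [proj_apply, decompose_of_mem_ne M.grading h hij]

lemma map_proj {M : DGModule A} {N : DGModule B} {r : ℤ} {f : M.carrier →ₗ[k] N.carrier}
    (hf : ∀ i, ∀ m ∈ M.grading i, f m ∈ N.grading (i + r)) (i : ℤ) (m : M.carrier) :
    f (M.proj i m) = N.proj (i + r) (f m) := by
  induction m using homogeneous_induction with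
  | zero => simp
  | add m m' h h' => simp only [map_add, h, h']
  | hom j m hm =>
    by_cases h : j = i
    · subst h
      rw [proj_of_mem M hm, proj_of_mem N (hf _ _ hm)]
    · rw [proj_of_mem_ne M hm h, proj_of_mem_ne N (hf _ _ hm) (by simpa using h), map_zero]

lemma d_proj (M : DGModule A) (i : ℤ) (m : M.carrier) :
    M.d (M.proj i m) = M.proj (i + 1) (M.d m) :=
  map_proj (f := M.d) (fun _ _ h => M.d_mem h) i m

/-- A dg module is acyclic if every cocycle is a coboundary. -/
def Acyclic (M : DGModule A) : Prop := ∀ m, M.d m = 0 → ∃ n, M.d n = m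

lemma Acyclic.exists_mem {M : DGModule A} (hM : M.Acyclic) {i j : ℤ} (hij : i + 1 = j)
    {m : M.carrier} (hm : m ∈ M.grading j) (h : M.d m = 0) : ∃ n ∈ M.grading i, M.d n = m := by
  obtain ⟨n, rfl⟩ := hM m h
  exact ⟨M.proj i n, M.proj_mem i n, by rw [d_proj, hij, proj_of_mem M hm]⟩

lemma acyclic_of_homogeneous {M : DGModule A}
    (h : ∀ i, ∀ m ∈ M.grading i, M.d m = 0 → ∃ n, M.d n = m) : M.Acyclic := by
  intro m hm
  have key : ∀ i, ∃ n, M.d n = M.proj i m := fun i => by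
    refine h i _ (M.proj_mem i m) ?_
    rw [d_proj, hm, map_zero]
  have hs : m ∈ LinearMap.range M.d := by
    classical
    rw [← DirectSum.sum_support_decompose M.grading m]
    refine Submodule.sum_mem _ fun i _ => ?_
    obtain ⟨n, hn⟩ := key i
    exact ⟨n, by rw [hn]; rfl⟩
  exact hs

lemma acyclic_of_homotopy {M : DGModule A} (h : M.carrier →ₗ[k] M.carrier)
    (H : ∀ m, M.d (h m) + h (M.d m) = m) : M.Acyclic := fun m hm => ⟨h m, by
  have := H m
  rwa [hm, map_zero, add_zero] at this⟩

lemma quasiIso_iff_acyclic_cone {M N : DGModule A} (f : M ⟶ N) :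
    quasiIso A f ↔ (cone f).Acyclic := by
  have hd : ∀ (m : M.carrier) (n : N.carrier), (cone f).d (m, n) = (-M.d m, f.f m + N.d n) :=
    fun _ _ => rfl
  constructor
  · intro hf
    refine acyclic_of_homogeneous ?_
    rintro i ⟨m, n⟩ ⟨hm, hn⟩ h
    change m ∈ M.grading (i + 1) at hm
    change n ∈ N.grading i at hn
    obtain ⟨h1, h2⟩ := Prod.mk_eq_zero.1 h
    replace h1 : -M.d m = 0 := h1
    replace h2 : f.f m + N.d n = 0 := h2
    rw [neg_eq_zero] at h1
    obtain ⟨m', hm', rfl⟩ := ((bijective_cohomologyMap_iff f (i + 1)).1 (hf _)).1 m ⟨hm, h1⟩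
      ⟨-n, by simpa using neg_mem hn, by rw [map_neg]; exact (eq_neg_of_add_eq_zero_left h2).symm⟩
    have hm'' : m' ∈ M.grading i := by simpa using hm'
    obtain ⟨x, hx, y, hy, hxy⟩ := ((bijective_cohomologyMap_iff f i).1 (hf _)).2 (n + f.f m')
      ⟨add_mem hn (f.map_mem hm''), by
        change N.d _ = 0
        rw [map_add, ← f.map_d, add_comm, h2]⟩
    refine ⟨(x - m', -y), ?_⟩
    have hx2 : M.d x = 0 := hx.2
    rw [hd, map_sub, hx2, map_sub, map_neg, hxy]
    simp
    rfl
  · intro hc i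
    rw [bijective_cohomologyMap_iff]
    constructor
    · rintro m ⟨hm, hdm⟩ ⟨n, hn, hfn⟩
      change M.d m = 0 at hdm
      have hmem : ((m, -n) : M.carrier × N.carrier) ∈ (cone f).grading (i - 1) :=
        ⟨by simpa using hm, by simpa using hn⟩
      obtain ⟨⟨x, y⟩, hxy, h⟩ := hc.exists_mem (i := i - 1 - 1) (by ring) hmem (by
        rw [hd, hdm, ← hfn, map_neg, neg_zero, add_neg_cancel]; rfl)
      rw [hd] at h
      refine ⟨-x, ?_, by rw [map_neg]; exact congrArg Prod.fst h⟩
      have := hxy.1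
      simpa using this
    · rintro n ⟨hn, hdn⟩
      change N.d n = 0 at hdn
      have hmem : ((0, n) : M.carrier × N.carrier) ∈ (cone f).grading i := ⟨zero_mem _, hn⟩
      obtain ⟨⟨x, y⟩, hxy, h⟩ := hc.exists_mem (i := i - 1) (by ring) hmem (by
        rw [hd, hdn, map_zero, map_zero, neg_zero, add_zero]; rfl)
      replace h : -M.d x = 0 ∧ f.f x + N.d y = n := Prod.mk.inj h
      rw [neg_eq_zero] at h
      refine ⟨x, ⟨by simpa using hxy.1, h.1⟩, -y, neg_mem hxy.2, ?_⟩
      rw [map_neg, ← h.2]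
      abel

/-- The differential of a dg module over a field has a generalized inverse of degree `-1`. -/
lemma exists_d_h_d (M : DGModule A) : ∃ h : M.carrier →ₗ[k] M.carrier,
    (∀ i, ∀ m ∈ M.grading i, h m ∈ M.grading (i - 1)) ∧ ∀ m, M.d (h (M.d m)) = M.d m := by
  obtain ⟨g, hg⟩ := LinearMap.exists_rightInverse_of_surjective M.d.rangeRestrict
    (LinearMap.range_rangeRestrict _)
  obtain ⟨s, hs⟩ := LinearMap.exists_extend g
  have hsd : ∀ m, M.d (s (M.d m)) = M.d m := fun m => by
    have h1 := LinearMap.congr_fun hs ⟨M.d m, m, rfl⟩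
    have h2 := congrArg Subtype.val (LinearMap.congr_fun hg ⟨M.d m, m, rfl⟩)
    simp only [LinearMap.comp_apply, Submodule.subtype_apply] at h1
    rw [h1]
    exact h2
  have hm : ∀ i, ∀ m ∈ M.grading i, gradedGlue M.grading
      (fun i => M.proj (i - 1) ∘ₗ s ∘ₗ (M.grading i).subtype) m = M.proj (i - 1) (s m) :=
    fun i m hm => gradedGlue_of_mem M.grading _ hm
  refine ⟨gradedGlue M.grading fun i => M.proj (i - 1) ∘ₗ s ∘ₗ (M.grading i).subtype, ?_, ?_⟩
  · intro i m h
    rw [hm i m h]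
    exact M.proj_mem _ _
  · intro m
    induction m using homogeneous_induction with
    | zero => simp
    | add m m' h h' => simp only [map_add, h, h']
    | hom i m h =>
      rw [hm _ _ (M.d_mem h), d_proj, hsd, sub_add_cancel, proj_of_mem M (M.d_mem h)]

/-- Acyclic dg modules over a field are contractible as complexes of vector spaces. -/
lemma Acyclic.exists_contraction {M : DGModule A} (hM : M.Acyclic) :
    ∃ h : M.carrier →ₗ[k] M.carrier, (∀ i, ∀ m ∈ M.grading i, h m ∈ M.grading (i - 1)) ∧
      ∀ m, M.d (h m) + h (M.d m) = m := by
  obtain ⟨h, h1, h2⟩ := M.exists_d_h_d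
  refine ⟨h + h ∘ₗ (LinearMap.id - M.d ∘ₗ h - h ∘ₗ M.d), ?_, ?_⟩
  · intro i m hm
    refine add_mem (h1 i m hm) (h1 i _ (sub_mem (sub_mem hm ?_) ?_))
    · have := M.d_mem (h1 i m hm)
      rwa [sub_add_cancel] at this
    · have := h1 _ _ (M.d_mem hm)
      rwa [add_sub_cancel_right] at this
  · intro m
    obtain ⟨n, hn⟩ := hM (m - M.d (h m) - h (M.d m)) (by simp [M.d_d, h2])
    have h3 : M.d (h (m - M.d (h m) - h (M.d m))) = m - M.d (h m) - h (M.d m) := by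
      rw [← hn, h2]
    have h4 : M.d m - M.d (h (M.d m)) - h (M.d (M.d m)) = 0 := by simp [M.d_d, h2]
    simp only [LinearMap.add_apply, LinearMap.comp_apply, LinearMap.sub_apply, LinearMap.id_apply,
      h4, map_add, h3, map_zero]
    abel

end DGModule

namespace DGModule

variable {k : Type u} [Field k] {A B : DGAlgebra.{u, v} k}

/-! ### Cones, products and direct sums -/

section Cone

variable {M N : DGModule A} (f : M ⟶ N)

lemma cone_d (x : (cone f).carrier) : (cone f).d x = (-M.d x.1, f.f x.1 + N.d x.2) := rfl

/-- The inclusion `M → cone f`, of degree `-1`. -/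
def coneInl : M.carrier →ₗ[k] (cone f).carrier := LinearMap.inl k M.carrier N.carrier

/-- The projection `cone f → M`, of degree `1`. -/
def coneFst : (cone f).carrier →ₗ[k] M.carrier := LinearMap.fst k M.carrier N.carrier

/-- The projection `cone f → N`, of degree `0`. -/
def coneSnd : (cone f).carrier →ₗ[k] N.carrier := LinearMap.snd k M.carrier N.carrier

lemma isDeg_coneInl : IsDeg M (cone f) (-1) (coneInl f) :=
  ⟨fun {i m} h => ⟨by
    change m ∈ M.grading (i + -1 + 1)
    simpa using h, zero_mem _⟩, fun m a => by
    change (M.act m a, (0 : N.carrier)) = (M.act m a, N.act 0 a)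
    simp⟩

lemma isDeg_coneFst : IsDeg (cone f) M 1 (coneFst f) := ⟨fun h => h.1, fun _ _ => rfl⟩

lemma isDeg_coneSnd : IsDeg (cone f) N 0 (coneSnd f) :=
  ⟨fun h => by rw [add_zero]; exact h.2, fun _ _ => rfl⟩

lemma homD_coneInl : homD M (cone f) (-1) (coneInl f) = (coneInr f).f ∘ₗ f.f := by
  ext m
  rw [homD_apply, cone_d]
  change ((-M.d m, f.f m + N.d 0) : M.carrier × N.carrier) -
    koszulSign k (-1) • ((M.d m, 0) : M.carrier × N.carrier) = (0, f.f m)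
  simp [koszulSign]

lemma homD_coneFst : homD (cone f) M 1 (coneFst f) = 0 := by
  ext x
  rw [homD_apply, cone_d]
  change M.d x.1 - koszulSign k 1 • -M.d x.1 = 0
  simp

lemma homD_coneSnd : homD (cone f) N 0 (coneSnd f) = -(f.f ∘ₗ coneFst f) := by
  ext x
  rw [homD_apply, cone_d]
  change N.d x.2 - koszulSign k 0 • (f.f x.1 + N.d x.2) = - f.f x.1
  simp

lemma coneFst_comp_coneInl : coneFst f ∘ₗ coneInl f = LinearMap.id := rfl

lemma coneSnd_comp_coneInr : coneSnd f ∘ₗ (coneInr f).f = LinearMap.id := rfl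

lemma coneFst_comp_coneInr : coneFst f ∘ₗ (coneInr f).f = 0 := rfl

lemma coneSnd_comp_coneInl : coneSnd f ∘ₗ coneInl f = 0 := rfl

lemma cone_decomp :
    coneInl f ∘ₗ coneFst f + (coneInr f).f ∘ₗ coneSnd f = LinearMap.id := by
  ext x
  exact Prod.ext (add_zero x.1) (zero_add x.2)

end Cone

/-- Chain homotopies of morphisms of dg modules. -/
def Homotopic {M N : DGModule A} (f g : M ⟶ N) : Prop :=
  ∃ h, IsDeg M N (-1) h ∧ f.f - g.f = homD M N (-1) h

section Homotopic

variable {M N K : DGModule A} {f g h : M ⟶ N}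

lemma Homotopic.refl (f : M ⟶ N) : Homotopic f f := ⟨0, IsDeg.zero, by rw [homD_zero, sub_self]⟩

lemma Homotopic.symm : Homotopic f g → Homotopic g f := fun ⟨s, h1, h2⟩ =>
  ⟨-s, h1.neg, by rw [homD_neg, ← h2, neg_sub]⟩

lemma Homotopic.trans : Homotopic f g → Homotopic g h → Homotopic f h :=
  fun ⟨s, h1, h2⟩ ⟨t, h3, h4⟩ => ⟨s + t, h1.add h3, by rw [homD_add, ← h2, ← h4]; abel⟩

lemma Homotopic.comp_right (w : N ⟶ K) : Homotopic f g → Homotopic (f ≫ w) (g ≫ w) :=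
  fun ⟨s, h1, h2⟩ => ⟨w.f ∘ₗ s, (w.isDeg.comp h1).cast (by ring), by
    have := homD_comp (M := M) (N := N) (K := K) (r := -1) (s := 0) (f := s) (g := w.f)
    rw [w.homD_eq_zero, add_zero] at this
    rw [this, ← h2]
    ext m
    simp⟩

lemma homotopic_iff : Homotopic f g ↔
    ∃ h, IsDeg M N (-1) h ∧ ∀ m, f.f m - g.f m = N.d (h m) + h (M.d m) := by
  refine exists_congr fun h => and_congr_right fun _ => ?_
  rw [LinearMap.ext_iff]
  refine forall_congr' fun m => ?_
  rw [homD_apply]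
  simp [koszulSign]

end Homotopic

/-- The zero morphism. -/
def zeroHom (M N : DGModule A) : M ⟶ N where
  f := 0
  map_mem _ := zero_mem _
  map_act _ _ := by simp
  map_d _ := by simp

/-- The direct sum of two dg modules. -/
def prod (M N : DGModule A) : DGModule A where
  carrier := M.carrier × N.carrier
  grading i := (M.grading i).prod (N.grading i)
  decomposition := gradedDecompositionProd M.grading N.grading
  act := LinearMap.mk₂ k (fun x a => (M.act x.1 a, N.act x.2 a))
    (by simp) (by simp) (by simp) (by simp)
  act_one x := by simp [M.act_one, N.act_one]
  act_mul x a b := by simp [M.act_mul, N.act_mul]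
  act_mem := fun {i j x a} hx ha => ⟨M.act_mem hx.1 ha, N.act_mem hx.2 ha⟩
  d := M.d.prodMap N.d
  d_mem := fun {i x} hx => ⟨M.d_mem hx.1, N.d_mem hx.2⟩
  d_d x := by simp [M.d_d, N.d_d]
  d_act := fun {i x} hx a => by
    have h1 := M.d_act hx.1 a
    have h2 := N.d_act hx.2 a
    ext
    · simp [h1]
    · simp [h2]

/-- The inclusion of the first summand. -/
def prodInl (M N : DGModule A) : M ⟶ M.prod N where
  f := LinearMap.inl k M.carrier N.carrier
  map_mem h := ⟨h, zero_mem _⟩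
  map_act m a := by
    change (M.act m a, (0 : N.carrier)) = (M.act m a, N.act 0 a)
    simp
  map_d m := by
    change (M.d m, (0 : N.carrier)) = (M.d m, N.d 0)
    simp

/-- The projection to the first summand. -/
def prodFst (M N : DGModule A) : M.prod N ⟶ M where
  f := LinearMap.fst k M.carrier N.carrier
  map_mem h := h.1
  map_act _ _ := rfl
  map_d _ := rfl

section DSum

variable {ι : Type}

/-- The homogeneous components of a direct sum of graded vector spaces. -/
def dsumGrading {X : ι → Type v} [∀ i, AddCommGroup (X i)] [∀ i, Module k (X i)]
    (𝒳 : ∀ i, ℤ → Submodule k (X i)) (n : ℤ) : Submodule k (⨁ i, X i) where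
  carrier := {x | ∀ i, x i ∈ 𝒳 i n}
  add_mem' ha hb i := add_mem (ha i) (hb i)
  zero_mem' _ := zero_mem _
  smul_mem' c _ hx i := Submodule.smul_mem _ c (hx i)

section

variable [DecidableEq ι] {X : ι → Type v} [∀ i, AddCommGroup (X i)] [∀ i, Module k (X i)]
  (𝒳 : ∀ i, ℤ → Submodule k (X i)) [∀ i, Decomposition (𝒳 i)]

omit [∀ i, Decomposition (𝒳 i)] in
lemma lof_mem_dsumGrading (n : ℤ) (i : ι) {m : X i} (hm : m ∈ 𝒳 i n) :
    DirectSum.lof k ι X i m ∈ dsumGrading 𝒳 n := fun j => by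
  rcases eq_or_ne i j with rfl | h
  · simpa [DirectSum.lof_eq_of] using hm
  · rw [DirectSum.lof_eq_of, DirectSum.of_eq_of_ne _ _ _ h.symm]
    exact zero_mem _

/-- The splitting of a direct sum of graded vector spaces into its components. -/
def dsumGradingMap : (⨁ i, X i) →ₗ[k] ⨁ n, dsumGrading 𝒳 n :=
  DirectSum.toModule k ι _ fun i => gradedGlue (𝒳 i) fun n =>
    DirectSum.lof k ℤ (fun n => dsumGrading 𝒳 n) n ∘ₗ
      (DirectSum.lof k ι X i).restrict (p := 𝒳 i n) (q := dsumGrading 𝒳 n)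
        (fun _ hm => lof_mem_dsumGrading 𝒳 n i hm)

lemma dsumGradingMap_lof {n : ℤ} {i : ι} {m : X i} (hm : m ∈ 𝒳 i n) :
    dsumGradingMap 𝒳 (DirectSum.lof k ι X i m) = DirectSum.lof k ℤ (fun n => dsumGrading 𝒳 n) n
      ⟨DirectSum.lof k ι X i m, lof_mem_dsumGrading 𝒳 n i hm⟩ := by
  rw [dsumGradingMap, DirectSum.toModule_lof, gradedGlue_of_mem (𝒳 i) _ hm]
  rfl

lemma sum_lof (x : ⨁ i, X i) :
    ∃ s : Finset ι, x = ∑ i ∈ s, DirectSum.lof k ι X i (x i) := by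
  classical
  exact ⟨DFinsupp.support x, (DirectSum.sum_support_of x).symm⟩

/-- The grading on a direct sum of graded vector spaces. -/
@[reducible] def dsumDecomposition : Decomposition (dsumGrading 𝒳) :=
  gradedDecompositionOf _ (dsumGradingMap 𝒳)
    (fun x => by
      refine LinearMap.congr_fun (f := DirectSum.coeLinearMap (dsumGrading 𝒳) ∘ₗ
        dsumGradingMap 𝒳) (g := LinearMap.id) (DirectSum.linearMap_ext _ fun i =>
          graded_hom_ext (𝒳 i) fun n m hm => ?_) x
      simp [dsumGradingMap_lof 𝒳 hm])
    (fun n x hx => by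
      obtain ⟨s, hs⟩ := sum_lof (k := k) x
      have h2 : (⟨x, hx⟩ : dsumGrading 𝒳 n) = ∑ i ∈ s,
          ⟨DirectSum.lof k ι X i (x i), lof_mem_dsumGrading 𝒳 n i (hx i)⟩ :=
        Subtype.ext (by simpa using hs)
      rw [h2, map_sum]
      conv_lhs => rw [hs]
      rw [map_sum]
      exact Finset.sum_congr rfl fun i _ => dsumGradingMap_lof 𝒳 (hx i))

end

variable (M : ι → DGModule A)

open Classical in
/-- The action on a direct sum of dg modules. -/
def dsumAct : (⨁ i, (M i).carrier) →ₗ[k] A.carrier →ₗ[k] ⨁ i, (M i).carrier :=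
  DirectSum.toModule k ι _ fun i =>
    (M i).act.compr₂ (DirectSum.lof k ι (fun i => (M i).carrier) i)

lemma dsumAct_apply (x : ⨁ i, (M i).carrier) (a : A.carrier) (i : ι) :
    dsumAct M x a i = (M i).act (x i) a := by
  classical
  induction x using DirectSum.induction_on with
  | zero => simp
  | add x y hx hy => simp [hx, hy]
  | of j m =>
    rw [← DirectSum.lof_eq_of k, dsumAct, DirectSum.toModule_lof, LinearMap.compr₂_apply,
      DirectSum.lof_eq_of, DirectSum.lof_eq_of]
    rcases eq_or_ne j i with rfl | h
    · simp
    · simp [DirectSum.of_eq_of_ne _ _ _ h.symm]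

/-- The direct sum of a family of dg modules. -/
def dsum : DGModule A where
  carrier := ⨁ i, (M i).carrier
  grading := dsumGrading fun i => (M i).grading
  decomposition :=
    haveI := Classical.decEq ι
    dsumDecomposition fun i => (M i).grading
  act := dsumAct M
  act_one x := DFinsupp.ext fun i => by rw [dsumAct_apply, (M i).act_one]
  act_mul x a b := DFinsupp.ext fun i => by simp only [dsumAct_apply, (M i).act_mul]
  act_mem hm ha i := by
    rw [dsumAct_apply]
    exact (M i).act_mem (hm i) ha
  d := DirectSum.lmap fun i => (M i).d
  d_mem hm i := (M i).d_mem (hm i)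
  d_d x := DFinsupp.ext fun i => (M i).d_d (x i)
  d_act {n x} hx a := DFinsupp.ext fun i => by
    have h := (M i).d_act (hx i) a
    rw [← dsumAct_apply] at h
    refine h.trans ?_
    rw [DFinsupp.add_apply, DFinsupp.smul_apply, dsumAct_apply, dsumAct_apply]
    rfl

open Classical in
/-- The inclusion of a summand. -/
def dsumι (i : ι) : M i ⟶ dsum M where
  f := DirectSum.lof k ι (fun i => (M i).carrier) i
  map_mem h := lof_mem_dsumGrading (fun i => (M i).grading) _ i h
  map_act m a := (LinearMap.congr_fun (DirectSum.toModule_lof k (M := fun i => (M i).carrier)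
    (φ := fun i => (M i).act.compr₂ (DirectSum.lof k ι (fun i => (M i).carrier) i)) i m) a).symm
  map_d m := (DirectSum.lmap_lof (fun i => (M i).d) i m).symm

/-- The projection to a summand. -/
def dsumπ (i : ι) : dsum M ⟶ M i where
  f := DirectSum.component k ι (fun i => (M i).carrier) i
  map_mem h := h i
  map_act x a := dsumAct_apply M x a i
  map_d _ := rfl

lemma dsum_ext {x y : (dsum M).carrier} (h : ∀ i, (dsumπ M i).f x = (dsumπ M i).f y) : x = y :=
  DFinsupp.ext h

@[simp] lemma dsumπ_dsumι_self (i : ι) (m : (M i).carrier) :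
    (dsumπ M i).f ((dsumι M i).f m) = m := by
  classical
  exact DirectSum.component.lof_self (R := k) (M := fun i => (M i).carrier) i m

lemma dsumπ_dsumι_ne {i j : ι} (h : i ≠ j) (m : (M i).carrier) :
    (dsumπ M j).f ((dsumι M i).f m) = 0 := by
  classical
  exact DirectSum.of_eq_of_ne (β := fun i => (M i).carrier) i j m h.symm

lemma dsum_hom_ext {P : Type v} [AddCommGroup P] [Module k P]
    {f g : (dsum M).carrier →ₗ[k] P} (h : ∀ i, f ∘ₗ (dsumι M i).f = g ∘ₗ (dsumι M i).f) :
    f = g := by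
  classical
  exact DirectSum.linearMap_ext k (M := fun i => (M i).carrier) h

open Classical in
/-- The linear map out of a direct sum with given components. -/
def dsumDesc {P : Type v} [AddCommGroup P] [Module k P]
    (f : ∀ i, (M i).carrier →ₗ[k] P) : (dsum M).carrier →ₗ[k] P :=
  DirectSum.toModule k ι P f

@[simp] lemma dsumDesc_ι {P : Type v} [AddCommGroup P] [Module k P]
    (f : ∀ i, (M i).carrier →ₗ[k] P) (i : ι) (m : (M i).carrier) :
    dsumDesc M f ((dsumι M i).f m) = f i m := by
  classical
  exact DirectSum.toModule_lof k (M := fun i => (M i).carrier) (φ := f) i m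

lemma dsum_induction {p : (dsum M).carrier → Prop} (x : (dsum M).carrier) (zero : p 0)
    (of : ∀ i m, p ((dsumι M i).f m)) (add : ∀ x y, p x → p y → p (x + y)) : p x := by
  classical
  exact DirectSum.induction_on (β := fun i => (M i).carrier) x zero of add

lemma exists_eq_sum_ι (x : (dsum M).carrier) :
    ∃ s : Finset ι, x = ∑ i ∈ s, (dsumι M i).f ((dsumπ M i).f x) := by
  classical
  exact sum_lof (k := k) (X := fun i => (M i).carrier) x

lemma isDeg_dsumDesc {N : DGModule A} {r : ℤ} {f : ∀ i, (M i).carrier →ₗ[k] N.carrier}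
    (hf : ∀ i, IsDeg (M i) N r (f i)) : IsDeg (dsum M) N r (dsumDesc M f) where
  mem {n x} hx := by
    classical
    obtain ⟨s, hs⟩ := exists_eq_sum_ι M x
    rw [hs, map_sum]
    refine Submodule.sum_mem _ fun i _ => ?_
    rw [dsumDesc_ι]
    exact (hf i).mem (hx i)
  act x a := by
    induction x using dsum_induction with
    | zero => simp
    | add x y hx hy => simp only [map_add, LinearMap.add_apply, hx, hy]
    | of i m => rw [← (dsumι M i).map_act, dsumDesc_ι, dsumDesc_ι, (hf i).act]

lemma homD_dsumDesc {N : DGModule A} {r : ℤ} (f : ∀ i, (M i).carrier →ₗ[k] N.carrier) :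
    homD (dsum M) N r (dsumDesc M f) = dsumDesc M fun i => homD (M i) N r (f i) := by
  refine dsum_hom_ext M fun i => ?_
  ext m
  simp only [LinearMap.comp_apply, homD_apply, ← (dsumι M i).map_d, dsumDesc_ι]

lemma acyclic_dsum (h : ∀ i, (M i).Acyclic) : (dsum M).Acyclic := by
  choose c _ hc using fun i => (h i).exists_contraction
  refine acyclic_of_homotopy (dsumDesc M fun i => (dsumι M i).f ∘ₗ c i) fun x => ?_
  induction x using dsum_induction with
  | zero => simp
  | add x y hx hy =>
    rw [map_add, map_add, map_add, map_add]
    conv_rhs => rw [← hx, ← hy]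
    abel
  | of i m =>
    rw [← (dsumι M i).map_d, dsumDesc_ι, dsumDesc_ι, LinearMap.comp_apply, LinearMap.comp_apply,
      ← (dsumι M i).map_d, ← map_add, hc]

/-- The zero dg module. -/
def zero (A : DGAlgebra.{u, v} k) : DGModule A := dsum fun i : Empty => i.elim

instance : Subsingleton (zero A).carrier := ⟨fun _ _ => dsum_ext _ fun i => i.elim⟩

end DSum

end DGModule

namespace DGModule

variable {k : Type u} [Field k] {A B C : DGAlgebra.{u, v} k}

/-! ### Quasi-isomorphisms and the derived category -/

lemma quasiIso_of_bijective {M N : DGModule A} (f : M ⟶ N) (hf : Function.Bijective f.f) :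
    quasiIso A f := by
  rw [quasiIso_iff_acyclic_cone]
  rintro ⟨x, y⟩ h
  obtain ⟨z, rfl⟩ := hf.2 y
  have h2 : f.f x + N.d (f.f z) = 0 := (Prod.mk_eq_zero.1 h).2
  refine ⟨(z, 0), ?_⟩
  rw [← f.map_d, ← map_add, map_eq_zero_iff _ hf.1] at h2
  refine Prod.ext (eq_neg_of_add_eq_zero_left h2).symm ?_
  change f.f z + N.d 0 = f.f z
  simp

lemma quasiIso_of_homotopyEquiv {M N : DGModule A} (f : M ⟶ N) (g : N ⟶ M)
    (h1 : Homotopic (f ≫ g) (𝟙 M)) (h2 : Homotopic (g ≫ f) (𝟙 N)) : quasiIso A f := by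
  obtain ⟨s, hs, hs'⟩ := homotopic_iff.1 h1
  obtain ⟨t, ht, ht'⟩ := homotopic_iff.1 h2
  intro i
  rw [bijective_cohomologyMap_iff]
  constructor
  · rintro m ⟨hm, hdm⟩ ⟨n, hn, hfn⟩
    change M.d m = 0 at hdm
    have := hs' m
    refine ⟨g.f n - s m, sub_mem (g.map_mem hn) (hs.mem' (by ring) hm), ?_⟩
    simp only [comp_f, id_f, hdm, map_zero, add_zero] at this
    rw [map_sub, ← g.map_d, hfn, ← this]
    abel
  · intro n hn
    have hdn : N.d n = 0 := hn.2
    refine ⟨g.f n, Hom.map_cocycles g i n hn, t n, ht.mem' (by ring) hn.1, ?_⟩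
    have := ht' n
    simp only [comp_f, id_f, hdn, map_zero, add_zero] at this
    exact this.symm

lemma acyclic_iff_of_quasiIso {M N : DGModule A} (f : M ⟶ N) (hf : quasiIso A f) :
    M.Acyclic ↔ N.Acyclic := by
  constructor
  · intro hM
    refine acyclic_of_homogeneous fun i n hn hdn => ?_
    obtain ⟨m, hm, x, _, hx⟩ := ((bijective_cohomologyMap_iff f i).1 (hf i)).2 n ⟨hn, hdn⟩
    obtain ⟨y, rfl⟩ := hM m hm.2
    exact ⟨f.f y - x, by rw [map_sub, hx, ← f.map_d]; abel⟩
  · intro hN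
    refine acyclic_of_homogeneous fun i m hm hdm => ?_
    obtain ⟨n, hn, hn'⟩ := hN.exists_mem (sub_add_cancel i 1) (f.map_mem hm)
      (by rw [← f.map_d, hdm, map_zero])
    obtain ⟨x, _, hx⟩ := ((bijective_cohomologyMap_iff f i).1 (hf i)).1 m ⟨hm, hdm⟩ ⟨n, hn, hn'⟩
    exact ⟨x, hx⟩

lemma quasiIso_of_acyclic {M N : DGModule A} (f : M ⟶ N) (hM : M.Acyclic) (hN : N.Acyclic) :
    quasiIso A f := by
  rw [quasiIso_iff_acyclic_cone]
  rintro ⟨x, y⟩ h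
  have h1 : -M.d x = 0 := (Prod.mk_eq_zero.1 h).1
  have h2 : f.f x + N.d y = 0 := (Prod.mk_eq_zero.1 h).2
  obtain ⟨z, rfl⟩ := hM x (neg_eq_zero.1 h1)
  obtain ⟨w, hw⟩ := hN (y + f.f z) (by rw [map_add, ← f.map_d, add_comm, h2])
  refine ⟨(-z, w), Prod.ext ?_ ?_⟩
  · change -M.d (-z) = M.d z
    simp
  · change f.f (-z) + N.d w = y
    rw [hw, map_neg]
    abel

/-- The isomorphism in the derived category given by a quasi-isomorphism. -/
def isoOfQuasiIso {M N : DGModule A} (f : M ⟶ N) (hf : quasiIso A f) : M.toD ≅ N.toD :=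
  haveI := (quasiIso A).Q_inverts f hf
  asIso ((quasiIso A).Q.map f)

lemma exists_toD_eq (X : DerivedCat A) : ∃ M : DGModule A, M.toD = X :=
  (Localization.Construction.objEquiv (quasiIso A)).surjective X

/-- Shifts in the derived category are computed by shifts of dg modules. -/
def shiftIso (M : DGModule A) (m : ℤ) : (M.shift m).toD ≅ M.toD⟦m⟧ :=
  ((quasiIso A).Q.commShiftIso m).app M

/-- The cohomology as a functor to types. -/
def cohomologyFunctor (A : DGAlgebra.{u, v} k) (i : ℤ) : DGModule A ⥤ Type v where
  obj M := M.Cohomology i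
  map f := ↾(Hom.cohomologyMap f i)
  map_id M := by
    ext x
    induction x using Submodule.Quotient.induction_on
    rfl
  map_comp f g := by
    ext x
    induction x using Submodule.Quotient.induction_on
    rfl

lemma acyclic_iff_subsingleton {M : DGModule A} :
    M.Acyclic ↔ ∀ i, Subsingleton (M.Cohomology i) := by
  constructor
  · intro h i
    refine subsingleton_of_forall_eq 0 fun x => ?_
    induction x using Submodule.Quotient.induction_on with | _ x
    obtain ⟨n, hn, hn'⟩ := h.exists_mem (sub_add_cancel i 1) x.2.1 x.2.2
    exact (Submodule.Quotient.mk_eq_zero _).2 ⟨n, hn, hn'⟩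
  · intro h
    refine acyclic_of_homogeneous fun i m hm hdm => ?_
    have := h i
    obtain ⟨n, _, hn⟩ := (Submodule.Quotient.mk_eq_zero
      ((M.coboundaries i).comap (M.cocycles i).subtype)).1
      (Subsingleton.elim (Submodule.Quotient.mk ⟨m, hm, hdm⟩) 0)
    exact ⟨n, hn⟩

lemma acyclic_of_iso {M N : DGModule A} (e : M.toD ≅ N.toD) (hM : M.Acyclic) : N.Acyclic := by
  rw [acyclic_iff_subsingleton] at hM ⊢
  intro i
  have hW : (quasiIso A).IsInvertedBy (cohomologyFunctor A i) := fun _ _ f hf =>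
    (isIso_iff_bijective _).2 (hf i)
  have e' := ((Localization.Construction.lift (cohomologyFunctor A i) hW).mapIso e).toEquiv
  have : Subsingleton (M.Cohomology i) := hM i
  exact Equiv.subsingleton (β := M.Cohomology i) e'.symm

/-- The zero dg module is a zero object of the derived category: the zero morphisms are natural, and
hence give natural transformations between the identity and the constant functor on the
localization. -/
lemma isZero_toD_zero : Limits.IsZero (zero A).toD := by
  let Q := (quasiIso A).Q
  let K : DerivedCat A ⥤ DerivedCat A := (Functor.const _).obj (zero A).toD
  let t : K ⟶ 𝟭 _ := Localization.Construction.natTransExtension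
    (F₁ := K) (F₂ := 𝟭 _) { app := fun M => Q.map (zeroHom _ M)
                            naturality := fun M N f => by
                              change 𝟙 _ ≫ Q.map _ = Q.map _ ≫ Q.map _
                              rw [← Q.map_comp, Category.id_comp]
                              congr 1
                              ext m
                              exact (map_zero f.f).symm }
  let s : 𝟭 _ ⟶ K := Localization.Construction.natTransExtension
    (F₁ := 𝟭 _) (F₂ := K) { app := fun M => Q.map (zeroHom M _)
                            naturality := fun M N f => by
                              change Q.map _ ≫ Q.map _ = Q.map _ ≫ 𝟙 _
                              rw [← Q.map_comp, Category.comp_id]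
                              congr 1 }
  have h0 : zeroHom (zero A) (zero A) = 𝟙 _ := by ext m; exact Subsingleton.elim _ _
  have ht : t.app (zero A).toD = 𝟙 _ := by
    exact (congrArg (fun f => Q.map f) h0).trans (Q.map_id _)
  have hs : s.app (zero A).toD = 𝟙 _ := by
    exact (congrArg (fun f => Q.map f) h0).trans (Q.map_id _)
  have h1 : ∀ Y (f : (zero A).toD ⟶ Y), f = t.app Y := fun Y f => by
    have := t.naturality f
    rw [ht] at this
    simpa [K] using this.symm
  have h2 : ∀ Y (f : Y ⟶ (zero A).toD), f = s.app Y := fun Y f => by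
    have := s.naturality f
    rw [hs] at this
    simpa [K] using this
  exact ⟨fun Y => ⟨⟨⟨t.app Y⟩, h1 Y⟩⟩, fun Y => ⟨⟨⟨s.app Y⟩, h2 Y⟩⟩⟩

lemma acyclic_of_subsingleton {M : DGModule A} [Subsingleton M.carrier] : M.Acyclic :=
  fun _ _ => ⟨0, Subsingleton.elim _ _⟩

lemma isZero_toD_iff {M : DGModule A} : Limits.IsZero M.toD ↔ M.Acyclic := by
  constructor
  · intro h
    exact acyclic_of_iso (isZero_toD_zero.iso h) acyclic_of_subsingleton
  · intro h
    exact isZero_toD_zero.of_iso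
      (isoOfQuasiIso (zeroHom M _) (quasiIso_of_acyclic _ h acyclic_of_subsingleton))

/-! ### dg functors -/

/-- A dg functor from dg modules over `A` to dg modules over `B` that preserves acyclic dg modules.
Its action on maps of degree `r` is recorded as a function on all linear maps, which is subject to
conditions only for the homogeneous `A`-linear ones. -/
structure DGFun (A B : DGAlgebra.{u, v} k) where
  /-- the dg module `F M` -/
  obj : DGModule A → DGModule B
  /-- the action on maps of a given degree -/
  map : ∀ (M N : DGModule A), ℤ → (M.carrier →ₗ[k] N.carrier) →
    ((obj M).carrier →ₗ[k] (obj N).carrier)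
  isDeg : ∀ {M N : DGModule A} {r f}, IsDeg M N r f → IsDeg (obj M) (obj N) r (map M N r f)
  map_id : ∀ M, map M M 0 LinearMap.id = LinearMap.id
  map_comp : ∀ {M N K : DGModule A} {r s f g}, IsDeg M N r f → IsDeg N K s g →
    map M K (r + s) (g ∘ₗ f) = map N K s g ∘ₗ map M N r f
  map_add : ∀ {M N : DGModule A} {r f g}, IsDeg M N r f → IsDeg M N r g →
    map M N r (f + g) = map M N r f + map M N r g
  map_homD : ∀ {M N : DGModule A} {r f}, IsDeg M N r f →
    map M N (r + 1) (homD M N r f) = homD (obj M) (obj N) r (map M N r f)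
  acyclic : ∀ {M}, M.Acyclic → (obj M).Acyclic

namespace DGFun

variable (F : DGFun A B)

lemma map_zero (M N : DGModule A) (r : ℤ) : F.map M N r 0 = 0 := by
  have := F.map_add (M := M) (N := N) (r := r) IsDeg.zero IsDeg.zero
  simpa using this

lemma map_comp' {M N K : DGModule A} {r s t : ℤ} {f : M.carrier →ₗ[k] N.carrier}
    {g : N.carrier →ₗ[k] K.carrier} (hf : IsDeg M N r f) (hg : IsDeg N K s g) (h : r + s = t) :
    F.map N K s g ∘ₗ F.map M N r f = F.map M K t (g ∘ₗ f) := by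
  rw [← h, F.map_comp hf hg]

/-- A dg functor as a functor. -/
def functor : DGModule A ⥤ DGModule B where
  obj := F.obj
  map {M N} f := mkHom (F.isDeg f.isDeg) (by
    rw [← F.map_homD f.isDeg, f.homD_eq_zero, map_zero])
  map_id M := Hom.ext (F.map_id M)
  map_comp {M N K} f g := Hom.ext ((F.map_comp f.isDeg g.isDeg).trans rfl)

/-- The morphism `F M ⟶ F N` induced by a morphism. -/
def mapHom {M N : DGModule A} (f : M ⟶ N) : F.obj M ⟶ F.obj N := F.functor.map f

lemma mapHom_f {M N : DGModule A} (f : M ⟶ N) : (F.mapHom f).f = F.map M N 0 f.f := rfl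

/-- The comparison of the cone of `F f` with the value of `F` on the cone of `f`. -/
def coneHom {M N : DGModule A} (f : M ⟶ N) : cone (F.mapHom f) ⟶ F.obj (cone f) :=
  mkHom (f := F.map _ _ (-1) (coneInl f) ∘ₗ coneFst _ + F.map _ _ 0 (coneInr f).f ∘ₗ coneSnd _)
    ((((F.isDeg (isDeg_coneInl f)).comp (isDeg_coneFst _)).cast (by ring)).add
      ((F.isDeg (coneInr f).isDeg).comp (isDeg_coneSnd _))) (by
    have h1 := homD_comp (r := 1) (s := -1) (f := coneFst (F.mapHom f))
      (g := F.map _ _ (-1) (coneInl f))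
    have h2 := homD_comp (r := 0) (s := 0) (f := coneSnd (F.mapHom f))
      (g := F.map _ _ 0 (coneInr f).f)
    rw [homD_coneFst, ← F.map_homD (isDeg_coneInl f), homD_coneInl] at h1
    rw [homD_coneSnd, ← F.map_homD (coneInr f).isDeg, (coneInr f).homD_eq_zero, map_zero] at h2
    rw [homD_add]
    refine (congrArg₂ _ h1 h2).trans ?_
    have h3 := F.map_comp' f.isDeg (coneInr f).isDeg (t := 0) (by ring)
    rw [show (-1 : ℤ) + 1 = 0 by ring, ← h3, mapHom_f]
    ext m
    simp)

/-- Maps between two decompositions of an object as a direct sum are mutually inverse if their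
components are. -/
lemma bijective_of_decomp {X Y Z W : Type v} [AddCommGroup X] [AddCommGroup Y] [AddCommGroup Z]
    [AddCommGroup W] [Module k X] [Module k Y] [Module k Z] [Module k W]
    {a : X →ₗ[k] Z} {b : Y →ₗ[k] Z} {c : Z →ₗ[k] X} {e : Z →ₗ[k] Y}
    {i : X →ₗ[k] W} {j : Y →ₗ[k] W} {p : W →ₗ[k] X} {q : W →ₗ[k] Y}
    (h1 : c ∘ₗ a = LinearMap.id) (h2 : e ∘ₗ a = 0) (h3 : c ∘ₗ b = 0) (h4 : e ∘ₗ b = LinearMap.id)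
    (h5 : a ∘ₗ c + b ∘ₗ e = LinearMap.id) (h6 : p ∘ₗ i = LinearMap.id) (h7 : q ∘ₗ i = 0)
    (h8 : p ∘ₗ j = 0) (h9 : q ∘ₗ j = LinearMap.id) (h10 : i ∘ₗ p + j ∘ₗ q = LinearMap.id) :
    Function.Bijective (a ∘ₗ p + b ∘ₗ q) := by
  simp only [LinearMap.ext_iff, LinearMap.comp_apply, LinearMap.add_apply, LinearMap.id_apply,
    LinearMap.zero_apply] at h1 h2 h3 h4 h5 h6 h7 h8 h9 h10
  rw [Function.bijective_iff_has_inverse]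
  refine ⟨i ∘ₗ c + j ∘ₗ e, fun x => ?_, fun x => ?_⟩
  · simp [h1, h2, h3, h4, h10]
  · simp [h5, h6, h7, h8, h9]

lemma bijective_coneHom {M N : DGModule A} (f : M ⟶ N) :
    Function.Bijective (F.coneHom f).f := by
  refine bijective_of_decomp (c := F.map _ _ 1 (coneFst f)) (e := F.map _ _ 0 (coneSnd f))
    ?_ ?_ ?_ ?_ ?_ (coneFst_comp_coneInl _) (coneSnd_comp_coneInl _) (coneFst_comp_coneInr _)
    (coneSnd_comp_coneInr _) (cone_decomp (F.mapHom f))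
  · rw [F.map_comp' (isDeg_coneInl f) (isDeg_coneFst f) (t := 0) (by ring), coneFst_comp_coneInl,
      F.map_id]
  · rw [F.map_comp' (isDeg_coneInl f) (isDeg_coneSnd f) (t := -1) (by ring),
      coneSnd_comp_coneInl, map_zero]
  · rw [F.map_comp' (coneInr f).isDeg (isDeg_coneFst f) (t := 1) (by ring), coneFst_comp_coneInr,
      map_zero]
  · rw [F.map_comp' (coneInr f).isDeg (isDeg_coneSnd f) (t := 0) (by ring), coneSnd_comp_coneInr,
      F.map_id]
  · rw [F.map_comp' (isDeg_coneFst f) (isDeg_coneInl f) (t := 0) (by ring),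
      F.map_comp' (isDeg_coneSnd f) (coneInr f).isDeg (t := 0) (by ring),
      ← F.map_add (((isDeg_coneInl f).comp (isDeg_coneFst f)).cast (by ring))
        (((coneInr f).isDeg.comp (isDeg_coneSnd f)).cast (by ring)), cone_decomp, F.map_id]

/-- A dg functor commutes with cones. -/
lemma quasiIso_coneHom {M N : DGModule A} (f : M ⟶ N) : quasiIso B (F.coneHom f) :=
  quasiIso_of_bijective _ (F.bijective_coneHom f)

/-- The identity map `M → M[n]`, of degree `-n`. -/
def toShift (M : DGModule A) (n : ℤ) : M.carrier →ₗ[k] (M.shift n).carrier := LinearMap.id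

/-- The identity map `M[n] → M`, of degree `n`. -/
def ofShift (M : DGModule A) (n : ℤ) : (M.shift n).carrier →ₗ[k] M.carrier := LinearMap.id

lemma isDeg_toShift (M : DGModule A) (n : ℤ) : IsDeg M (M.shift n) (-n) (toShift M n) :=
  ⟨fun {i m} h => by
    change m ∈ M.grading (i + -n + n)
    simpa using h, fun _ _ => rfl⟩

lemma isDeg_ofShift (M : DGModule A) (n : ℤ) : IsDeg (M.shift n) M n (ofShift M n) :=
  ⟨fun h => h, fun _ _ => rfl⟩

lemma koszulSign_neg (n : ℤ) : koszulSign k (-n) = koszulSign k n := by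
  simp [koszulSign]

lemma homD_toShift (M : DGModule A) (n : ℤ) : homD M (M.shift n) (-n) (toShift M n) = 0 := by
  ext m
  rw [homD_apply, koszulSign_neg]
  change koszulSign k n • M.d m - koszulSign k n • M.d m = 0
  rw [sub_self]

lemma homD_ofShift (M : DGModule A) (n : ℤ) : homD (M.shift n) M n (ofShift M n) = 0 := by
  ext m
  rw [homD_apply]
  change M.d m - koszulSign k n • koszulSign k n • M.d m = 0
  rw [smul_smul, koszulSign_mul_self, one_smul, sub_self]

/-- The comparison of `F(M)[n]` with `F(M[n])`. -/
def shiftHom (M : DGModule A) (n : ℤ) : (F.obj M).shift n ⟶ F.obj (M.shift n) :=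
  mkHom (f := F.map _ _ (-n) (toShift M n) ∘ₗ ofShift (F.obj M) n)
    (((F.isDeg (isDeg_toShift M n)).comp (isDeg_ofShift _ n)).cast (by ring)) (by
    have h1 := homD_comp (r := n) (s := -n) (f := ofShift (F.obj M) n)
      (g := F.map _ _ (-n) (toShift M n))
    rw [homD_ofShift, ← F.map_homD (isDeg_toShift M n), homD_toShift, map_zero] at h1
    rw [add_neg_cancel] at h1
    rw [h1]
    ext m
    simp)

lemma quasiIso_shiftHom (M : DGModule A) (n : ℤ) : quasiIso B (F.shiftHom M n) := by
  refine quasiIso_of_bijective _ ?_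
  have h1 := F.map_comp' (isDeg_toShift M n) (isDeg_ofShift M n) (t := 0) (by ring)
  have h2 := F.map_comp' (isDeg_ofShift M n) (isDeg_toShift M n) (t := 0) (by ring)
  refine Function.bijective_iff_has_inverse.2 ⟨F.map _ _ n (ofShift M n), ?_, ?_⟩
  · exact fun x => LinearMap.congr_fun (h1.trans (F.map_id M)) x
  · exact fun x => LinearMap.congr_fun (h2.trans (F.map_id (M.shift n))) x

lemma quasiIso_mapHom {M N : DGModule A} (f : M ⟶ N) (hf : quasiIso A f) :
    quasiIso B (F.mapHom f) := by
  rw [quasiIso_iff_acyclic_cone] at hf ⊢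
  exact (acyclic_iff_of_quasiIso _ (F.quasiIso_coneHom f)).2 (F.acyclic hf)

/-- The functor between derived categories induced by a dg functor. -/
def derived : DerivedCat A ⥤ DerivedCat B :=
  Localization.Construction.lift (F.functor ⋙ (quasiIso B).Q) fun _ _ f hf =>
    (quasiIso B).Q_inverts _ (F.quasiIso_mapHom f hf)

/-- The identity dg functor. -/
def id (A : DGAlgebra.{u, v} k) : DGFun A A where
  obj M := M
  map _ _ _ f := f
  isDeg h := h
  map_id _ := rfl
  map_comp _ _ := rfl
  map_add _ _ := rfl
  map_homD _ := rfl
  acyclic h := h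

/-- The composition of dg functors. -/
def comp (F : DGFun A B) (G : DGFun B C) : DGFun A C where
  obj M := G.obj (F.obj M)
  map M N r f := G.map _ _ r (F.map M N r f)
  isDeg h := G.isDeg (F.isDeg h)
  map_id M := by rw [F.map_id, G.map_id]
  map_comp hf hg := by rw [F.map_comp hf hg, G.map_comp (F.isDeg hf) (F.isDeg hg)]
  map_add hf hg := by rw [F.map_add hf hg, G.map_add (F.isDeg hf) (F.isDeg hg)]
  map_homD hf := by rw [F.map_homD hf, G.map_homD (F.isDeg hf)]
  acyclic h := G.acyclic (F.acyclic h)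

end DGFun

end DGModule

namespace DerivedCat

open DGModule

variable {k : Type u} [Field k] {A B C : DGAlgebra.{u, v} k}

/-! ### Thick subcategories -/

lemma isThick_thickClosure (S : ObjectProperty (DerivedCat A)) : IsThick (thickClosure S) where
  zero X h _ hP _ := hP.zero X h
  shift X m h P hP hS := hP.shift X m (h P hP hS)
  ext T hT h1 h3 P hP hS := hP.ext T hT (h1 P hP hS) (h3 P hP hS)
  summand X Y r h P hP hS := hP.summand X Y r (h P hP hS)

lemma le_thickClosure (S : ObjectProperty (DerivedCat A)) : S ≤ thickClosure S :=
  fun _ hX _ _ hS => hS _ hX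

lemma isThick_perf : IsThick (perf A) := isThick_thickClosure _

lemma perf_regular : perf A A.regular.toD := le_thickClosure _ _ rfl

namespace IsThick

variable {P : ObjectProperty (DerivedCat A)} (hP : IsThick P)

include hP

lemma iso {X Y : DerivedCat A} (e : X ≅ Y) (h : P X) : P Y :=
  hP.summand _ _ (Retract.ofIso e.symm) h

lemma of_cone {M N : DGModule A} (f : M ⟶ N) (h1 : P M.toD) (h3 : P (cone f).toD) : P N.toD :=
  hP.ext ((quasiIso A).Q.mapTriangle.obj (coneTriangle f)) ⟨M, N, f, ⟨Iso.refl _⟩⟩ h1 h3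

lemma of_shortExact {M N K : DGModule A} (f : M ⟶ N) (g : cone f ⟶ K) (hg : quasiIso A g)
    (h1 : P M.toD) (h3 : P K.toD) : P N.toD :=
  hP.of_cone f h1 (hP.iso (isoOfQuasiIso g hg).symm h3)

lemma acyclic {M : DGModule A} (hM : M.Acyclic) : P M.toD := hP.zero _ (isZero_toD_iff.2 hM)

end IsThick

/-- Acyclic dg modules form a thick subcategory. -/
lemma isThick_isZero : IsThick (A := A) (fun X => Limits.IsZero X) where
  zero _ h := h
  shift X m h := by
    obtain ⟨M, rfl⟩ := exists_toD_eq X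
    refine Limits.IsZero.of_iso ?_ (shiftIso M m).symm
    rw [isZero_toD_iff] at h ⊢
    intro (x : M.carrier) hx
    obtain ⟨y, rfl⟩ := h x ((smul_eq_zero_iff_right (koszulSign_ne_zero k m)).1 hx)
    refine ⟨koszulSign k m • y, ?_⟩
    change koszulSign k m • M.d (koszulSign k m • y) = _
    rw [map_smul, smul_smul, koszulSign_mul_self, one_smul]
  ext := by
    rintro T ⟨M, N, f, ⟨e⟩⟩ h1 h3
    replace h1 : Limits.IsZero M.toD := h1.of_iso
      ((Pretriangulated.Triangle.π₁ ⋙ 𝟭 _).mapIso e.symm)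
    replace h3 : Limits.IsZero (cone f).toD := h3.of_iso
      ((Pretriangulated.Triangle.π₃ ⋙ 𝟭 _).mapIso e.symm)
    refine Limits.IsZero.of_iso (Y := N.toD) ?_ ((Pretriangulated.Triangle.π₂ ⋙ 𝟭 _).mapIso e)
    rw [isZero_toD_iff] at h1 h3 ⊢
    exact (acyclic_iff_of_quasiIso f ((quasiIso_iff_acyclic_cone f).2 h3)).1 h1
  summand X Y r h := by
    refine ⟨fun Z => ⟨⟨⟨r.i ≫ h.to_ Z⟩, fun f => ?_⟩⟩, fun Z => ⟨⟨⟨h.from_ Z ≫ r.r⟩, fun f => ?_⟩⟩⟩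
    · exact (by rw [← Category.id_comp f, ← r.retract, Category.assoc, h.eq_to (r.r ≫ f)] :
        f = r.i ≫ h.to_ Z)
    · exact (by rw [← Category.comp_id f, ← r.retract, ← Category.assoc, h.eq_from (f ≫ r.i)] :
        f = h.from_ Z ≫ r.r)

/-- The preimage of a thick subcategory under a dg functor is thick. -/
lemma IsThick.comap {P : ObjectProperty (DerivedCat B)} (hP : IsThick P) (F : DGFun A B) :
    IsThick fun X => P (F.derived.obj X) where
  zero X h := by
    refine hP.iso (F.derived.mapIso (isZero_toD_zero.iso h)) ?_
    exact hP.acyclic (F.acyclic (acyclic_of_subsingleton (M := DGModule.zero A)))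
  shift X m h := by
    obtain ⟨M, rfl⟩ := exists_toD_eq X
    refine hP.iso (F.derived.mapIso (shiftIso M m)) ?_
    refine hP.iso (isoOfQuasiIso _ (F.quasiIso_shiftHom M m)) ?_
    exact hP.iso (shiftIso (F.obj M) m).symm (hP.shift _ m h)
  ext := by
    rintro T ⟨M, N, f, ⟨e⟩⟩ h1 h3
    replace h1 : P (F.obj M).toD := hP.iso (F.derived.mapIso
      ((Pretriangulated.Triangle.π₁ ⋙ 𝟭 _).mapIso e)) h1
    replace h3 : P (F.obj (cone f)).toD := hP.iso (F.derived.mapIso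
      ((Pretriangulated.Triangle.π₃ ⋙ 𝟭 _).mapIso e)) h3
    refine hP.iso (X := (F.obj N).toD) (F.derived.mapIso
      ((Pretriangulated.Triangle.π₂ ⋙ 𝟭 _).mapIso e.symm)) ?_
    exact hP.of_shortExact (F.mapHom f) _ (F.quasiIso_coneHom f) h1 h3
  summand X Y r h := hP.summand _ _ (r.map F.derived) h

end DerivedCat

namespace DGModule

variable {k : Type u} [Field k] {A B C : DGAlgebra.{u, v} k}

open DerivedCat

/-- The morphism from the cone of the first map of a short exact sequence to its last term. -/
def coneDesc {M N K : DGModule A} (f : M ⟶ N) (g : N ⟶ K) (hfg : ∀ m, g.f (f.f m) = 0) :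
    cone f ⟶ K where
  f := g.f ∘ₗ coneSnd f
  map_mem h := g.map_mem h.2
  map_act _ _ := g.map_act _ _
  map_d x := by
    change g.f (f.f x.1 + N.d x.2) = K.d (g.f x.2)
    rw [map_add, hfg, zero_add, g.map_d]

lemma quasiIso_coneDesc {M N K : DGModule A} (f : M ⟶ N) (g : N ⟶ K)
    (hfg : ∀ m, g.f (f.f m) = 0) (hf : Function.Injective f.f) (hg : Function.Surjective g.f)
    (hex : ∀ n, g.f n = 0 → ∃ m, f.f m = n) : quasiIso A (coneDesc f g hfg) := by
  rw [quasiIso_iff_acyclic_cone]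
  rintro ⟨⟨x, y⟩, z⟩ h
  replace h := Prod.mk_eq_zero.1 h
  have h1 : f.f x + N.d y = 0 := (Prod.mk_eq_zero.1 (neg_eq_zero.1 h.1)).2
  have h2 : g.f y + K.d z = 0 := h.2
  obtain ⟨y', rfl⟩ := hg z
  obtain ⟨w, hw⟩ := hex (y + N.d y') (by rw [map_add, g.map_d, h2])
  have h3 : x = -M.d w := hf (by
    rw [map_neg, f.map_d, hw, map_add, N.d_d, add_zero, eq_neg_iff_add_eq_zero, h1])
  refine ⟨((-w, y'), 0), Prod.ext (Prod.ext ?_ ?_) ?_⟩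
  · change -(-M.d (-w)) = x
    rw [h3, neg_neg, map_neg]
  · change -(f.f (-w) + N.d y') = y
    rw [map_neg, hw]
    abel
  · change g.f y' + K.d 0 = g.f y'
    rw [map_zero, add_zero]

lemma thick_of_exact {P : ObjectProperty (DerivedCat A)} (hP : IsThick P) {M N K : DGModule A}
    (f : M ⟶ N) (g : N ⟶ K) (hfg : ∀ m, g.f (f.f m) = 0) (hf : Function.Injective f.f)
    (hg : Function.Surjective g.f) (hex : ∀ n, g.f n = 0 → ∃ m, f.f m = n) (hM : P M.toD)
    (hK : P K.toD) : P N.toD :=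
  hP.of_shortExact f _ (quasiIso_coneDesc f g hfg hf hg hex) hM hK

section

variable {ι : Type} (M : ι → DGModule A)

/-- The morphism out of a direct sum with given components. -/
def dsumDescHom {N : DGModule A} (f : ∀ i, M i ⟶ N) : dsum M ⟶ N :=
  mkHom (isDeg_dsumDesc M fun i => (f i).isDeg) (by
    rw [homD_dsumDesc]
    refine dsum_hom_ext M fun i => ?_
    ext m
    simp [(f i).homD_eq_zero])

@[simp] lemma dsumDescHom_ι {N : DGModule A} (f : ∀ i, M i ⟶ N) (i : ι) (m : (M i).carrier) :
    (dsumDescHom M f).f ((dsumι M i).f m) = (f i).f m := dsumDesc_ι M _ i m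

/-- A direct sum may be reindexed. -/
lemma quasiIso_reindex {κ : Type} (e : κ ≃ ι) :
    quasiIso A (dsumDescHom (fun i => M (e i)) fun i => dsumι M (e i)) := by
  refine quasiIso_of_bijective _ (Function.bijective_iff_has_inverse.2 ⟨dsumDesc M fun i =>
    e.apply_symm_apply i ▸ (dsumι (fun i => M (e i)) (e.symm i)).f, fun x => ?_, fun x => ?_⟩)
  · induction x using dsum_induction with
    | zero => simp
    | add x y hx hy => simp only [map_add, hx, hy]
    | of i m =>
      rw [dsumDescHom_ι, dsumDesc_ι]
      have key : ∀ (j : κ) (h : e j = e i),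
          (h ▸ (dsumι (fun i => M (e i)) j).f : (M (e i)).carrier →ₗ[k] _) m =
          (dsumι (fun i => M (e i)) i).f m := fun j h => by
        obtain rfl := e.injective h
        rfl
      exact key _ _
  · induction x using dsum_induction with
    | zero => simp
    | add x y hx hy => simp only [map_add, hx, hy]
    | of i m =>
      obtain ⟨i, rfl⟩ := e.surjective i
      rw [dsumDesc_ι]
      have key : ∀ (j : κ) (h : e j = e i),
          (h ▸ (dsumι (fun i => M (e i)) j).f : (M (e i)).carrier →ₗ[k] _) m =
          (dsumι (fun i => M (e i)) i).f m := fun j h => by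
        obtain rfl := e.injective h
        rfl
      rw [key, dsumDescHom_ι]

end

lemma thick_dsum_fin {P : ObjectProperty (DerivedCat A)} (hP : IsThick P) : ∀ (n : ℕ)
    (M : Fin n → DGModule A), (∀ i, P (M i).toD) → P (dsum M).toD
  | 0, M, _ => hP.acyclic (acyclic_dsum M fun i => i.elim0)
  | n + 1, M, h => by
    let g : dsum M ⟶ dsum fun i : Fin n => M i.succ :=
      dsumDescHom M (Fin.cases (zeroHom _ _) fun i => dsumι (fun i : Fin n => M i.succ) i)
    have h0 : ∀ m, g.f ((dsumι M 0).f m) = 0 := fun m => dsumDescHom_ι M _ 0 m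
    have hs : ∀ i m, g.f ((dsumι M i.succ).f m) = (dsumι (fun i : Fin n => M i.succ) i).f m :=
      fun i m => dsumDescHom_ι M _ i.succ m
    let s : (dsum fun i : Fin n => M i.succ) ⟶ dsum M :=
      dsumDescHom (fun i : Fin n => M i.succ) fun i => dsumι M i.succ
    have hgs : ∀ x, g.f (s.f x) = x := fun x => by
      induction x using dsum_induction with
      | zero => simp
      | add x y hx hy => simp only [map_add, hx, hy]
      | of i m =>
        refine (congrArg g.f (dsumDescHom_ι (fun i : Fin n => M i.succ)
          (fun i => dsumι M i.succ) i m)).trans (hs i m)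
    have hx : ∀ x, x = (dsumι M 0).f ((dsumπ M 0).f x) + s.f (g.f x) := fun x => by
      induction x using dsum_induction with
      | zero => simp
      | add x y hx hy =>
        conv_lhs => rw [hx, hy]
        simp only [map_add]
        abel
      | of i m =>
        refine Fin.cases (fun m => ?_) (fun i m => ?_) i m
        · rw [h0, map_zero, add_zero, dsumπ_dsumι_self]
        · rw [hs, dsumπ_dsumι_ne M (Fin.succ_ne_zero i), map_zero, zero_add]
          exact (dsumDescHom_ι (fun i : Fin n => M i.succ) (fun i => dsumι M i.succ) i m).symm
    refine thick_of_exact hP (dsumι M 0) g h0 ?_ (fun x => ⟨s.f x, hgs x⟩) (fun x h => ?_) (h 0)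
      (thick_dsum_fin hP n _ fun i => h i.succ)
    · intro m m' hm
      simpa using congrArg (dsumπ M 0).f hm
    · refine ⟨(dsumπ M 0).f x, ?_⟩
      have := hx x
      rw [h, map_zero, add_zero] at this
      exact this.symm

lemma thick_dsum {P : ObjectProperty (DerivedCat A)} (hP : IsThick P) {ι : Type} [Finite ι]
    (M : ι → DGModule A) (h : ∀ i, P (M i).toD) : P (dsum M).toD := by
  obtain ⟨n, ⟨e⟩⟩ := Finite.exists_equiv_fin ι
  exact hP.iso (isoOfQuasiIso _ (quasiIso_reindex M e.symm)) (thick_dsum_fin hP n _ fun i => h _)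

end DGModule

namespace DGModule

variable {k : Type u} [Field k] {A B : DGAlgebra.{u, v} k}

/-! ### External products as dg functors -/

lemma one_mem (A : DGAlgebra.{u, v} k) : (1 : A.carrier) ∈ A.grading 0 := SetLike.GradedOne.one_mem

lemma d_one (A : DGAlgebra.{u, v} k) : A.d 1 = 0 := by
  have := A.d_mul (one_mem A) 1
  simpa using this

/-- The identification of `B ⊗ A` with the underlying space of the tensor product of dg algebras. -/
abbrev toTensor (B A : DGAlgebra.{u, v} k) :
    B.carrier ⊗[k] A.carrier ≃ₗ[k] (B.tensor A).carrier :=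
  GradedTensorProduct.of k B.grading A.grading

lemma toTensor_mul {i j : ℤ} (b : B.carrier) {a : A.carrier} (ha : a ∈ A.grading j)
    {b' : B.carrier} (hb' : b' ∈ B.grading i) (a' : A.carrier) :
    toTensor B A (b ⊗ₜ a) * toTensor B A (b' ⊗ₜ a') =
      koszulSign k (j * i) • toTensor B A ((b * b') ⊗ₜ (a * a')) :=
  gtp_mul_of_mem b ha hb' a'

lemma toTensor_mem {i j n : ℤ} (h : i + j = n) {b : B.carrier} (hb : b ∈ B.grading i)
    {a : A.carrier} (ha : a ∈ A.grading j) : toTensor B A (b ⊗ₜ a) ∈ (B.tensor A).grading n :=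
  ⟨_, tmul_mem_tensorGrading _ _ h hb ha, rfl⟩

lemma d_toTensor {i : ℤ} {b : B.carrier} (hb : b ∈ B.grading i) (a : A.carrier) :
    (B.tensor A).d (toTensor B A (b ⊗ₜ a)) =
      toTensor B A (B.d b ⊗ₜ a) + koszulSign k i • toTensor B A (b ⊗ₜ A.d a) :=
  (congrArg (toTensor B A) (tensorD_tmul B.grading B.d A.d hb a)).trans (by simp)

/-- The pure tensor `m ⊗ x`, as an element of `M ⊠ N`. -/
def tm {M : DGModule B} {N : DGModule A} : M.carrier →ₗ[k] N.carrier →ₗ[k] (M.box N).carrier :=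
  TensorProduct.mk k M.carrier N.carrier

section Box

variable {M M' M'' : DGModule B} {N N' N'' : DGModule A}

lemma box_act_tm {i j : ℤ} (m : M.carrier) {x : N.carrier}
    (hx : x ∈ N.grading j) {b : B.carrier} (hb : b ∈ B.grading i) (a : A.carrier) :
    (M.box N).act (tm m x) (toTensor B A (b ⊗ₜ a)) =
      koszulSign k (j * i) • tm (M.act m b) (N.act x a) :=
  tensorAct_tmul M N m hx hb a

lemma box_d_tm {i : ℤ} {m : M.carrier} (hm : m ∈ M.grading i) (x : N.carrier) :
    (M.box N).d (tm m x) = tm (M.d m) x + koszulSign k i • tm m (N.d x) :=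
  tensorD_tmul M.grading M.d N.d hm x

lemma tm_mem {i j n : ℤ} (h : i + j = n) {m : M.carrier} (hm : m ∈ M.grading i) {x : N.carrier}
    (hx : x ∈ N.grading j) : tm m x ∈ (M.box N).grading n :=
  tmul_mem_tensorGrading _ _ h hm hx

lemma box_induction {p : (M.box N).carrier → Prop} (t : (M.box N).carrier) (zero : p 0)
    (tm : ∀ i, ∀ m ∈ M.grading i, ∀ j, ∀ x ∈ N.grading j, p (tm m x))
    (add : ∀ a b, p a → p b → p (a + b)) : p t :=
  graded_tensor_induction M.grading N.grading t zero tm add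

lemma tensor_induction {p : (B.tensor A).carrier → Prop} (t : (B.tensor A).carrier) (zero : p 0)
    (tmul : ∀ i, ∀ b ∈ B.grading i, ∀ j, ∀ a ∈ A.grading j, p (toTensor B A (b ⊗ₜ a)))
    (add : ∀ a b, p a → p b → p (a + b)) : p t := by
  obtain ⟨t, rfl⟩ := (toTensor B A).surjective t
  refine graded_tensor_induction (p := fun t => p (toTensor B A t)) B.grading A.grading t ?_
    tmul fun a b ha hb => ?_
  · simpa using zero
  · simpa using add _ _ ha hb

/-- The linear map out of `M ⊠ N` given by a bilinear map. -/
def boxLift {X : Type v} [AddCommGroup X] [Module k X]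
    (f : M.carrier →ₗ[k] N.carrier →ₗ[k] X) : (M.box N).carrier →ₗ[k] X := TensorProduct.lift f

@[simp] lemma boxLift_tm {X : Type v} [AddCommGroup X] [Module k X]
    (f : M.carrier →ₗ[k] N.carrier →ₗ[k] X) (m : M.carrier) (x : N.carrier) :
    boxLift f (tm m x) = f m x := TensorProduct.lift.tmul m x

/-- The tensor product of two linear maps. -/
def boxMap (f : M.carrier →ₗ[k] M'.carrier) (g : N.carrier →ₗ[k] N'.carrier) :
    (M.box N).carrier →ₗ[k] (M'.box N').carrier := TensorProduct.map f g

@[simp] lemma boxMap_tm (f : M.carrier →ₗ[k] M'.carrier) (g : N.carrier →ₗ[k] N'.carrier)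
    (m : M.carrier) (x : N.carrier) : boxMap f g (tm m x) = tm (f m) (g x) := rfl

lemma box_hom_ext {X : Type v} [AddCommGroup X] [Module k X] {f g : (M.box N).carrier →ₗ[k] X}
    (h : ∀ i, ∀ m ∈ M.grading i, ∀ j, ∀ x ∈ N.grading j, f (tm m x) = g (tm m x)) : f = g :=
  graded_tensor_hom_ext M.grading N.grading h

lemma isDeg_of_box {K : DGModule (B.tensor A)} {r : ℤ} {f : (M.box N).carrier →ₗ[k] K.carrier}
    (h1 : ∀ i, ∀ m ∈ M.grading i, ∀ j, ∀ x ∈ N.grading j, f (tm m x) ∈ K.grading (i + j + r))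
    (h2 : ∀ i, ∀ m ∈ M.grading i, ∀ j, ∀ x ∈ N.grading j, ∀ l, ∀ b ∈ B.grading l, ∀ n,
      ∀ a ∈ A.grading n, koszulSign k (j * l) • f (tm (M.act m b) (N.act x a)) =
        K.act (f (tm m x)) (toTensor B A (b ⊗ₜ a))) :
    IsDeg (M.box N) K r f where
  mem {n t} ht := by
    refine tensorGrading_le (S := (K.grading (n + r)).comap f) M.grading N.grading ?_ ht
    rintro i j rfl m hm x hx
    exact h1 i m hm j x hx
  act t p := by
    induction t using box_induction with
    | zero => simp only [map_zero, LinearMap.zero_apply]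
    | add s t hs ht => simp only [map_add, LinearMap.add_apply, hs, ht]
    | tm i m hm j x hx =>
    induction p using tensor_induction with
    | zero => simp only [map_zero]
    | add p q hp hq => simp only [map_add, hp, hq]
    | tmul l b hb n a ha =>
      rw [box_act_tm m hx hb a, map_smul]
      exact h2 i m hm j x hx l b hb n a ha

end Box

/-- The dg functor `M ↦ M ⊠ P`. -/
def boxRight (P : DGModule A) (B : DGAlgebra.{u, v} k) : DGFun B (B.tensor A) where
  obj M := M.box P
  map _ _ _ f := boxMap f LinearMap.id
  isDeg {M N r f} hf := isDeg_of_box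
    (fun i m hm j x hx => tm_mem (by ring) (hf.mem hm) hx)
    (fun i m hm j x hx l b hb n a ha => by
      rw [boxMap_tm, boxMap_tm, LinearMap.id_apply, LinearMap.id_apply, box_act_tm _ hx hb a,
        hf.act])
  map_id M := box_hom_ext fun i m hm j x hx => rfl
  map_comp _ _ := box_hom_ext fun i m hm j x hx => rfl
  map_add {M N r f g} _ _ := box_hom_ext fun i m hm j x hx => by
    simp only [boxMap_tm, LinearMap.add_apply, map_add]
  map_homD {M N r f} hf := box_hom_ext fun i m hm j x hx => by
    rw [homD_apply, box_d_tm hm, map_add, map_smul]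
    simp only [boxMap_tm, LinearMap.id_apply, homD_apply, map_sub, map_smul, LinearMap.sub_apply,
      LinearMap.smul_apply]
    rw [box_d_tm (hf.mem hm)]
    rcases koszulSign_cases (k := k) i with h1 | h1 <;>
    rcases koszulSign_cases (k := k) r with h2 | h2 <;>
    simp only [h1, h2, koszulSign_add] <;> module
  acyclic {M} hM := by
    obtain ⟨h, h1, h2⟩ := hM.exists_contraction
    refine acyclic_of_homotopy (boxMap h LinearMap.id) fun t => ?_
    refine LinearMap.congr_fun (f := (M.box P).d ∘ₗ boxMap h LinearMap.id +
      boxMap h LinearMap.id ∘ₗ (M.box P).d) (g := LinearMap.id)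
      (box_hom_ext fun i m hm j x hx => ?_) t
    simp only [LinearMap.add_apply, LinearMap.comp_apply]
    rw [box_d_tm hm, map_add, map_smul]
    simp only [boxMap_tm, LinearMap.id_apply]
    rw [box_d_tm (h1 i m hm)]
    conv_rhs => rw [← h2 m]
    simp only [map_add, LinearMap.add_apply, sub_eq_add_neg, koszulSign_add,
      DGFun.koszulSign_neg, koszulSign_one]
    module

/-- The dg functor `X ↦ V ⊠ X`; a map `f` of degree `r` is sent to
`v ⊗ x ↦ (-1)^(r |v|) v ⊗ f x`. -/
def boxLeft (V : DGModule B) (A : DGAlgebra.{u, v} k) : DGFun A (B.tensor A) where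
  obj X := V.box X
  map _ _ r f := boxMap (signOp V.grading r) f
  isDeg {M N r f} hf := isDeg_of_box
    (fun i m hm j x hx => by
      rw [boxMap_tm, signOp_of_mem V.grading r hm]
      exact tm_mem (by ring) (Submodule.smul_mem _ _ hm) (hf.mem hx))
    (fun i m hm j x hx l b hb n a ha => by
      rw [boxMap_tm, boxMap_tm, signOp_of_mem V.grading r hm,
        signOp_of_mem V.grading r (V.act_mem hm hb), box_act_tm _ (hf.mem hx) hb a, hf.act]
      simp only [map_smul, LinearMap.smul_apply, smul_smul, add_mul, koszulSign_add, mul_comm r l]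
      congr 1
      ring)
  map_id M := box_hom_ext fun i m hm j x hx => by
    rw [boxMap_tm, signOp_of_mem V.grading 0 hm]
    simp
  map_comp {M N K r s f g} _ _ := box_hom_ext fun i m hm j x hx => by
    simp only [LinearMap.comp_apply, boxMap_tm, signOp_of_mem V.grading _ hm, map_smul,
      LinearMap.smul_apply, smul_smul, mul_add, koszulSign_add]
  map_add {M N r f g} _ _ := box_hom_ext fun i m hm j x hx => by
    simp only [boxMap_tm, LinearMap.add_apply, map_add]
  map_homD {M N r f} hf := box_hom_ext fun i m hm j x hx => by
    rw [homD_apply, box_d_tm hm, map_add, map_smul]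
    simp only [boxMap_tm, homD_apply, map_sub, map_smul,
      signOp_of_mem V.grading _ hm, signOp_of_mem V.grading _ (V.d_mem hm), LinearMap.smul_apply]
    rw [box_d_tm hm]
    rcases koszulSign_cases (k := k) i with h1 | h1 <;>
    rcases koszulSign_cases (k := k) r with h2 | h2 <;>
    rcases koszulSign_cases (k := k) (i * r) with h3 | h3 <;>
    simp only [h1, h2, h3, koszulSign_add, mul_add, add_mul, mul_one, one_mul] <;> module
  acyclic {M} hM := by
    obtain ⟨h, h1, h2⟩ := hM.exists_contraction
    refine acyclic_of_homotopy (boxMap (signOp V.grading 1) h) fun t => ?_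
    refine LinearMap.congr_fun (f := (V.box M).d ∘ₗ boxMap (signOp V.grading 1) h +
      boxMap (signOp V.grading 1) h ∘ₗ (V.box M).d) (g := LinearMap.id)
      (box_hom_ext fun i m hm j x hx => ?_) t
    simp only [LinearMap.add_apply, LinearMap.comp_apply]
    rw [box_d_tm hm, map_add, map_smul]
    simp only [boxMap_tm, LinearMap.id_apply, signOp_of_mem V.grading _ hm,
      signOp_of_mem V.grading _ (V.d_mem hm), map_smul, LinearMap.smul_apply]
    rw [box_d_tm hm]
    conv_rhs => rw [← h2 x]
    simp only [map_add, mul_one, koszulSign_add, koszulSign_one, smul_add, smul_smul,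
      koszulSign_mul_self]
    module

end DGModule

namespace DGModule

variable {k : Type u} [Field k] {A B : DGAlgebra.{u, v} k}

/-! ### Restriction of scalars to one of the factors -/

section Restriction

variable (N : DGModule (B.tensor A))

/-- The right action of `a` in `A` on a dg module over `B ⊗ A`. -/
def actR : N.carrier →ₗ[k] A.carrier →ₗ[k] N.carrier :=
  N.act.compl₂ ((toTensor B A).toLinearMap ∘ₗ TensorProduct.mk k B.carrier A.carrier 1)

/-- The right action of `b` in `B` on a dg module over `B ⊗ A`. -/
def actL : N.carrier →ₗ[k] B.carrier →ₗ[k] N.carrier :=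
  N.act.compl₂ ((toTensor B A).toLinearMap ∘ₗ (TensorProduct.mk k B.carrier A.carrier).flip 1)

lemma actR_apply (x : N.carrier) (a : A.carrier) :
    N.actR x a = N.act x (toTensor B A (1 ⊗ₜ a)) := rfl

lemma actL_apply (x : N.carrier) (b : B.carrier) :
    N.actL x b = N.act x (toTensor B A (b ⊗ₜ 1)) := rfl

lemma one_tensor_one : toTensor B A (1 ⊗ₜ 1) = 1 := rfl

lemma actR_mul (x : N.carrier) (a a' : A.carrier) :
    N.actR x (a * a') = N.actR (N.actR x a) a' := by
  rw [actR_apply, actR_apply, actR_apply, ← N.act_mul]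
  congr 1
  suffices h : (toTensor B A).toLinearMap ∘ₗ TensorProduct.mk k B.carrier A.carrier 1 ∘ₗ
      (LinearMap.mul k A.carrier).flip a' = LinearMap.mulRight k (toTensor B A (1 ⊗ₜ a')) ∘ₗ
        (toTensor B A).toLinearMap ∘ₗ TensorProduct.mk k B.carrier A.carrier 1 from
    LinearMap.congr_fun h a
  refine graded_hom_ext A.grading fun i a ha => ?_
  refine Eq.trans ?_ (toTensor_mul 1 ha (one_mem B) a').symm
  simp

lemma actL_mul (x : N.carrier) (b b' : B.carrier) :
    N.actL x (b * b') = N.actL (N.actL x b) b' := by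
  rw [actL_apply, actL_apply, actL_apply, ← N.act_mul]
  congr 1
  suffices h : (toTensor B A).toLinearMap ∘ₗ (TensorProduct.mk k B.carrier A.carrier).flip 1 ∘ₗ
      LinearMap.mul k B.carrier b = LinearMap.mul k _ (toTensor B A (b ⊗ₜ 1)) ∘ₗ
        (toTensor B A).toLinearMap ∘ₗ (TensorProduct.mk k B.carrier A.carrier).flip 1 from
    LinearMap.congr_fun h b'
  refine graded_hom_ext B.grading fun i b' hb' => ?_
  refine Eq.trans ?_ (toTensor_mul b (one_mem A) hb' 1).symm
  simp

lemma actR_actL (x : N.carrier) (b : B.carrier) (a : A.carrier) :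
    N.actR (N.actL x b) a = N.act x (toTensor B A (b ⊗ₜ a)) := by
  rw [actR_apply, actL_apply, ← N.act_mul, toTensor_mul b (one_mem A) (one_mem B) a]
  simp

lemma actL_actR (x : N.carrier) {i j : ℤ} {b : B.carrier} (hb : b ∈ B.grading i)
    {a : A.carrier} (ha : a ∈ A.grading j) :
    N.actL (N.actR x a) b = koszulSign k (j * i) • N.act x (toTensor B A (b ⊗ₜ a)) := by
  rw [actR_apply, actL_apply, ← N.act_mul, toTensor_mul 1 ha hb 1, map_smul]
  simp

variable {N} in
lemma actL_mem {i j : ℤ} {x : N.carrier} {b : B.carrier} (hx : x ∈ N.grading i)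
    (hb : b ∈ B.grading j) : N.actL x b ∈ N.grading (i + j) :=
  N.act_mem hx (toTensor_mem (add_zero j) hb (one_mem A))

lemma d_actL {i : ℤ} {x : N.carrier} (hx : x ∈ N.grading i) (b : B.carrier) :
    N.d (N.actL x b) = N.actL (N.d x) b + koszulSign k i • N.actL x (B.d b) := by
  induction b using Decomposition.inductionOn B.grading with
  | zero => simp
  | add b b' h h' => simp only [map_add, h, h', smul_add]; abel
  | @homogeneous j b =>
    rw [actL_apply, N.d_act hx, d_toTensor b.2, d_one]
    simp [actL_apply]

/-- The restriction of a dg module over `B ⊗ A` to a dg module over `A`. -/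
def res : DGModule A where
  carrier := N.carrier
  grading := N.grading
  act := N.actR
  act_one x := by rw [actR_apply, one_tensor_one, N.act_one]
  act_mul := N.actR_mul
  act_mem hx ha := N.act_mem hx (toTensor_mem (zero_add _) (one_mem B) ha)
  d := N.d
  d_mem := N.d_mem
  d_d := N.d_d
  d_act {i x} hx a := by
    rw [actR_apply, N.d_act hx, d_toTensor (one_mem B), d_one]
    simp [actR_apply]

/-- The identity of the underlying vector spaces, from the restriction to `N`. -/
def ofRes : N.res.carrier →ₗ[k] N.carrier := LinearMap.id

/-- The identity of the underlying vector spaces, from `N` to its restriction. -/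
def toRes : N.carrier →ₗ[k] N.res.carrier := LinearMap.id

variable {N}

lemma isDeg_res {M N : DGModule (B.tensor A)} {r : ℤ} {f : M.carrier →ₗ[k] N.carrier}
    (hf : IsDeg M N r f) : IsDeg M.res N.res r (N.toRes ∘ₗ f ∘ₗ M.ofRes) :=
  ⟨fun h => hf.mem h, fun m _ => hf.act m _⟩

lemma acyclic_res {N : DGModule (B.tensor A)} : N.res.Acyclic ↔ N.Acyclic := Iff.rfl

end Restriction

/-! ### Modules of homomorphisms -/

section HomModule

/-- The homogeneous `A`-linear maps of a given degree, as a subspace of the linear maps. -/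
def homSub (P N : DGModule A) (r : ℤ) : Submodule k (P.carrier →ₗ[k] N.carrier) where
  carrier := {f | IsDeg P N r f}
  add_mem' hf hg := hf.add hg
  zero_mem' := IsDeg.zero
  smul_mem' c _ hf := hf.smul c

/-- The finite sums of homogeneous `A`-linear maps. -/
def homTot (P N : DGModule A) : Submodule k (P.carrier →ₗ[k] N.carrier) := ⨆ r, homSub P N r

/-- The grading on the space of finite sums of homogeneous maps. -/
def homGrading (P N : DGModule A) (r : ℤ) : Submodule k (homTot P N) :=
  (homSub P N r).comap (homTot P N).subtype

variable {P N : DGModule A}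

lemma homSub_le (r : ℤ) : homSub P N r ≤ homTot P N := le_iSup (homSub P N) r

lemma homTot_induction {p : homTot P N → Prop} (f : homTot P N) (zero : p 0)
    (deg : ∀ r (f : homTot P N), IsDeg P N r f.1 → p f) (add : ∀ f g, p f → p g → p (f + g)) :
    p f := by
  obtain ⟨f, hf⟩ := f
  refine Submodule.iSup_induction' (homSub P N) (motive := fun f hf => p ⟨f, hf⟩)
    (fun r f hf => deg r _ hf) zero (fun f g hf hg h h' => add _ _ h h') hf

variable (P N) in
lemma isInternal_homGrading : DirectSum.IsInternal (homGrading P N) := by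
  constructor
  · have key : ∀ (s i : ℤ) (p : P.carrier), p ∈ P.grading i → ∀ y : ⨁ r, homGrading P N r,
        N.proj (i + s) ((DirectSum.coeLinearMap (homGrading P N) y).1 p) = (y s).1.1 p := by
      intro s i p hp y
      induction y using DirectSum.induction_on with
      | zero => simp
      | add x y hx hy => simp only [map_add, Submodule.coe_add, LinearMap.add_apply, hx, hy,
          DirectSum.add_apply]
      | of r f =>
        rw [DirectSum.coeLinearMap_of]
        have hf : IsDeg P N r f.1.1 := f.2
        by_cases h : r = s
        · subst h
          rw [DirectSum.of_eq_same, proj_of_mem N (hf.mem hp)]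
        · rw [DirectSum.of_eq_of_ne _ _ _ (Ne.symm h), proj_of_mem_ne N (hf.mem hp) (by simpa)]
          rfl
    intro x y hxy
    refine DFinsupp.ext fun s => Subtype.ext (Subtype.ext (LinearMap.ext fun p => ?_))
    induction p using homogeneous_induction with
    | zero => simp
    | add p q hp hq => simp only [map_add, hp, hq]
    | hom i p hp =>
      have hxy' : DirectSum.coeLinearMap (homGrading P N) x =
        DirectSum.coeLinearMap (homGrading P N) y := hxy
      rw [← key s i p hp x, ← key s i p hp y, hxy']
  · intro f
    induction f using homTot_induction with
    | zero => exact ⟨0, map_zero _⟩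
    | add f g hf hg =>
      obtain ⟨x, rfl⟩ := hf
      obtain ⟨y, rfl⟩ := hg
      exact ⟨x + y, map_add _ _ _⟩
    | deg r f hf =>
      exact ⟨DirectSum.of (fun r => homGrading P N r) r ⟨f, hf⟩, DirectSum.coeAddMonoidHom_of _ _ _⟩

/-- The differential on the linear maps that is `homD r` on those of degree `r`. -/
def homTotD (P N : DGModule A) : (P.carrier →ₗ[k] N.carrier) →ₗ[k] (P.carrier →ₗ[k] N.carrier) where
  toFun f := N.d ∘ₗ f - signOp N.grading 1 ∘ₗ f ∘ₗ signOp P.grading 1 ∘ₗ P.d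
  map_add' f g := by ext p; simp; abel
  map_smul' c f := by ext p; simp [smul_sub]

lemma homTotD_of_isDeg {r : ℤ} {f : P.carrier →ₗ[k] N.carrier} (hf : IsDeg P N r f) :
    homTotD P N f = homD P N r f := by
  refine graded_hom_ext P.grading fun i p hp => ?_
  have h := P.d_mem hp
  rw [homD_apply]
  change N.d (f p) - signOp N.grading 1 (f (signOp P.grading 1 (P.d p))) = _
  rw [signOp_of_mem P.grading 1 h, map_smul, map_smul, signOp_of_mem N.grading 1 (hf.mem h),
    smul_smul]
  congr 2
  rcases koszulSign_cases (k := k) i with h1 | h1 <;>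
  rcases koszulSign_cases (k := k) r with h2 | h2 <;>
  simp [koszulSign_add, h1, h2]

lemma homTotD_mem {f : P.carrier →ₗ[k] N.carrier} (hf : f ∈ homTot P N) :
    homTotD P N f ∈ homTot P N := by
  refine homTot_induction (p := fun f => homTotD P N f.1 ∈ homTot P N) ⟨f, hf⟩ ?_ ?_ ?_
  · simp
  · intro r f hf
    rw [homTotD_of_isDeg hf]
    exact homSub_le _ (isDeg_homD hf)
  · intro f g hf hg
    rw [Submodule.coe_add, map_add]
    exact add_mem hf hg

end HomModule

section HomModule

variable {P : DGModule A} {N : DGModule (B.tensor A)}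

variable (P N) in
/-- The action `(f b) p = (-1)^(|b| |p|) (f p) b` of `B` on linear maps. -/
def homAct :
    B.carrier →ₗ[k] (P.carrier →ₗ[k] N.res.carrier) →ₗ[k] (P.carrier →ₗ[k] N.res.carrier) :=
  gradedGlue B.grading fun j => (LinearMap.mk₂ k
    (fun (b : B.carrier) (f : P.carrier →ₗ[k] N.res.carrier) =>
      N.toRes ∘ₗ N.actL.flip b ∘ₗ N.ofRes ∘ₗ f ∘ₗ signOp P.grading j)
    (fun b b' f => by ext; simp) (fun c b f => by ext; simp) (fun b f f' => by ext; simp)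
    (fun c b f => by ext; simp)) ∘ₗ (B.grading j).subtype

lemma homAct_apply {i j : ℤ} {b : B.carrier} (hb : b ∈ B.grading j)
    (f : P.carrier →ₗ[k] N.res.carrier) {p : P.carrier} (hp : p ∈ P.grading i) :
    homAct P N b f p = koszulSign k (i * j) • N.toRes (N.actL (N.ofRes (f p)) b) := by
  rw [homAct, gradedGlue_of_mem B.grading _ hb]
  change N.toRes (N.actL (N.ofRes (f (signOp P.grading j p))) b) = _
  rw [signOp_of_mem P.grading j hp]
  simp only [map_smul, LinearMap.smul_apply]

lemma actL_actR_comm (N : DGModule (B.tensor A)) (x : N.carrier) {i j l : ℤ} {b : B.carrier}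
    (hb : b ∈ B.grading j) {a : A.carrier} (ha : a ∈ A.grading l) :
    koszulSign k ((i + l) * j) • N.actL (N.actR x a) b =
      koszulSign k (i * j) • N.actR (N.actL x b) a := by
  rw [actR_actL, actL_actR N _ hb ha, smul_smul, add_mul, koszulSign_add, mul_assoc,
    koszulSign_mul_self, mul_one]

lemma isDeg_homAct {r j : ℤ} {b : B.carrier} (hb : b ∈ B.grading j)
    {f : P.carrier →ₗ[k] N.res.carrier} (hf : IsDeg P N.res r f) :
    IsDeg P N.res (r + j) (homAct P N b f) where
  mem {i p} hp := by
    rw [homAct_apply hb f hp]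
    have := actL_mem (N := N) (hf.mem hp) hb
    rw [add_assoc] at this
    exact Submodule.smul_mem _ _ this
  act p a := by
    induction p using homogeneous_induction with
    | zero => simp
    | add p q hp hq => simp only [map_add, LinearMap.add_apply, hp, hq]
    | hom i p hp =>
    induction a using Decomposition.inductionOn A.grading with
    | zero => simp
    | add a a' h h' => simp only [map_add, h, h']
    | @homogeneous l a =>
      rw [homAct_apply hb f (P.act_mem hp a.2), homAct_apply hb f hp, hf.act, map_smul,
        LinearMap.smul_apply]
      exact actL_actR_comm N (f p) hb a.2

lemma homAct_mem {b : B.carrier} {f : P.carrier →ₗ[k] N.res.carrier} (hf : f ∈ homTot P N.res) :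
    homAct P N b f ∈ homTot P N.res := by
  refine homTot_induction (p := fun f => homAct P N b f.1 ∈ homTot P N.res) ⟨f, hf⟩ ?_ ?_ ?_
  · simp
  · intro r f hf
    induction b using Decomposition.inductionOn B.grading with
    | zero => simp
    | add a a' h h' =>
      rw [map_add, LinearMap.add_apply]
      exact add_mem h h'
    | @homogeneous l b => exact homSub_le _ (isDeg_homAct b.2 hf)
  · intro f g hf hg
    rw [Submodule.coe_add, map_add]
    exact add_mem hf hg

lemma homModule_d_act_aux (N : DGModule (B.tensor A)) {i r : ℤ} {x : N.carrier}
    (hx : x ∈ N.grading (i + r)) (y : N.carrier) (b : B.carrier) (j : ℤ) :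
    N.d (koszulSign k (i * j) • N.actL x b) -
      koszulSign k (r + j) • koszulSign k ((i + 1) * j) • N.actL y b =
      koszulSign k (i * j) • N.actL (N.d x - koszulSign k r • y) b +
      koszulSign k r • koszulSign k (i * (j + 1)) • N.actL x (B.d b) := by
  rw [map_smul, d_actL N hx, map_sub, map_smul, LinearMap.sub_apply, LinearMap.smul_apply]
  rcases koszulSign_cases (k := k) i with h1 | h1 <;>
  rcases koszulSign_cases (k := k) r with h2 | h2 <;>
  rcases koszulSign_cases (k := k) j with h3 | h3 <;>
  rcases koszulSign_cases (k := k) (i * j) with h4 | h4 <;>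
  simp only [h1, h2, h3, h4, koszulSign_add, mul_add, add_mul, mul_one, one_mul] <;> module

variable (P N) in
/-- The dg module `Hom_A(P, N)` over `B`, for a dg module `P` over `A` and a dg module `N` over
`B ⊗ A`. Its elements are the finite sums of homogeneous `A`-linear maps. -/
def homModule : DGModule B where
  carrier := homTot P N.res
  grading := homGrading P N.res
  decomposition := (isInternal_homGrading P N.res).chooseDecomposition
  act := LinearMap.mk₂ k (fun f b => ⟨homAct P N b f.1, homAct_mem f.2⟩)
    (fun f g b => Subtype.ext (map_add _ _ _)) (fun c f b => Subtype.ext (map_smul _ _ _))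
    (fun f b b' => Subtype.ext (LinearMap.map_add₂ _ _ _ _))
    (fun c f b => Subtype.ext (LinearMap.map_smul₂ _ _ _ _))
  act_one f := Subtype.ext (graded_hom_ext P.grading fun i p hp => by
    refine (homAct_apply (one_mem B) f.1 hp).trans ?_
    rw [mul_zero, koszulSign_zero, one_smul]
    exact N.act_one _)
  act_mul f b c := by
    refine Subtype.ext (graded_hom_ext P.grading fun i p hp => ?_)
    change homAct P N (b * c) f.1 p = homAct P N c (homAct P N b f.1) p
    induction b using Decomposition.inductionOn B.grading with
    | zero => simp
    | add a a' h h' => simp only [map_add, LinearMap.add_apply, add_mul, h, h']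
    | @homogeneous j b =>
    induction c using Decomposition.inductionOn B.grading with
    | zero => simp
    | add a a' h h' => simp only [map_add, LinearMap.add_apply, mul_add, h, h']
    | @homogeneous l c =>
      rw [homAct_apply (SetLike.mul_mem_graded b.2 c.2) _ hp, homAct_apply c.2 _ hp,
        homAct_apply b.2 _ hp, actL_mul, mul_add, koszulSign_add]
      simp only [map_smul, LinearMap.smul_apply, smul_smul]
      rw [mul_comm]
      rfl
  act_mem hf hb := isDeg_homAct hb hf
  d := (homTotD P N.res).restrict fun _ hf => homTotD_mem hf
  d_mem {r f} hf := by
    have hf : IsDeg P N.res r f.1 := hf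
    change IsDeg P N.res (r + 1) (homTotD P N.res f.1)
    rw [homTotD_of_isDeg hf]
    exact isDeg_homD hf
  d_d f := by
    refine Subtype.ext ?_
    change homTotD P N.res (homTotD P N.res f.1) = 0
    induction f using homTot_induction with
    | zero => simp
    | add f g hf hg => simp only [Submodule.coe_add, map_add, hf, hg, add_zero]
    | deg r f hf => rw [homTotD_of_isDeg hf, homTotD_of_isDeg (isDeg_homD hf), homD_homD]
  d_act {r f} hf b := by
    refine Subtype.ext ?_
    change homTotD P N.res (homAct P N b f.1) = homAct P N b (homTotD P N.res f.1) +
      koszulSign k r • homAct P N (B.d b) f.1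
    replace hf : IsDeg P N.res r f.1 := hf
    induction b using Decomposition.inductionOn B.grading with
    | zero => simp
    | add a a' h h' => simp only [map_add, LinearMap.add_apply, h, h', smul_add]; abel
    | @homogeneous j b =>
      rw [homTotD_of_isDeg (isDeg_homAct b.2 hf), homTotD_of_isDeg hf]
      refine graded_hom_ext P.grading fun i p hp => ?_
      rw [LinearMap.add_apply, LinearMap.smul_apply, homD_apply, homAct_apply b.2 _ hp,
        homAct_apply b.2 _ (P.d_mem hp), homAct_apply b.2 _ hp, homAct_apply (B.d_mem b.2) _ hp,
        homD_apply]
      exact homModule_d_act_aux N (hf.mem hp) (f.1 (P.d p)) b.1 j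

end HomModule

end DGModule

namespace DGModule

variable {k : Type u} [Field k] {A B C : DGAlgebra.{u, v} k}

/-- The factorization of a linear map through an injective one. -/
def liftInjective {X Y Z : Type v} [AddCommGroup X] [AddCommGroup Y] [AddCommGroup Z]
    [Module k X] [Module k Y] [Module k Z] (i : Y →ₗ[k] Z) (hi : Function.Injective i)
    (g : X →ₗ[k] Z) (h : ∀ x, ∃ y, i y = g x) : X →ₗ[k] Y :=
  (LinearEquiv.ofInjective i hi).symm.toLinearMap ∘ₗ g.codRestrict (LinearMap.range i) h

lemma liftInjective_apply {X Y Z : Type v} [AddCommGroup X] [AddCommGroup Y] [AddCommGroup Z]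
    [Module k X] [Module k Y] [Module k Z] (i : Y →ₗ[k] Z) (hi : Function.Injective i)
    (g : X →ₗ[k] Z) (h : ∀ x, ∃ y, i y = g x) (x : X) : i (liftInjective i hi g h x) = g x :=
  LinearEquiv.ofInjective_symm_apply (f := i) (h := hi) (g.codRestrict (LinearMap.range i) h x)

section HomModule

variable {P : DGModule A} {M N K : DGModule (B.tensor A)}

/-- The evaluation of an element of `Hom_A(P, N)`. -/
def homEval (P : DGModule A) (N : DGModule (B.tensor A)) :
    (homModule P N).carrier →ₗ[k] P.carrier →ₗ[k] N.carrier :=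
  (homTot P N.res).subtype

/-- A homogeneous `A`-linear map, as an element of `Hom_A(P, N)`. -/
def homMk {r : ℤ} {f : P.carrier →ₗ[k] N.carrier} (hf : IsDeg P N.res r f) :
    (homModule P N).carrier := ⟨f, homSub_le r hf⟩

lemma homMk_mem {r : ℤ} {f : P.carrier →ₗ[k] N.carrier} (hf : IsDeg P N.res r f) :
    homMk hf ∈ (homModule P N).grading r := hf

lemma homModule_ext {x y : (homModule P N).carrier} (h : homEval P N x = homEval P N y) : x = y :=
  Subtype.ext h

lemma isDeg_homEval {r : ℤ} {x : (homModule P N).carrier} (hx : x ∈ (homModule P N).grading r) :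
    IsDeg P N.res r (homEval P N x) := hx

lemma homEval_mem {i r : ℤ} {x : (homModule P N).carrier} (hx : x ∈ (homModule P N).grading r)
    {p : P.carrier} (hp : p ∈ P.grading i) : homEval P N x p ∈ N.grading (i + r) :=
  (isDeg_homEval hx).mem hp

lemma homEval_d {r : ℤ} {x : (homModule P N).carrier} (hx : x ∈ (homModule P N).grading r)
    (p : P.carrier) : homEval P N ((homModule P N).d x) p =
      N.d (homEval P N x p) - koszulSign k r • homEval P N x (P.d p) :=
  LinearMap.congr_fun (homTotD_of_isDeg (isDeg_homEval hx)) p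

lemma homEval_act_p (x : (homModule P N).carrier) (p : P.carrier) (a : A.carrier) :
    homEval P N x (P.act p a) = N.actR (homEval P N x p) a := by
  induction x using homogeneous_induction with
  | zero => simp
  | add x y hx hy => simp only [map_add, LinearMap.add_apply, hx, hy]
  | hom r x hx => exact (isDeg_homEval hx).act p a

lemma homEval_act {i j : ℤ} (x : (homModule P N).carrier) {b : B.carrier} (hb : b ∈ B.grading j)
    {p : P.carrier} (hp : p ∈ P.grading i) : homEval P N ((homModule P N).act x b) p =
      koszulSign k (i * j) • N.actL (homEval P N x p) b :=
  homAct_apply hb x.1 hp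

/-- A dg module `P` is `K`-projective if every closed homogeneous map from `P` to an acyclic dg
module is null-homotopic. -/
def KProj (P : DGModule A) : Prop := ∀ N : DGModule A, N.Acyclic → ∀ r f, IsDeg P N r f →
  homD P N r f = 0 → ∃ g, IsDeg P N (r - 1) g ∧ homD P N (r - 1) g = f

lemma acyclic_homModule
    (h : ∀ r f, IsDeg P N.res r f → homD P N.res r f = 0 →
      ∃ g, IsDeg P N.res (r - 1) g ∧ homD P N.res (r - 1) g = f) : (homModule P N).Acyclic := by
  refine acyclic_of_homogeneous fun r x hx hdx => ?_
  obtain ⟨g, hg, hg'⟩ := h r (homEval P N x) (isDeg_homEval hx) (by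
    rw [← homTotD_of_isDeg (isDeg_homEval hx)]
    exact congrArg Subtype.val hdx)
  exact ⟨homMk (N := N) hg, homModule_ext ((homTotD_of_isDeg hg).trans hg')⟩

open Classical in
/-- Postcomposition with a linear map that preserves finite sums of homogeneous `A`-linear maps,
on `Hom_A(P, -)`; for other linear maps the value is irrelevant. -/
def homPost (P : DGModule A) (M N : DGModule (B.tensor A)) (f : M.carrier →ₗ[k] N.carrier) :
    (homModule P M).carrier →ₗ[k] (homModule P N).carrier :=
  if h : ∀ x, ∃ y, homEval P N y = f ∘ₗ homEval P M x then
    liftInjective (homEval P N) (fun _ _ => homModule_ext)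
      (LinearMap.llcomp k P.carrier M.carrier N.carrier f ∘ₗ homEval P M) h
  else 0

lemma homEval_homPost {r : ℤ} {f : M.carrier →ₗ[k] N.carrier} (hf : IsDeg M N r f)
    (x : (homModule P M).carrier) (p : P.carrier) :
    homEval P N (homPost P M N f x) p = f (homEval P M x p) := by
  have h : ∀ x, ∃ y, homEval P N y = f ∘ₗ homEval P M x := by
    intro x
    induction x using homogeneous_induction with
    | zero => exact ⟨0, by simp⟩
    | add x y hx hy =>
      obtain ⟨x', hx⟩ := hx
      obtain ⟨y', hy⟩ := hy
      exact ⟨x' + y', by rw [map_add, hx, hy, map_add, LinearMap.comp_add]⟩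
    | hom i x hx => exact ⟨homMk (N := N) ((isDeg_res hf).comp (isDeg_homEval hx)), rfl⟩
  rw [homPost, dif_pos h]
  exact LinearMap.congr_fun (liftInjective_apply (homEval P N) _ _ h x) p

lemma homPost_mem {i r : ℤ} {f : M.carrier →ₗ[k] N.carrier} (hf : IsDeg M N r f)
    {x : (homModule P M).carrier} (hx : x ∈ (homModule P M).grading i) :
    homPost P M N f x ∈ (homModule P N).grading (i + r) := by
  have : homEval P N (homPost P M N f x) = f ∘ₗ homEval P M x :=
    LinearMap.ext fun p => homEval_homPost hf x p
  change IsDeg P N.res (i + r) (homEval P N (homPost P M N f x))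
  rw [this]
  exact (isDeg_res hf).comp (isDeg_homEval hx)

/-- The dg functor `N ↦ Hom_A(P, N)`, for a `K`-projective dg module `P`. -/
def homFun (P : DGModule A) (hP : KProj P) (B : DGAlgebra.{u, v} k) : DGFun (B.tensor A) B where
  obj N := homModule P N
  map M N _ f := homPost P M N f
  isDeg {M N r f} hf :=
    { mem := fun {i x} hx => by
        exact homPost_mem hf hx
      act := fun x b => by
        refine homModule_ext (graded_hom_ext P.grading fun i p hp => ?_)
        induction b using Decomposition.inductionOn B.grading with
        | zero => simp
        | add a b ha hb => simp only [map_add, LinearMap.add_apply, ha, hb]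
        | @homogeneous j b =>
          rw [homEval_homPost hf, homEval_act _ b.2 hp, homEval_act _ b.2 hp, homEval_homPost hf,
            map_smul, actL_apply, hf.act, actL_apply] }
  map_id M := LinearMap.ext fun x => homModule_ext (LinearMap.ext fun p =>
    homEval_homPost (IsDeg.id M) x p)
  map_comp hf hg := LinearMap.ext fun x => homModule_ext (LinearMap.ext fun p => by
    rw [homEval_homPost (hg.comp hf), LinearMap.comp_apply, LinearMap.comp_apply,
      homEval_homPost hg, homEval_homPost hf])
  map_add hf hg := LinearMap.ext fun x => homModule_ext (LinearMap.ext fun p => by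
    rw [homEval_homPost (hf.add hg), LinearMap.add_apply, LinearMap.add_apply, map_add,
      LinearMap.add_apply, homEval_homPost hg, homEval_homPost hf])
  map_homD {M N r f} hf := LinearMap.ext fun x => homModule_ext (LinearMap.ext fun p => by
    induction x using homogeneous_induction with
    | zero => simp
    | add x y hx hy => simp only [map_add, LinearMap.add_apply, hx, hy]
    | hom i x hx =>
      have h1 : homPost P M N f x ∈ (homModule P N).grading (i + r) := homPost_mem hf hx
      rw [homEval_homPost (isDeg_homD hf), homD_apply, homD_apply, map_sub, map_smul,
        LinearMap.sub_apply, LinearMap.smul_apply, homEval_d h1, homEval_homPost hf,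
        homEval_homPost hf, homEval_homPost hf, homEval_d hx, map_sub, map_smul, koszulSign_add]
      module)
  acyclic {N} hN := acyclic_homModule (hP N.res (acyclic_res.2 hN))

/-- The evaluation `Hom_A(P, N) ⊠ P → N`. -/
def evHom (P : DGModule A) (N : DGModule (B.tensor A)) : (homModule P N).box P ⟶ N :=
  mkHom (f := boxLift (homEval P N))
    (isDeg_of_box
      (fun i x hx j p hp => by
        rw [boxLift_tm, add_zero, add_comm]
        exact homEval_mem hx hp)
      (fun i x hx j p hp l b hb n a ha => by
        rw [boxLift_tm, boxLift_tm, homEval_act _ hb (P.act_mem hp ha), homEval_act_p,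
          actL_actR _ _ hb ha, smul_smul, smul_smul, ← koszulSign_add, ← koszulSign_add]
        rw [show j * l + (j + n) * l + n * l = (j * l + n * l) + (j * l + n * l) by ring,
          koszulSign_add, koszulSign_mul_self, one_smul]))
    (box_hom_ext fun i x hx j p hp => by
      rw [homD_apply, box_d_tm hx, map_add, map_smul, boxLift_tm, boxLift_tm, boxLift_tm,
        homEval_d hx]
      simp)

lemma evHom_tm (x : (homModule P N).carrier) (p : P.carrier) :
    (evHom P N).f (tm x p) = homEval P N x p := boxLift_tm _ x p

lemma evHom_natural {r : ℤ} {f : M.carrier →ₗ[k] N.carrier} (hf : IsDeg M N r f) :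
    f ∘ₗ (evHom P M).f = (evHom P N).f ∘ₗ boxMap (homPost P M N f) LinearMap.id :=
  box_hom_ext fun i x hx j p hp => by
    rw [LinearMap.comp_apply, LinearMap.comp_apply, evHom_tm, boxMap_tm, evHom_tm,
      homEval_homPost hf, LinearMap.id_apply]

lemma tm_act (V : DGModule B) (P : DGModule A) (v : V.carrier) (p : P.carrier) (a : A.carrier) :
    tm v (P.act p a) = (V.box P).actR (tm v p) a := by
  induction p using homogeneous_induction with
  | zero => simp
  | add p q hp hq => simp only [map_add, LinearMap.add_apply, hp, hq]
  | hom j p hp =>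
    rw [actR_apply, box_act_tm v hp (one_mem B) a, mul_zero, koszulSign_zero, one_smul, V.act_one]

lemma isDeg_tm (V : DGModule B) (P : DGModule A) {i : ℤ} {v : V.carrier} (hv : v ∈ V.grading i) :
    IsDeg P (V.box P).res i (tm v) :=
  ⟨fun hp => tm_mem (by ring) hv hp, tm_act V P v⟩

lemma exists_homEval_eq_tm (V : DGModule B) (P : DGModule A) (v : V.carrier) :
    ∃ x, homEval P (V.box P) x = tm v := by
  induction v using homogeneous_induction with
  | zero => exact ⟨0, by simp⟩
  | add v w hv hw =>
    obtain ⟨x, hx⟩ := hv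
    obtain ⟨y, hy⟩ := hw
    exact ⟨x + y, by rw [map_add, map_add, hx, hy]⟩
  | hom i v hv => exact ⟨homMk (N := V.box P) (isDeg_tm V P hv), rfl⟩

/-- The linear map `V → Hom_A(P, V ⊠ P)` that sends `v` to `p ↦ v ⊗ p`. -/
def constMap (V : DGModule B) (P : DGModule A) :
    V.carrier →ₗ[k] (homModule P (V.box P)).carrier :=
  liftInjective (homEval P (V.box P)) (fun _ _ => homModule_ext) tm (exists_homEval_eq_tm V P)

lemma homEval_constMap (V : DGModule B) (P : DGModule A) (v : V.carrier) :
    homEval P (V.box P) (constMap V P v) = tm v := liftInjective_apply _ _ _ _ v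

lemma constMap_mem (V : DGModule B) (P : DGModule A) {i : ℤ} {v : V.carrier}
    (hv : v ∈ V.grading i) : constMap V P v ∈ (homModule P (V.box P)).grading i := by
  change IsDeg P (V.box P).res i (homEval P (V.box P) (constMap V P v))
  rw [homEval_constMap]
  exact isDeg_tm V P hv

/-- The morphism `V → Hom_A(P, V ⊠ P)` that sends `v` to `p ↦ v ⊗ p`. -/
def constHom (V : DGModule B) (P : DGModule A) : V ⟶ homModule P (V.box P) where
  f := constMap V P
  map_mem hv := constMap_mem V P hv
  map_act v b := by
    refine homModule_ext (graded_hom_ext P.grading fun i p hp => ?_)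
    induction b using Decomposition.inductionOn B.grading with
    | zero => simp
    | add a b ha hb => simp only [map_add, LinearMap.add_apply, ha, hb]
    | @homogeneous j b =>
      rw [homEval_act _ b.2 hp, homEval_constMap, homEval_constMap, actL_apply,
        box_act_tm v hp b.2 1, P.act_one, smul_smul, koszulSign_mul_self, one_smul]
  map_d v := by
    refine homModule_ext (LinearMap.ext fun p => ?_)
    induction v using homogeneous_induction with
    | zero => simp
    | add v w hv hw => simp only [map_add, LinearMap.add_apply, hv, hw]
    | hom i v hv =>
      rw [homEval_d (constMap_mem V P hv), homEval_constMap, homEval_constMap, box_d_tm hv]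
      simp

lemma homEval_constHom (V : DGModule B) (P : DGModule A) (v : V.carrier) :
    homEval P (V.box P) ((constHom V P).f v) = tm v := homEval_constMap V P v

end HomModule

/-! ### Sums and cones of dg functors -/

section

variable {M N : DGModule A} (f : M ⟶ N)

lemma cone_ext {x y : (cone f).carrier} (h1 : coneFst f x = coneFst f y)
    (h2 : coneSnd f x = coneSnd f y) : x = y := Prod.ext h1 h2

lemma coneFst_d (x : (cone f).carrier) : coneFst f ((cone f).d x) = -M.d (coneFst f x) := rfl

lemma coneSnd_d (x : (cone f).carrier) :
    coneSnd f ((cone f).d x) = f.f (coneFst f x) + N.d (coneSnd f x) := rfl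

@[simp] lemma coneFst_inl (m : M.carrier) : coneFst f (coneInl f m) = m := rfl

@[simp] lemma coneSnd_inl (m : M.carrier) : coneSnd f (coneInl f m) = 0 := rfl

@[simp] lemma coneFst_inr (n : N.carrier) : coneFst f ((coneInr f).f n) = 0 := rfl

@[simp] lemma coneSnd_inr (n : N.carrier) : coneSnd f ((coneInr f).f n) = n := rfl

end

namespace DGFun

variable {ι : Type}

/-- The direct sum of a family of dg functors. -/
def dsum (F : ι → DGFun A B) : DGFun A B where
  obj M := DGModule.dsum fun i => (F i).obj M
  map M N r f := dsumDesc (fun i => (F i).obj M) fun i =>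
    (dsumι (fun i => (F i).obj N) i).f ∘ₗ (F i).map M N r f
  isDeg hf := isDeg_dsumDesc _ fun i =>
    (((dsumι _ i).isDeg.comp ((F i).isDeg hf)).cast (by ring))
  map_id M := dsum_hom_ext _ fun i => by
    ext x
    simp [(F i).map_id]
  map_comp hf hg := dsum_hom_ext _ fun i => by
    ext x
    simp [(F i).map_comp hf hg]
  map_add hf hg := dsum_hom_ext _ fun i => by
    ext x
    simp [(F i).map_add hf hg]
  map_homD {M N r f} hf := by
    rw [homD_dsumDesc]
    refine congrArg _ (funext fun i => ?_)
    have := homD_comp (r := r) (s := 0) (f := (F i).map M N r f)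
      (g := (dsumι (fun i => (F i).obj N) i).f)
    rw [add_zero, Hom.homD_eq_zero, ← (F i).map_homD hf] at this
    rw [this]
    simp
  acyclic hM := acyclic_dsum _ fun i => (F i).acyclic hM

/-- The cone of a natural transformation of dg functors. A map `f` of degree `r` acts by
`(s, x) ↦ ((-1)^r S f s, T f x)`. -/
def cone (S T : DGFun A B) (η : ∀ M, S.obj M ⟶ T.obj M)
    (hη : ∀ {M N : DGModule A} {r f}, IsDeg M N r f →
      T.map M N r f ∘ₗ (η M).f = (η N).f ∘ₗ S.map M N r f) : DGFun A B where
  obj M := DGModule.cone (η M)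
  map M N r f := koszulSign k r • (coneInl (η N) ∘ₗ S.map M N r f ∘ₗ coneFst (η M)) +
    (coneInr (η N)).f ∘ₗ T.map M N r f ∘ₗ coneSnd (η M)
  isDeg {M N r f} hf := IsDeg.add
    ((((isDeg_coneInl (η N)).comp ((S.isDeg hf).comp (isDeg_coneFst (η M)))).cast
      (by ring)).smul _)
    (((coneInr (η N)).isDeg.comp ((T.isDeg hf).comp (isDeg_coneSnd (η M)))).cast (by ring))
  map_id M := by
    rw [S.map_id, T.map_id, koszulSign_zero, one_smul, LinearMap.id_comp, LinearMap.id_comp,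
      cone_decomp]
  map_comp {M N K r s f g} hf hg := by
    rw [S.map_comp hf hg, T.map_comp hf hg]
    ext x
    refine Prod.ext ?_ ?_
    · change koszulSign k (r + s) • S.map N K s g (S.map M N r f x.1) + 0 =
        koszulSign k s • S.map N K s g (koszulSign k r • S.map M N r f x.1 + 0) + 0
      rw [add_zero, add_zero, add_zero, map_smul, smul_smul, koszulSign_add, mul_comm]
    · change koszulSign k (r + s) • 0 + T.map N K s g (T.map M N r f x.2) =
        koszulSign k s • 0 + T.map N K s g (koszulSign k r • 0 + T.map M N r f x.2)
      simp only [smul_zero, zero_add]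
  map_add {M N r f g} hf hg := by
    rw [S.map_add hf hg, T.map_add hf hg]
    simp only [LinearMap.add_comp, LinearMap.comp_add, smul_add]
    abel
  map_homD {M N r f} hf := by
    rw [S.map_homD hf, T.map_homD hf]
    ext x
    have h := LinearMap.congr_fun (hη hf) (coneFst (η M) x)
    simp only [LinearMap.comp_apply] at h
    refine cone_ext _ ?_ ?_
    · simp only [homD_apply, LinearMap.add_apply, LinearMap.smul_apply, LinearMap.comp_apply,
        _root_.map_add, _root_.map_zero, sub_zero, map_sub, map_smul, coneFst_d, coneFst_inl,
        coneFst_inr, _root_.map_neg, add_zero, smul_zero, neg_zero, koszulSign_add, koszulSign_one]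
      rcases koszulSign_cases (k := k) r with h1 | h1 <;> simp only [h1] <;> module
    · simp only [homD_apply, LinearMap.add_apply, LinearMap.smul_apply, LinearMap.comp_apply,
        _root_.map_add, _root_.map_zero, sub_zero, map_sub, map_smul, coneSnd_d, coneFst_inl,
        coneFst_inr, coneSnd_inl, coneSnd_inr, smul_zero, zero_add, add_zero, h]
      module
  acyclic {M} hM := (quasiIso_iff_acyclic_cone (η M)).1
    (quasiIso_of_acyclic (η M) (S.acyclic hM) (T.acyclic hM))

end DGFun

end DGModule

namespace DGModule

variable {k : Type u} [Field k] {A B : DGAlgebra.{u, v} k}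

/-! ### Free modules and `K`-projective resolutions -/

section KProj

lemma koszulSign_neg_one : koszulSign k (-1) = -1 := by
  rw [DGFun.koszulSign_neg, koszulSign_one]

lemma KProj.shift {P : DGModule A} (hP : KProj P) (n : ℤ) : KProj (P.shift n) := by
  intro N hN r f hf hdf
  have h1 := homD_comp (r := -n) (s := r) (f := DGFun.toShift P n) (g := f)
  rw [hdf, DGFun.homD_toShift] at h1
  obtain ⟨g, hg, hg'⟩ := hP N hN (-n + r) (f ∘ₗ DGFun.toShift P n)
    (hf.comp (DGFun.isDeg_toShift P n)) (by rw [h1]; ext; simp)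
  have h2 := homD_comp (r := n) (s := -n + r - 1) (f := DGFun.ofShift P n) (g := g)
  rw [hg', DGFun.homD_ofShift, show n + (-n + r - 1) = r - 1 by ring] at h2
  refine ⟨g ∘ₗ DGFun.ofShift P n, (hg.comp (DGFun.isDeg_ofShift P n)).cast (by ring), ?_⟩
  rw [h2]
  ext x
  simp only [LinearMap.comp_zero, smul_zero, add_zero]
  rfl

/-- A map from a graded vector space composed with a contraction of its target. -/
lemma d_contraction {N : DGModule A} {c : N.carrier →ₗ[k] N.carrier}
    (hc : ∀ m, N.d (c m) + c (N.d m) = m) {r : ℤ} {x y : N.carrier}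
    (h : N.d x = koszulSign k r • y) : N.d (c x) = x - koszulSign k r • c y := by
  rw [← map_smul, ← h, eq_sub_iff_add_eq, hc]

/-- The identity map from a dg algebra to its regular module. -/
def toReg (A : DGAlgebra.{u, v} k) : A.carrier →ₗ[k] A.regular.carrier := LinearMap.id

lemma toReg_surjective (A : DGAlgebra.{u, v} k) : Function.Surjective (toReg A) := fun a => ⟨a, rfl⟩

lemma regular_d (a : A.carrier) : A.regular.d (toReg A a) = toReg A (A.d a) := rfl

lemma toReg_eq_act (a : A.carrier) : toReg A a = A.regular.act (toReg A 1) a := (one_mul a).symm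

lemma toReg_mem {i : ℤ} {a : A.carrier} (ha : a ∈ A.grading i) :
    toReg A a ∈ A.regular.grading i := ha

lemma kproj_regular (A : DGAlgebra.{u, v} k) : KProj A.regular := by
  intro N hN r f hf hdf
  obtain ⟨c, hc1, hc2⟩ := hN.exists_contraction
  have h1 : f (toReg A 1) ∈ N.grading r := hf.mem' (zero_add r) (toReg_mem (one_mem A))
  have h2 : N.d (f (toReg A 1)) = 0 := by
    rw [d_of_homD_eq_zero hdf, regular_d, d_one, map_zero, map_zero, smul_zero]
  have h3 : N.d (c (f (toReg A 1))) = f (toReg A 1) := by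
    have := hc2 (f (toReg A 1))
    rwa [h2, map_zero, add_zero] at this
  have h4 : ∀ a : A.carrier, f (toReg A a) = N.act (f (toReg A 1)) a := fun a => by
    rw [toReg_eq_act, hf.act]
  refine ⟨N.act (c (f (toReg A 1))), ⟨fun {i a} ha => ?_, fun a b => N.act_mul _ a b⟩, ?_⟩
  · have := N.act_mem (hc1 _ _ h1) ha
    rwa [add_comm] at this
  · refine LinearMap.ext fun a => ?_
    obtain ⟨a, rfl⟩ := toReg_surjective A a
    refine Eq.trans ?_ (h4 a).symm
    change N.d (N.act (c (f (toReg A 1))) a) - koszulSign k (r - 1) •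
      N.act (c (f (toReg A 1))) (A.d a) = N.act (f (toReg A 1)) a
    rw [N.d_act (hc1 _ _ h1), h3, add_sub_cancel_right]

/-- The free dg module `Y ⊗ A` on the complex underlying `Y`. -/
def free (Y : DGModule A) : DGModule A := (Y.box A.regular).res

/-- The pure tensor `y ⊗ a` in the free dg module. -/
def fm {Y : DGModule A} : Y.carrier →ₗ[k] A.carrier →ₗ[k] Y.free.carrier :=
  TensorProduct.mk k Y.carrier A.carrier

section

variable {Y Z : DGModule A}

lemma fm_mem {i j n : ℤ} (h : i + j = n) {y : Y.carrier} (hy : y ∈ Y.grading i) {a : A.carrier}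
    (ha : a ∈ A.grading j) : fm y a ∈ Y.free.grading n :=
  tmul_mem_tensorGrading _ _ h hy ha

lemma free_act (y : Y.carrier) (a b : A.carrier) :
    Y.free.act (fm y a) b = fm y (a * b) := (tm_act Y A.regular y a b).symm

lemma free_d {i : ℤ} {y : Y.carrier} (hy : y ∈ Y.grading i) (a : A.carrier) :
    Y.free.d (fm y a) = fm (Y.d y) a + koszulSign k i • fm y (A.d a) :=
  tensorD_tmul Y.grading Y.d A.d hy a

lemma free_d_one (y : Y.carrier) : Y.free.d (fm y 1) = fm (Y.d y) 1 := by
  induction y using homogeneous_induction with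
  | zero => simp
  | add y z hy hz => simp only [map_add, LinearMap.add_apply, hy, hz]
  | hom i y hy => rw [free_d hy, d_one, map_zero, smul_zero, add_zero]

lemma free_hom_ext {X : Type v} [AddCommGroup X] [Module k X] {f g : Y.free.carrier →ₗ[k] X}
    (h : ∀ i, ∀ y ∈ Y.grading i, ∀ j, ∀ a ∈ A.grading j, f (fm y a) = g (fm y a)) : f = g :=
  graded_tensor_hom_ext Y.grading A.grading h

/-- The `A`-linear map on `Y ⊗ A` that extends a linear map on `Y`. -/
def freeLift (ψ : Y.carrier →ₗ[k] Z.carrier) : Y.free.carrier →ₗ[k] Z.carrier :=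
  TensorProduct.lift (Z.act ∘ₗ ψ)

@[simp] lemma freeLift_fm (ψ : Y.carrier →ₗ[k] Z.carrier) (y : Y.carrier) (a : A.carrier) :
    freeLift ψ (fm y a) = Z.act (ψ y) a := TensorProduct.lift.tmul y a

lemma isDeg_freeLift {r : ℤ} {ψ : Y.carrier →ₗ[k] Z.carrier}
    (hψ : ∀ i, ∀ y ∈ Y.grading i, ψ y ∈ Z.grading (i + r)) : IsDeg Y.free Z r (freeLift ψ) where
  mem {n t} ht := by
    refine tensorGrading_le (S := (Z.grading (n + r)).comap (freeLift ψ)) Y.grading A.grading ?_ ht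
    rintro i j rfl y hy a ha
    have := Z.act_mem (hψ i y hy) ha
    rw [show i + r + j = i + j + r by ring] at this
    exact this
  act t b := by
    refine LinearMap.congr_fun (f := freeLift ψ ∘ₗ Y.free.act.flip b)
      (g := Z.act.flip b ∘ₗ freeLift ψ) (free_hom_ext fun i y hy j a ha => ?_) t
    simp only [LinearMap.comp_apply, LinearMap.flip_apply]
    rw [free_act, freeLift_fm, freeLift_fm, Z.act_mul]

lemma homD_freeLift {r : ℤ} {ψ : Y.carrier →ₗ[k] Z.carrier}
    (hψ : ∀ i, ∀ y ∈ Y.grading i, ψ y ∈ Z.grading (i + r)) :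
    homD Y.free Z r (freeLift ψ) = freeLift (homD Y Z r ψ) :=
  free_hom_ext fun i y hy j a ha => by
    rw [homD_apply, free_d hy, map_add, map_smul, freeLift_fm, freeLift_fm, freeLift_fm,
      freeLift_fm, Z.d_act (hψ i y hy), homD_apply, map_sub, map_smul, LinearMap.sub_apply,
      LinearMap.smul_apply, koszulSign_add]
    module

lemma freeLift_of_isDeg {r : ℤ} {f : Y.free.carrier →ₗ[k] Z.carrier} (hf : IsDeg Y.free Z r f) :
    freeLift (f ∘ₗ (fm : Y.carrier →ₗ[k] A.carrier →ₗ[k] Y.free.carrier).flip 1) = f :=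
  free_hom_ext fun i y hy j a ha => by
    rw [freeLift_fm, LinearMap.comp_apply, LinearMap.flip_apply, ← hf.act, free_act, one_mul]

/-- A closed map `f` from a free module to an acyclic one is null-homotopic: the homotopy is the
`A`-linear extension of `y ↦ c (f (y ⊗ 1))`, for a linear contraction `c` of the target. -/
lemma kproj_free (Y : DGModule A) : KProj Y.free := by
  intro N hN r f hf hdf
  obtain ⟨c, hc1, hc2⟩ := hN.exists_contraction
  have h1 : ∀ i, ∀ y ∈ Y.grading i, c (f (fm y 1)) ∈ N.grading (i + (r - 1)) := fun i y hy => by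
    have := hc1 _ _ (hf.mem (fm_mem (add_zero i) hy (one_mem A)))
    rwa [add_sub_assoc] at this
  refine ⟨freeLift (c ∘ₗ f ∘ₗ (fm : Y.carrier →ₗ[k] A.carrier →ₗ[k] Y.free.carrier).flip 1),
    isDeg_freeLift h1, ?_⟩
  rw [homD_freeLift h1]
  conv_rhs => rw [← freeLift_of_isDeg hf]
  congr 1
  ext y
  rw [homD_apply]
  simp only [LinearMap.comp_apply, LinearMap.flip_apply]
  have h2 := d_of_homD_eq_zero hdf (fm y 1)
  rw [free_d_one] at h2
  rw [d_contraction hc2 h2, koszulSign, sub_eq_add_neg r, ← koszulSign, koszulSign_add,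
    DGFun.koszulSign_neg, koszulSign_one]
  module

/-- The counit `Y ⊗ A → Y`. -/
def freeCounit (Y : DGModule A) : Y.free ⟶ Y :=
  mkHom (f := freeLift LinearMap.id) (isDeg_freeLift fun i y hy => by rwa [add_zero]) (by
    rw [homD_freeLift fun i y hy => by rwa [add_zero]]
    refine free_hom_ext fun i y hy j a ha => ?_
    rw [freeLift_fm, homD_apply]
    simp)

@[simp] lemma freeCounit_fm (y : Y.carrier) (a : A.carrier) :
    (freeCounit Y).f (fm y a) = Y.act y a := freeLift_fm _ y a

/-- The morphism of free dg modules induced by a morphism. -/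
def freeHom (f : Y ⟶ Z) : Y.free ⟶ Z.free :=
  have h : ∀ i, ∀ y ∈ Y.grading i, (fm : Z.carrier →ₗ[k] A.carrier →ₗ[k] Z.free.carrier).flip 1
      (f.f y) ∈ Z.free.grading (i + 0) := fun i y hy => fm_mem rfl (f.map_mem hy) (one_mem A)
  mkHom (f := freeLift ((fm : Z.carrier →ₗ[k] A.carrier →ₗ[k] Z.free.carrier).flip 1 ∘ₗ f.f))
    (isDeg_freeLift h) (by
    rw [homD_freeLift h]
    refine free_hom_ext fun i y hy j a ha => ?_
    rw [freeLift_fm, homD_apply]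
    simp only [LinearMap.comp_apply, LinearMap.flip_apply]
    rw [free_d_one, f.map_d]
    simp)

@[simp] lemma freeHom_fm (f : Y ⟶ Z) (y : Y.carrier) (a : A.carrier) :
    (freeHom f).f (fm y a) = fm (f.f y) a := by
  refine (freeLift_fm _ y a).trans ?_
  simp only [LinearMap.comp_apply, LinearMap.flip_apply]
  rw [free_act, one_mul]

end

/-- The difference of two morphisms. -/
def subHom {M N : DGModule A} (f g : M ⟶ N) : M ⟶ N :=
  mkHom (f := f.f - g.f) (f.isDeg.sub g.isDeg) (by
    rw [homD_sub, f.homD_eq_zero, g.homD_eq_zero, sub_zero])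

@[simp] lemma subHom_f {M N : DGModule A} (f g : M ⟶ N) (m : M.carrier) :
    (subHom f g).f m = f.f m - g.f m := rfl

/-- A dg module with the differential `d + θ`. -/
def twist (D : DGModule A) (θ : D.carrier →ₗ[k] D.carrier) (hθ : IsDeg D D 1 θ)
    (h : ∀ x, D.d (θ x) + θ (D.d x) + θ (θ x) = 0) : DGModule A where
  carrier := D.carrier
  grading := D.grading
  act := D.act
  act_one := D.act_one
  act_mul := D.act_mul
  act_mem := D.act_mem
  d := D.d + θ
  d_mem hx := add_mem (D.d_mem hx) (hθ.mem hx)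
  d_d x := by
    simp only [LinearMap.add_apply, map_add, D.d_d]
    rw [zero_add, ← add_assoc, add_comm (θ (D.d x)), h x]
  d_act hx a := by
    simp only [LinearMap.add_apply, map_add, D.d_act hx, hθ.act]
    abel

/-- A resolution of `Y` by `K`-projective dg modules `D n`, with a linear contraction. -/
structure Resolution (Y : DGModule A) where
  /-- the terms -/
  D : ℕ → DGModule A
  /-- the maps between the terms -/
  δ : ∀ n, D (n + 1) ⟶ D n
  /-- the augmentation -/
  ε : D 0 ⟶ Y
  /-- the contraction -/
  S : ∀ n, (D n).carrier →ₗ[k] (D (n + 1)).carrier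
  /-- the section of the augmentation -/
  s : Y.carrier →ₗ[k] (D 0).carrier
  ε_δ : ∀ x, ε.f ((δ 0).f x) = 0
  δ_δ : ∀ n x, (δ n).f ((δ (n + 1)).f x) = 0
  s_d : ∀ y, s (Y.d y) = (D 0).d (s y)
  S_d : ∀ n x, S n ((D n).d x) = (D (n + 1)).d (S n x)
  ε_s : ∀ y, ε.f (s y) = y
  δ_S_zero : ∀ x, (δ 0).f (S 0 x) = x - s (ε.f x)
  δ_S_succ : ∀ n x, (δ (n + 1)).f (S (n + 1) x) = x - S n ((δ n).f x)
  kproj : ∀ n, KProj (D n)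

namespace Resolution

variable {Y : DGModule A} (R : Resolution Y)

/-- The direct sum of the shifted terms of a resolution. -/
def sum : DGModule A := dsum fun n : ℕ => (R.D n).shift n

/-- The inclusion of the `n`-th term. -/
def ι (n : ℕ) : (R.D n).carrier →ₗ[k] R.sum.carrier :=
  (dsumι (fun n : ℕ => (R.D n).shift n) n).f

/-- The linear map on the direct sum of the terms with given components. -/
def desc {X : Type v} [AddCommGroup X] [Module k X] (f : ∀ n, (R.D n).carrier →ₗ[k] X) :
    R.sum.carrier →ₗ[k] X :=
  dsumDesc (fun n : ℕ => (R.D n).shift n) f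

@[simp] lemma desc_ι {X : Type v} [AddCommGroup X] [Module k X]
    (f : ∀ n, (R.D n).carrier →ₗ[k] X) (n : ℕ) (x : (R.D n).carrier) :
    R.desc f (R.ι n x) = f n x := dsumDesc_ι _ f n x

variable {R} in
lemma sum_hom_ext {X : Type v} [AddCommGroup X] [Module k X] {f g : R.sum.carrier →ₗ[k] X}
    (h : ∀ n x, f (R.ι n x) = g (R.ι n x)) : f = g :=
  dsum_hom_ext _ fun n => LinearMap.ext (h n)

lemma sum_d (n : ℕ) (x : (R.D n).carrier) :
    R.sum.d (R.ι n x) = koszulSign k n • R.ι n ((R.D n).d x) := by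
  rw [← map_smul]
  exact ((dsumι (fun n : ℕ => (R.D n).shift n) n).map_d x).symm

lemma isDeg_ι (n : ℕ) : IsDeg (R.D n) R.sum (-n) (R.ι n) :=
  (((dsumι (fun n : ℕ => (R.D n).shift n) n).isDeg).comp
    (DGFun.isDeg_toShift (R.D n) n)).cast (by ring)

lemma isDeg_desc {N : DGModule A} {r : ℤ} {f : ∀ n, (R.D n).carrier →ₗ[k] N.carrier}
    (hf : ∀ n : ℕ, IsDeg (R.D n) N (r - n) (f n)) : IsDeg R.sum N r (R.desc f) :=
  isDeg_dsumDesc _ fun n =>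
    ((hf n).comp (DGFun.isDeg_ofShift (R.D n) n)).cast (by ring)

/-- The components of the twist of the differential. -/
def θAux : ∀ n, (R.D n).carrier →ₗ[k] R.sum.carrier
  | 0 => 0
  | n + 1 => R.ι n ∘ₗ (R.δ n).f

/-- The part of the differential of the totalization that comes from the maps `δ`. -/
def θ : R.sum.carrier →ₗ[k] R.sum.carrier := R.desc R.θAux

@[simp] lemma θ_zero (x : (R.D 0).carrier) : R.θ (R.ι 0 x) = 0 := R.desc_ι _ 0 x

@[simp] lemma θ_succ (n : ℕ) (x : (R.D (n + 1)).carrier) :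
    R.θ (R.ι (n + 1) x) = R.ι n ((R.δ n).f x) := R.desc_ι _ (n + 1) x

lemma isDeg_θ : IsDeg R.sum R.sum 1 R.θ :=
  R.isDeg_desc fun n => match n with
    | 0 => IsDeg.zero
    | n + 1 => ((R.isDeg_ι n).comp (R.δ n).isDeg).cast (by push_cast; ring)

lemma θ_eq (x : R.sum.carrier) : R.sum.d (R.θ x) + R.θ (R.sum.d x) + R.θ (R.θ x) = 0 := by
  refine LinearMap.congr_fun (f := R.sum.d ∘ₗ R.θ + R.θ ∘ₗ R.sum.d + R.θ ∘ₗ R.θ) (g := 0)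
    (sum_hom_ext fun n x => ?_) x
  simp only [LinearMap.add_apply, LinearMap.comp_apply, LinearMap.zero_apply, sum_d, map_smul]
  match n with
  | 0 => simp
  | 1 =>
    rw [θ_succ, θ_succ, sum_d, θ_zero, (R.δ 0).map_d]
    simp
  | n + 2 =>
    rw [θ_succ, θ_succ, θ_succ, sum_d, (R.δ _).map_d, δ_δ]
    push_cast
    simp only [koszulSign_add, koszulSign_one, map_zero, add_zero,
      show koszulSign k 2 = 1 by rw [← one_add_one_eq_two, koszulSign_add]; simp]
    module

/-- The totalization of a resolution. -/
def tot : DGModule A := twist R.sum R.θ R.isDeg_θ R.θ_eq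

/-- The identity map from the totalization to the underlying graded module. -/
def ofTot : R.tot.carrier →ₗ[k] R.sum.carrier := LinearMap.id

/-- The identity map to the totalization from the underlying graded module. -/
def toTot : R.sum.carrier →ₗ[k] R.tot.carrier := LinearMap.id

@[simp] lemma ofTot_toTot (x : R.sum.carrier) : R.ofTot (R.toTot x) = x := rfl

@[simp] lemma toTot_ofTot (x : R.tot.carrier) : R.toTot (R.ofTot x) = x := rfl

lemma tot_d (x : R.sum.carrier) : R.tot.d (R.toTot x) = R.toTot (R.sum.d x + R.θ x) := rfl

lemma tot_d' (x : R.tot.carrier) :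
    R.tot.d x = R.toTot (R.sum.d (R.ofTot x) + R.θ (R.ofTot x)) := rfl

lemma isDeg_toTot : IsDeg R.sum R.tot 0 R.toTot := ⟨(IsDeg.id R.sum).1, fun _ _ => rfl⟩

lemma isDeg_ofTot : IsDeg R.tot R.sum 0 R.ofTot := ⟨(IsDeg.id R.sum).1, fun _ _ => rfl⟩

variable {R} in
lemma tot_hom_ext {X : Type v} [AddCommGroup X] [Module k X] {f g : R.tot.carrier →ₗ[k] X}
    (h : ∀ n x, f (R.toTot (R.ι n x)) = g (R.toTot (R.ι n x))) : f = g :=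
  sum_hom_ext h

/-- The components of the augmentation of the totalization. -/
def augAux : ∀ n, (R.D n).carrier →ₗ[k] Y.carrier
  | 0 => R.ε.f
  | _ + 1 => 0

/-- The linear map underlying the augmentation of the totalization. -/
def augMap : R.sum.carrier →ₗ[k] Y.carrier := R.desc R.augAux

@[simp] lemma augMap_zero (x : (R.D 0).carrier) : R.augMap (R.ι 0 x) = R.ε.f x := R.desc_ι _ 0 x

@[simp] lemma augMap_succ (n : ℕ) (x : (R.D (n + 1)).carrier) :
    R.augMap (R.ι (n + 1) x) = 0 := R.desc_ι _ (n + 1) x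

/-- The augmentation of the totalization of a resolution. -/
def aug : R.tot ⟶ Y :=
  mkHom (f := R.augMap ∘ₗ R.ofTot) (((R.isDeg_desc (N := Y) (r := 0) fun n => match n with
    | 0 => R.ε.isDeg.cast (by simp)
    | _ + 1 => IsDeg.zero).comp R.isDeg_ofTot).cast (zero_add 0)) (tot_hom_ext fun n x => by
    rw [homD_apply, tot_d, sum_d, koszulSign_zero, one_smul, LinearMap.comp_apply,
      LinearMap.comp_apply, ofTot_toTot, ofTot_toTot, map_add, map_smul]
    match n with
    | 0 => simp [R.ε.map_d]
    | 1 => rw [augMap_succ, augMap_succ, θ_succ, augMap_zero, ε_δ]; simp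
    | n + 2 => simp)

lemma aug_apply (x : R.tot.carrier) : R.aug.f x = R.augMap (R.ofTot x) := rfl

/-- The contraction on the sum of the terms. -/
def contr : R.sum.carrier →ₗ[k] R.sum.carrier := R.desc fun n => R.ι (n + 1) ∘ₗ R.S n

lemma contr_ι (n : ℕ) (x : (R.D n).carrier) : R.contr (R.ι n x) = R.ι (n + 1) (R.S n x) :=
  R.desc_ι _ n x

lemma augMap_contr (x : R.sum.carrier) : R.augMap (R.contr x) = 0 :=
  LinearMap.congr_fun (f := R.augMap ∘ₗ R.contr) (g := 0) (sum_hom_ext fun n x => by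
    rw [LinearMap.comp_apply, contr_ι, augMap_succ, LinearMap.zero_apply]) x

lemma contr_eq (x : R.sum.carrier) :
    R.sum.d (R.contr x) + R.θ (R.contr x) + R.contr (R.sum.d x) + R.contr (R.θ x) +
      R.ι 0 (R.s (R.augMap x)) = x := by
  refine LinearMap.congr_fun (f := R.sum.d ∘ₗ R.contr + R.θ ∘ₗ R.contr + R.contr ∘ₗ R.sum.d +
    R.contr ∘ₗ R.θ + R.ι 0 ∘ₗ R.s ∘ₗ R.augMap) (g := LinearMap.id) (sum_hom_ext fun n x => ?_) x
  simp only [LinearMap.add_apply, LinearMap.comp_apply, LinearMap.id_apply]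
  rw [contr_ι, sum_d, sum_d, ← S_d, map_smul, contr_ι, θ_succ]
  match n with
  | 0 =>
    rw [θ_zero, map_zero, augMap_zero, δ_S_zero, map_sub]
    simp only [Nat.cast_zero, zero_add, Nat.cast_one, koszulSign_zero, koszulSign_one]
    module
  | n + 1 =>
    rw [θ_succ, contr_ι, augMap_succ, δ_S_succ, map_zero, map_sub]
    push_cast
    simp only [koszulSign_add, koszulSign_one, map_zero]
    module

/-- The linear contraction of the resolution contracts the cone of the augmentation. -/
lemma quasiIso_aug : quasiIso A R.aug := by
  rw [quasiIso_iff_acyclic_cone]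
  refine acyclic_of_homotopy (coneInl R.aug ∘ₗ R.toTot ∘ₗ
    (R.ι 0 ∘ₗ R.s ∘ₗ coneSnd R.aug - R.contr ∘ₗ R.ofTot ∘ₗ coneFst R.aug)) fun x => ?_
  refine cone_ext _ ?_ ?_
  · have h := congrArg R.toTot (R.contr_eq (R.ofTot (coneFst R.aug x)))
    simp only [map_add, toTot_ofTot] at h
    simp only [map_add, coneFst_d, coneSnd_d, LinearMap.comp_apply, LinearMap.sub_apply,
      coneFst_inl, tot_d', map_sub, ofTot_toTot, sum_d, θ_zero, map_neg, s_d, aug_apply,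
      Nat.cast_zero, koszulSign_zero, one_smul]
    conv_rhs => rw [← h]
    simp only [map_zero]
    abel
  · simp only [map_add, coneSnd_d, LinearMap.comp_apply, LinearMap.sub_apply, coneFst_inl,
      coneSnd_inl, aug_apply, map_sub, ofTot_toTot, augMap_zero, ε_s, augMap_contr,
      map_zero, add_zero, sub_zero]

/-- A null-homotopy on the totalization is constructed successively on the terms. -/
lemma kproj_tot : KProj R.tot := by
  intro N hN r f hf hdf
  obtain ⟨F, hFf⟩ : ∃ F : ∀ n : ℕ, (R.D n).carrier →ₗ[k] N.carrier,
      ∀ n x, F n x = f (R.toTot (R.ι n x)) := ⟨fun n => f ∘ₗ R.toTot ∘ₗ R.ι n, fun _ _ => rfl⟩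
  have hF : ∀ n : ℕ, IsDeg (R.D n) N (r - n) (F n) := fun n => by
    have : F n = f ∘ₗ R.toTot ∘ₗ R.ι n := LinearMap.ext (hFf n)
    rw [this]
    exact (hf.comp (R.isDeg_toTot.comp (R.isDeg_ι n))).cast (by ring)
  have hF0 : homD (R.D 0) N (r - (0 : ℕ)) (F 0) = 0 := by
    ext x
    have h := d_of_homD_eq_zero hdf (R.toTot (R.ι 0 x))
    rw [tot_d, sum_d, θ_zero] at h
    rw [homD_apply, hFf, hFf, h]
    simp
  have hF1 : ∀ n : ℕ, homD (R.D (n + 1)) N (r - (n + 1 : ℕ)) (F (n + 1)) =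
      koszulSign k r • (F n ∘ₗ (R.δ n).f) := fun n => by
    ext x
    have h := d_of_homD_eq_zero hdf (R.toTot (R.ι (n + 1) x))
    rw [tot_d, sum_d, θ_succ] at h
    rw [homD_apply, LinearMap.smul_apply, LinearMap.comp_apply, hFf, hFf, hFf, h, map_add, map_add,
      map_smul, map_smul, sub_eq_add_neg r, koszulSign_add, DGFun.koszulSign_neg]
    module
  -- the condition that allows to extend a homotopy from the `n`-th term to the next one
  have step : ∀ (n : ℕ) (g : (R.D n).carrier →ₗ[k] N.carrier), IsDeg (R.D n) N (r - 1 - n) g ∧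
      (∀ x, homD (R.D n) N (r - 1 - n) g ((R.δ n).f x) = F n ((R.δ n).f x)) →
      ∃ g', IsDeg (R.D (n + 1)) N (r - 1 - (n + 1 : ℕ)) g' ∧
        homD (R.D (n + 1)) N (r - 1 - (n + 1 : ℕ)) g' =
          F (n + 1) - koszulSign k r • (g ∘ₗ (R.δ n).f) := by
    rintro n g ⟨h1, h2⟩
    have e : r - 1 - (n + 1 : ℕ) = r - (n + 1 : ℕ) - 1 := by ring
    have e' : 0 + (r - 1 - n) = r - (n + 1 : ℕ) := by push_cast; ring
    rw [e]
    refine R.kproj (n + 1) N hN (r - (n + 1 : ℕ)) (F (n + 1) - koszulSign k r • (g ∘ₗ (R.δ n).f))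
      ((hF (n + 1)).sub (((h1.comp (R.δ n).isDeg).cast e').smul _)) ?_
    have h3 := homD_comp (r := 0) (s := r - 1 - n) (f := (R.δ n).f) (g := g)
    rw [Hom.homD_eq_zero, e'] at h3
    rw [homD_sub, homD_smul, hF1, h3]
    ext x
    simp only [LinearMap.sub_apply, LinearMap.smul_apply, LinearMap.add_apply,
      LinearMap.comp_apply, h2]
    simp
  have good : ∀ (n : ℕ) (g : (R.D n).carrier →ₗ[k] N.carrier) (g' : (R.D (n + 1)).carrier →ₗ[k] _),
      homD (R.D (n + 1)) N (r - 1 - (n + 1 : ℕ)) g' =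
        F (n + 1) - koszulSign k r • (g ∘ₗ (R.δ n).f) →
      ∀ x, homD (R.D (n + 1)) N (r - 1 - (n + 1 : ℕ)) g' ((R.δ (n + 1)).f x) =
        F (n + 1) ((R.δ (n + 1)).f x) := fun n g g' h x => by
    rw [h, LinearMap.sub_apply, LinearMap.smul_apply, LinearMap.comp_apply, δ_δ, map_zero,
      smul_zero, sub_zero]
  obtain ⟨g0, hg0, hg0'⟩ := R.kproj 0 N hN (r - (0 : ℕ)) (F 0) (hF 0) hF0
  have e0 : r - (0 : ℕ) - 1 = r - 1 - (0 : ℕ) := by simp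
  rw [e0] at hg0 hg0'
  choose! next hnext hnext' using step
  obtain ⟨G, hG1, hG0, hG⟩ : ∃ G : ∀ n : ℕ, (R.D n).carrier →ₗ[k] N.carrier,
      (∀ n : ℕ, IsDeg (R.D n) N (r - 1 - n) (G n)) ∧
      homD (R.D 0) N (r - 1 - (0 : ℕ)) (G 0) = F 0 ∧
      ∀ n, homD (R.D (n + 1)) N (r - 1 - (n + 1 : ℕ)) (G (n + 1)) =
        F (n + 1) - koszulSign k r • ((G n) ∘ₗ (R.δ n).f) := by
    let G : ∀ n : ℕ, {g : (R.D n).carrier →ₗ[k] N.carrier // IsDeg (R.D n) N (r - 1 - n) g ∧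
        (∀ x, homD (R.D n) N (r - 1 - n) g ((R.δ n).f x) = F n ((R.δ n).f x))} := Nat.rec
      ⟨g0, hg0, fun x => LinearMap.congr_fun hg0' _⟩
      (fun n g => ⟨next n g.1, hnext n g.1 g.2, good n g.1 _ (hnext' n g.1 g.2)⟩)
    exact ⟨fun n => (G n).1, fun n => (G n).2.1, hg0', fun n => hnext' n (G n).1 (G n).2⟩
  refine ⟨R.desc G ∘ₗ R.ofTot,
    ((R.isDeg_desc hG1).comp R.isDeg_ofTot).cast (zero_add _),
    tot_hom_ext fun n x => ?_⟩
  rw [homD_apply, tot_d, sum_d, LinearMap.comp_apply, LinearMap.comp_apply, ofTot_toTot,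
    ofTot_toTot, map_add, map_smul, desc_ι, desc_ι, ← hFf]
  match n with
  | 0 =>
    have h := LinearMap.congr_fun hG0 x
    rw [homD_apply] at h
    rw [θ_zero, map_zero, ← h]
    simp
  | n + 1 =>
    have h := LinearMap.congr_fun (hG n) x
    rw [homD_apply, LinearMap.sub_apply, LinearMap.smul_apply, LinearMap.comp_apply,
      sub_eq_iff_eq_add] at h
    rw [θ_succ, desc_ι, h, sub_eq_add_neg (r - 1) ((n + 1 : ℕ) : ℤ), koszulSign_add _ (r - 1),
      DGFun.koszulSign_neg, sub_eq_add_neg r 1, koszulSign_add _ r, koszulSign_neg_one]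
    module

end Resolution

section Bar

variable {Z : DGModule A}

/-- The map `x ⊗ a ↦ x a - δ(x) ⊗ a`. Iterated from the action `Y ⊗ A → Y`, this gives the
alternating sums of the bar resolution. -/
def barNext (δ : Z.free ⟶ Z) : Z.free.free ⟶ Z.free := subHom (freeCounit Z.free) (freeHom δ)

lemma barNext_fm (δ : Z.free ⟶ Z) (x : Z.free.carrier) (a : A.carrier) :
    (barNext δ).f (fm x a) = Z.free.act x a - fm (δ.f x) a := by
  rw [barNext, subHom_f, freeCounit_fm, freeHom_fm]

lemma barNext_fm_one (δ : Z.free ⟶ Z) (x : Z.free.carrier) :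
    (barNext δ).f (fm x 1) = x - fm (δ.f x) 1 := by
  rw [barNext_fm, Z.free.act_one]

lemma comp_barNext {δ : Z.free ⟶ Z} (h : ∀ x a, δ.f (fm (δ.f x) a) = Z.act (δ.f x) a)
    (x : Z.free.free.carrier) : δ.f ((barNext δ).f x) = 0 := by
  refine LinearMap.congr_fun (f := δ.f ∘ₗ (barNext δ).f) (g := 0)
    (free_hom_ext fun i x hx j a ha => ?_) x
  rw [LinearMap.comp_apply, barNext_fm, map_sub, h, δ.map_act, sub_self, LinearMap.zero_apply]

lemma barNext_aux {δ : Z.free ⟶ Z} (h : ∀ x a, δ.f (fm (δ.f x) a) = Z.act (δ.f x) a)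
    (x : Z.free.free.carrier) (a : A.carrier) :
    (barNext δ).f (fm ((barNext δ).f x) a) = Z.free.act ((barNext δ).f x) a := by
  rw [barNext_fm, comp_barNext h, map_zero, LinearMap.zero_apply, sub_zero]

/-- The terms of the bar resolution, as iterated free dg modules. -/
def barTerm (Y : DGModule A) : ℕ → DGModule A
  | 0 => Y
  | n + 1 => free (barTerm Y n)

/-- The maps of the bar resolution. -/
def barMap (Y : DGModule A) : ∀ n, free (barTerm Y n) ⟶ barTerm Y n
  | 0 => freeCounit Y
  | n + 1 => barNext (barMap Y n)

lemma barMap_fm (Y : DGModule A) : ∀ (n : ℕ) x (a : A.carrier),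
    (barMap Y n).f (fm ((barMap Y n).f x) a) = (barTerm Y n).act ((barMap Y n).f x) a
  | 0, _, _ => freeCounit_fm _ _
  | n + 1, x, a => barNext_aux (barMap_fm Y n) x a

/-- The bar resolution. -/
def barResolution (Y : DGModule A) : Resolution Y where
  D n := free (barTerm Y n)
  δ n := barMap Y (n + 1)
  ε := barMap Y 0
  S n := (fm : (free (barTerm Y n)).carrier →ₗ[k] A.carrier →ₗ[k] _).flip 1
  s := (fm : Y.carrier →ₗ[k] A.carrier →ₗ[k] _).flip 1
  ε_δ := comp_barNext (barMap_fm Y 0)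
  δ_δ n := comp_barNext (barMap_fm Y (n + 1))
  s_d y := (free_d_one y).symm
  S_d _ x := (free_d_one x).symm
  ε_s y := (freeCounit_fm y 1).trans (Y.act_one y)
  δ_S_zero := barNext_fm_one (barMap Y 0)
  δ_S_succ n := barNext_fm_one (barMap Y (n + 1))
  kproj _ := kproj_free _

end Bar

/-- Every dg module has a `K`-projective resolution. -/
lemma exists_kproj (Y : DGModule A) : ∃ (P : DGModule A) (f : P ⟶ Y), KProj P ∧ quasiIso A f :=
  ⟨_, (barResolution Y).aug, (barResolution Y).kproj_tot, (barResolution Y).quasiIso_aug⟩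

end KProj

end DGModule

namespace DGModule

variable {k : Type u} [Field k] {A B : DGAlgebra.{u, v} k}

/-! ### Morphisms in the derived category as homotopy classes -/

/-- Null-homotopic maps of degree `r`. -/
def NullHtpic (M N : DGModule A) (r : ℤ) (f : M.carrier →ₗ[k] N.carrier) : Prop :=
  ∃ g, IsDeg M N (r - 1) g ∧ homD M N (r - 1) g = f

namespace NullHtpic

variable {M N K : DGModule A} {r s : ℤ} {f f' : M.carrier →ₗ[k] N.carrier}

lemma zero : NullHtpic M N r 0 := ⟨0, IsDeg.zero, homD_zero⟩

lemma add : NullHtpic M N r f → NullHtpic M N r f' → NullHtpic M N r (f + f') :=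
  fun ⟨g, h1, h2⟩ ⟨g', h1', h2'⟩ => ⟨g + g', h1.add h1', by rw [homD_add, h2, h2']⟩

lemma smul (c : k) : NullHtpic M N r f → NullHtpic M N r (c • f) :=
  fun ⟨g, h1, h2⟩ => ⟨c • g, h1.smul c, by rw [homD_smul, h2]⟩

lemma cast (h : NullHtpic M N r f) (e : r = s) : NullHtpic M N s f := e ▸ h

lemma comp_left {g : N.carrier →ₗ[k] K.carrier} (hg : IsDeg N K s g) (hdg : homD N K s g = 0) :
    NullHtpic M N r f → NullHtpic M K (r + s) (g ∘ₗ f) := fun ⟨h, h1, h2⟩ => by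
  have h3 := homD_comp (r := r - 1) (s := s) (f := h) (g := g)
  rw [hdg, h2] at h3
  refine ⟨koszulSign k s • (g ∘ₗ h), ((hg.comp h1).cast (by ring)).smul _, ?_⟩
  rw [homD_smul, show r + s - 1 = r - 1 + s by ring, h3]
  ext m
  simp [smul_smul]

lemma comp_right {g : K.carrier →ₗ[k] M.carrier} (hg : IsDeg K M s g) (hdg : homD K M s g = 0) :
    NullHtpic M N r f → NullHtpic K N (s + r) (f ∘ₗ g) := fun ⟨h, h1, h2⟩ => by
  have h3 := homD_comp (r := s) (s := r - 1) (f := g) (g := h)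
  rw [hdg, h2, show s + (r - 1) = s + r - 1 by ring] at h3
  refine ⟨h ∘ₗ g, (h1.comp hg).cast (by ring), ?_⟩
  rw [h3]
  ext m
  simp

end NullHtpic

lemma homotopic_iff_nullHtpic {M N : DGModule A} {f g : M ⟶ N} :
    Homotopic f g ↔ NullHtpic M N 0 (f.f - g.f) := by
  constructor
  · rintro ⟨h, h1, h2⟩
    exact ⟨h, h1, h2.symm⟩
  · rintro ⟨h, h1, h2⟩
    exact ⟨h, h1, h2.symm⟩

/-- The morphism `(m, n) ↦ h m + g n` out of the cone of `f` given by a null-homotopy `h` of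
`g f`. -/
def coneExt {M N Z : DGModule A} (f : M ⟶ N) (g : N ⟶ Z) (h : M.carrier →ₗ[k] Z.carrier)
    (h1 : IsDeg M Z (-1) h) (h2 : ∀ m, g.f (f.f m) = Z.d (h m) + h (M.d m)) : cone f ⟶ Z where
  f := h ∘ₗ coneFst f + g.f ∘ₗ coneSnd f
  map_mem {i x} hx := add_mem (h1.mem' (by ring) hx.1) (g.map_mem hx.2)
  map_act x a := by
    rw [LinearMap.add_apply, LinearMap.comp_apply, LinearMap.comp_apply, (isDeg_coneFst f).act,
      (isDeg_coneSnd f).act, h1.act, g.map_act]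
    simp
  map_d x := by
    rw [LinearMap.add_apply, LinearMap.comp_apply, LinearMap.comp_apply, coneFst_d, coneSnd_d,
      map_add, h2, g.map_d, LinearMap.add_apply, map_add, map_neg]
    simp only [LinearMap.comp_apply]
    abel

@[simp] lemma coneExt_inr {M N Z : DGModule A} (f : M ⟶ N) (g : N ⟶ Z)
    (h : M.carrier →ₗ[k] Z.carrier) (h1 : IsDeg M Z (-1) h)
    (h2 : ∀ m, g.f (f.f m) = Z.d (h m) + h (M.d m)) : coneInr f ≫ coneExt f g h h1 h2 = g := by
  ext n
  change h 0 + g.f n = g.f n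
  rw [map_zero, zero_add]

/-- A homotopy is a morphism out of the cylinder of `M`, whose two inclusions agree in the derived
category. -/
lemma Q_map_eq_of_homotopic {M N : DGModule A} {f g : M ⟶ N} (h : Homotopic f g) :
    (quasiIso A).Q.map f = (quasiIso A).Q.map g := by
  obtain ⟨s, hs1, hs2⟩ := homotopic_iff.1 h
  -- the cylinder of `M`
  let j : M ⟶ M.prod M :=
    { f := LinearMap.prod LinearMap.id (-LinearMap.id)
      map_mem := fun hm => ⟨hm, neg_mem hm⟩
      map_act := fun m a => Prod.ext rfl (by
        change -(M.act m a) = M.act (-m) a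
        simp)
      map_d := fun m => Prod.ext rfl (map_neg M.d m).symm }
  let i1 : M ⟶ M.prod M :=
    { f := LinearMap.inr k M.carrier M.carrier
      map_mem := fun hm => ⟨zero_mem _, hm⟩
      map_act := fun m a => Prod.ext (by
        change 0 = M.act 0 a
        simp) rfl
      map_d := fun m => Prod.ext (map_zero M.d).symm rfl }
  let I0 : M ⟶ cone j := prodInl M M ≫ coneInr j
  let I1 : M ⟶ cone j := i1 ≫ coneInr j
  have hI0 : ∀ m, I0.f m = (0, (m, 0)) := fun _ => rfl
  have hI1 : ∀ m, I1.f m = (0, (0, m)) := fun _ => rfl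
  let sum : ∀ (N : DGModule A) (f g : M ⟶ N), M.prod M ⟶ N := fun N f g =>
    { f := LinearMap.coprod f.f g.f
      map_mem := fun hm => add_mem (f.map_mem hm.1) (g.map_mem hm.2)
      map_act := fun x a => by
        change f.f (M.act x.1 a) + g.f (M.act x.2 a) = N.act (f.f x.1 + g.f x.2) a
        rw [f.map_act, g.map_act, map_add, LinearMap.add_apply]
      map_d := fun x => by
        change f.f (M.d x.1) + g.f (M.d x.2) = N.d (f.f x.1 + g.f x.2)
        rw [f.map_d, g.map_d, map_add] }
  let H : cone j ⟶ N := coneExt j (sum N f g) s hs1 fun m => by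
    change f.f m + g.f (-m) = _
    rw [map_neg, ← sub_eq_add_neg, hs2]
  let p : cone j ⟶ M := coneExt j (sum M (𝟙 M) (𝟙 M)) 0 IsDeg.zero fun m => by
    change m + -m = M.d 0 + 0
    simp
  have hH0 : I0 ≫ H = f := by
    ext m
    change s 0 + (f.f m + g.f 0) = f.f m
    simp
  have hH1 : I1 ≫ H = g := by
    ext m
    change s 0 + (f.f 0 + g.f m) = g.f m
    simp
  have hp0 : I0 ≫ p = 𝟙 M := by
    ext m
    change 0 + (m + 0) = m
    simp
  have hp1 : I1 ≫ p = 𝟙 M := by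
    ext m
    change 0 + (0 + m) = m
    simp
  have hp : quasiIso A p := by
    refine quasiIso_of_homotopyEquiv p I0 ?_ (hp0 ▸ Homotopic.refl _)
    refine homotopic_iff.2 ⟨coneInl j ∘ₗ LinearMap.snd k M.carrier M.carrier ∘ₗ coneSnd j,
      ⟨fun {i x} hx => (isDeg_coneInl j).mem hx.2.2, fun x a => ?_⟩, fun x => ?_⟩
    · exact (isDeg_coneInl j).act _ _
    · obtain ⟨m, a, b⟩ := x
      refine Prod.ext ?_ (Prod.ext ?_ ?_)
      · change (0 : M.carrier) - m = -M.d b + (-m + M.d b)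
        abel
      · change (0 + (a + b)) - a = (b + M.d 0) + 0
        rw [map_zero]
        abel
      · change 0 - b = (-b + M.d 0) + 0
        rw [map_zero]
        abel
  have := (quasiIso A).Q_inverts p hp
  have e : (quasiIso A).Q.map I0 = (quasiIso A).Q.map I1 := by
    rw [← cancel_mono ((quasiIso A).Q.map p), ← Functor.map_comp, ← Functor.map_comp, hp0, hp1]
  calc (quasiIso A).Q.map f = (quasiIso A).Q.map (I0 ≫ H) := by rw [hH0]
    _ = (quasiIso A).Q.map I0 ≫ (quasiIso A).Q.map H := Functor.map_comp _ _ _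
    _ = (quasiIso A).Q.map I1 ≫ (quasiIso A).Q.map H := by rw [e]
    _ = (quasiIso A).Q.map (I1 ≫ H) := (Functor.map_comp _ _ _).symm
    _ = (quasiIso A).Q.map g := by rw [hH1]

section

variable {P : DGModule A} (hP : KProj P) {X Y : DGModule A} (w : X ⟶ Y) (hw : quasiIso A w)
include hP hw

lemma KProj.exists_lift (g : P ⟶ Y) : ∃ f : P ⟶ X, Homotopic (f ≫ w) g := by
  obtain ⟨s, hs1, hs2⟩ := hP (cone w) ((quasiIso_iff_acyclic_cone w).1 hw) 0 (g ≫ coneInr w).f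
    (Hom.isDeg _) (Hom.homD_eq_zero _)
  have h1 : ∀ p, (coneFst w) ((g ≫ coneInr w).f p) = 0 := fun _ => rfl
  have h2 : ∀ p, (coneSnd w) ((g ≫ coneInr w).f p) = g.f p := fun _ => rfl
  have hs : ∀ p, (g ≫ coneInr w).f p = (cone w).d (s p) + s (P.d p) := fun p => by
    rw [← hs2, homD_apply, zero_sub, koszulSign_neg_one]
    simp
  refine ⟨mkHom (f := coneFst w ∘ₗ s) (((isDeg_coneFst w).comp hs1).cast (by ring)) ?_,
    homotopic_iff.2 ⟨-(coneSnd w ∘ₗ s), (((isDeg_coneSnd w).comp hs1).cast (by ring)).neg,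
      fun p => ?_⟩⟩
  · ext p
    have := congrArg (coneFst w) (hs p)
    rw [h1, map_add, coneFst_d] at this
    rw [homD_apply, koszulSign_zero, one_smul, LinearMap.comp_apply, LinearMap.comp_apply,
      LinearMap.zero_apply, sub_eq_zero]
    rw [eq_comm, neg_add_eq_zero] at this
    exact this
  · have := congrArg (coneSnd w) (hs p)
    rw [h2, map_add, coneSnd_d] at this
    rw [this]
    simp only [comp_f, mkHom_f, LinearMap.neg_apply, LinearMap.comp_apply, map_neg]
    abel

lemma KProj.homotopic_of_comp {f g : P ⟶ X} (h : Homotopic (f ≫ w) (g ≫ w)) : Homotopic f g := by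
  obtain ⟨s, hs1, hs2⟩ := homotopic_iff.1 h
  obtain ⟨t, ht1, ht2⟩ := hP (cone w) ((quasiIso_iff_acyclic_cone w).1 hw) (-1)
    (coneInl w ∘ₗ (f.f - g.f) - (coneInr w).f ∘ₗ s)
    ((((isDeg_coneInl w).comp (f.isDeg.sub g.isDeg)).cast (by ring)).sub
      (((coneInr w).isDeg.comp hs1).cast (by ring))) (by
      ext p
      rw [homD_apply, koszulSign_neg_one]
      have h3 := hs2 p
      rw [comp_f, comp_f] at h3
      refine cone_ext w ?_ ?_
      · simp [coneFst_d, f.map_d, g.map_d]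
        rw [neg_add_eq_sub, sub_self]
      · simp [coneSnd_d, h3])
  refine homotopic_iff.2 ⟨-(coneFst w ∘ₗ t), (((isDeg_coneFst w).comp ht1).cast (by ring)).neg,
    fun p => ?_⟩
  have h3 := congrArg (coneFst w) (LinearMap.congr_fun ht2 p)
  rw [homD_apply, map_sub, map_smul, coneFst_d] at h3
  simp only [LinearMap.sub_apply, LinearMap.comp_apply, map_sub, coneFst_inl, coneFst_inr,
    sub_zero] at h3
  rw [← h3, show (-1 - 1 : ℤ) = -2 by ring, DGFun.koszulSign_neg,
    show koszulSign k 2 = 1 by rw [← one_add_one_eq_two, koszulSign_add]; simp]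
  simp only [LinearMap.neg_apply, LinearMap.comp_apply, map_neg]
  module

end

/-- Homotopy classes of morphisms. -/
def homotopySetoid (M N : DGModule A) : Setoid (M ⟶ N) :=
  ⟨Homotopic, Homotopic.refl, Homotopic.symm, Homotopic.trans⟩

/-- The functor of homotopy classes of morphisms from `P`. -/
def homotopyFunctor (P : DGModule A) : DGModule A ⥤ Type v where
  obj X := Quotient (homotopySetoid P X)
  map w := ↾(Quotient.map (fun f => f ≫ w) fun _ _ h => h.comp_right w)
  map_id X := by
    ext x
    induction x using Quotient.inductionOn with | _ f
    exact congrArg (Quotient.mk _) (Category.comp_id f)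
  map_comp v w := by
    ext x
    induction x using Quotient.inductionOn with | _ f
    exact congrArg (Quotient.mk _) (Category.assoc f v w).symm

namespace KProj

variable {P : DGModule A} (hP : KProj P)
include hP

lemma homotopyFunctor_inverts : (quasiIso A).IsInvertedBy (homotopyFunctor P) := fun X Y w hw => by
  refine (isIso_iff_bijective _).2 ⟨fun x y h => ?_, fun y => ?_⟩
  · induction x using Quotient.inductionOn with | _ f
    induction y using Quotient.inductionOn with | _ g
    exact Quotient.sound (hP.homotopic_of_comp w hw (Quotient.exact h))
  · induction y using Quotient.inductionOn with | _ g
    obtain ⟨f, hf⟩ := hP.exists_lift w hw g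
    exact ⟨Quotient.mk _ f, Quotient.sound hf⟩

/-- For `K`-projective `P`, morphisms of dg modules out of `P` that agree in the derived category
are homotopic. -/
lemma homotopic_of_Q_map_eq {X : DGModule A} {f g : P ⟶ X}
    (h : (quasiIso A).Q.map f = (quasiIso A).Q.map g) : Homotopic f g := by
  have h1 := congrArg (Localization.Construction.lift (homotopyFunctor P)
    hP.homotopyFunctor_inverts).map h
  have h2 : (homotopyFunctor P).map f = (homotopyFunctor P).map g := h1
  have h3 := ConcreteCategory.congr_hom h2 (Quotient.mk _ (𝟙 P))
  have h4 : Homotopic (𝟙 P ≫ f) (𝟙 P ≫ g) := Quotient.exact h3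
  rwa [Category.id_comp, Category.id_comp] at h4

/-- Every morphism out of a `K`-projective dg module in the derived category is represented by a
morphism of dg modules. -/
lemma exists_Q_map {X : DGModule A} (φ : P.toD ⟶ X.toD) :
    ∃ f : P ⟶ X, (quasiIso A).Q.map f = φ := by
  -- composition with a morphism in `T` preserves the property of being represented; `T` contains
  -- the generators of the localization
  let T : MorphismProperty (DerivedCat A) := fun X Y φ => ∀ f : P ⟶ X.as.obj,
    ∃ g : P ⟶ Y.as.obj, (show P.toD ⟶ X from (quasiIso A).Q.map f) ≫ φ = (quasiIso A).Q.map g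
  have hT : T = ⊤ := by
    have : T.IsStableUnderComposition := ⟨fun {X Y Z} φ ψ hφ hψ f => by
      obtain ⟨g, hg⟩ := hφ f
      obtain ⟨h, hh⟩ := hψ g
      exact ⟨h, by rw [← Category.assoc, hg]; exact hh⟩⟩
    refine Localization.Construction.morphismProperty_eq_top T (fun X Y w f => ⟨f ≫ w, ?_⟩)
      (fun X Y w hw f => ?_)
    · exact ((quasiIso A).Q.map_comp f w).symm
    · obtain ⟨g, hg⟩ := hP.exists_lift w hw f
      refine ⟨g, ?_⟩
      have h1 := Q_map_eq_of_homotopic hg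
      have h2 : (quasiIso A).Q.map w ≫ Localization.Construction.wInv w hw = 𝟙 _ :=
        (Localization.Construction.wIso w hw).hom_inv_id
      change (quasiIso A).Q.map f ≫ Localization.Construction.wInv w hw = (quasiIso A).Q.map g
      refine (congrArg (· ≫ Localization.Construction.wInv w hw) h1).symm.trans ?_
      exact (congrArg (· ≫ Localization.Construction.wInv w hw) (Functor.map_comp _ g w)).trans
        ((Category.assoc _ _ _).trans ((congrArg (_ ≫ ·) h2).trans (Category.comp_id _)))
  obtain ⟨g, hg⟩ := (hT ▸ (trivial : (⊤ : MorphismProperty (DerivedCat A)) φ) : T φ) (𝟙 P)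
  refine ⟨g, ?_⟩
  exact hg.symm.trans ((congrArg (· ≫ φ) ((quasiIso A).Q.map_id P)).trans (Category.id_comp φ))

end KProj

/-- The morphisms that factor through a zero object. These serve as zero morphisms without a
preadditive structure on the derived category. -/
def IsNull {X Y : DerivedCat A} (φ : X ⟶ Y) : Prop :=
  ∃ (Z : DerivedCat A) (a : X ⟶ Z) (b : Z ⟶ Y), Limits.IsZero Z ∧ a ≫ b = φ

namespace IsNull

variable {X Y Z : DerivedCat A}

lemma eq {φ ψ : X ⟶ Y} : IsNull φ → IsNull ψ → φ = ψ := by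
  rintro ⟨Z, a, b, hZ, rfl⟩ ⟨Z', a', b', hZ', rfl⟩
  have e := hZ.iso hZ'
  rw [← Category.comp_id a', hZ'.eq_of_src (𝟙 Z') (e.inv ≫ e.hom)]
  rw [hZ.eq_of_tgt a (a' ≫ e.inv), hZ'.eq_of_src b' (e.inv ≫ b)]
  simp

lemma comp_left (f : X ⟶ Y) {φ : Y ⟶ Z} : IsNull φ → IsNull (f ≫ φ) := by
  rintro ⟨W, a, b, hW, rfl⟩
  exact ⟨W, f ≫ a, b, hW, by rw [Category.assoc]⟩

end IsNull

lemma isNull_zeroHom (M N : DGModule A) : IsNull ((quasiIso A).Q.map (zeroHom M N)) :=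
  ⟨(zero A).toD, (quasiIso A).Q.map (zeroHom _ _), (quasiIso A).Q.map (zeroHom _ _),
    isZero_toD_zero, by rw [← Functor.map_comp]; rfl⟩

lemma isNull_of_nullHtpic {M N : DGModule A} {f : M ⟶ N} (h : NullHtpic M N 0 f.f) :
    IsNull ((quasiIso A).Q.map f) := by
  rw [Q_map_eq_of_homotopic (g := zeroHom M N) (homotopic_iff_nullHtpic.2 ?_)]
  · exact isNull_zeroHom M N
  · rwa [show (zeroHom M N).f = 0 from rfl, sub_zero]

lemma KProj.nullHtpic_of_isNull {P : DGModule A} (hP : KProj P) {X : DGModule A} {f : P ⟶ X}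
    (h : IsNull ((quasiIso A).Q.map f)) : NullHtpic P X 0 f.f := by
  have := homotopic_iff_nullHtpic.1 (hP.homotopic_of_Q_map_eq (h.eq (isNull_zeroHom P X)))
  rwa [show (zeroHom P X).f = 0 from rfl, sub_zero] at this

section

variable {M N M' N' : DGModule A} (f : M ⟶ N) (f' : M' ⟶ N') (a : M' ⟶ M) (b : N' ⟶ N)
  (s : M'.carrier →ₗ[k] N.carrier) (hs : IsDeg M' N (-1) s)
  (h : ∀ m, b.f (f'.f m) - f.f (a.f m) = N.d (s m) + s (M'.d m))

/-- The morphism `(m, n) ↦ (a m, b n + s m)` of cones given by a square that commutes up to the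
homotopy `s`. -/
def coneMap : cone f' ⟶ cone f where
  f := coneInl f ∘ₗ a.f ∘ₗ coneFst f' + (coneInr f).f ∘ₗ (b.f ∘ₗ coneSnd f' + s ∘ₗ coneFst f')
  map_mem {i x} hx := add_mem ((isDeg_coneInl f).mem' (by ring) (a.map_mem hx.1))
    ((coneInr f).map_mem (add_mem (b.map_mem hx.2) (hs.mem' (by ring) hx.1)))
  map_act x c := by
    simp only [LinearMap.add_apply, LinearMap.comp_apply, (isDeg_coneFst f').act,
      (isDeg_coneSnd f').act, a.map_act, b.map_act, hs.act, (isDeg_coneInl f).act, map_add,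
      (coneInr f).map_act]
  map_d x := by
    refine cone_ext f ?_ ?_
    · simp [coneFst_d, a.map_d]
    · have := h (coneFst f' x)
      rw [sub_eq_iff_eq_add] at this
      simp only [LinearMap.add_apply, LinearMap.comp_apply, coneFst_d, coneSnd_d, map_add, map_neg,
        coneSnd_inl, coneSnd_inr, coneFst_inl, coneFst_inr, this, b.map_d, zero_add, add_zero,
        map_zero]
      abel

lemma coneMap_inr : coneInr f' ≫ coneMap f f' a b s hs h = b ≫ coneInr f := by
  ext n
  refine cone_ext f ?_ ?_
  · simp [coneMap]
  · simp [coneMap]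

lemma quasiIso_coneMap (ha : quasiIso A a) (hb : quasiIso A b) :
    quasiIso A (coneMap f f' a b s hs h) := by
  rw [quasiIso_iff_acyclic_cone] at ha hb ⊢
  rintro ⟨⟨x, y⟩, ⟨m, n⟩⟩ h0
  replace h0 := Prod.mk_eq_zero.1 h0
  have h1 : -(-(M'.d x)) = 0 := (Prod.mk_eq_zero.1 h0.1).1
  have h3 : a.f x + 0 + -(M.d m) = 0 := (Prod.mk_eq_zero.1 h0.2).1
  rw [neg_neg] at h1
  rw [add_zero, ← sub_eq_add_neg] at h3
  obtain ⟨⟨p, q⟩, hpq⟩ := ha (x, -m) (Prod.ext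
    (by change -(M'.d x) = 0; rw [h1, neg_zero])
    (by change a.f x + M.d (-m) = 0; rw [map_neg, ← sub_eq_add_neg, h3]))
  have hp : -(M'.d p) = x := congrArg Prod.fst hpq
  have hq : a.f p + M.d q = -m := congrArg Prod.snd hpq
  -- the part of the cocycle in `cone b` that is left after subtracting a coboundary
  obtain ⟨⟨p', q'⟩, hpq'⟩ := hb (y - f'.f p, n - (f.f q - s p)) (by
    have h2 : -(f'.f x + N'.d y) = 0 := (Prod.mk_eq_zero.1 h0.1).2
    have h4 : 0 + (b.f y + s x) + (f.f m + N.d n) = 0 := (Prod.mk_eq_zero.1 h0.2).2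
    have h5 := h p
    rw [neg_eq_zero, ← hp, map_neg, f'.map_d] at h2
    rw [zero_add, ← hp, map_neg, ← neg_neg m, ← hq, map_neg, map_add, f.map_d] at h4
    refine Prod.ext ?_ ?_
    · change -(N'.d (y - f'.f p)) = 0
      rw [map_sub, neg_eq_zero, sub_eq_zero]
      rw [neg_add_eq_zero] at h2
      exact h2.symm
    · change b.f (y - f'.f p) + N.d (n - (f.f q - s p)) = 0
      rw [sub_eq_iff_eq_add] at h5
      rw [map_sub, h5, map_sub, map_sub, ← h4]
      abel)
  have hp' : -(N'.d p') = y - f'.f p := congrArg Prod.fst hpq'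
  have hq' : b.f p' + N.d q' = n - (f.f q - s p) := congrArg Prod.snd hpq'
  refine ⟨((-p, p'), (q, q')), Prod.ext (Prod.ext ?_ ?_) (Prod.ext ?_ ?_)⟩
  · change -(-(M'.d (-p))) = x
    rw [neg_neg, map_neg, hp]
  · change -(f'.f (-p) + N'.d p') = y
    rw [map_neg, neg_add, hp']
    abel
  · change a.f (-p) + 0 + -(M.d q) = m
    rw [← neg_neg m, ← hq, map_neg]
    abel
  · change 0 + (b.f p' + s (-p)) + (f.f q + N.d q') = n
    rw [map_neg, zero_add]
    rw [eq_sub_iff_add_eq] at hq'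
    rw [← hq']
    abel

end

/-- The cone of `f` is a weak cokernel of `f` in the derived category. After replacing source and
target by `K`-projective dg modules, the vanishing of the composition is a null-homotopy, and this
extends the morphism to the cone. -/
lemma exists_factor {M N Z : DGModule A} (f : M ⟶ N) (φ : N.toD ⟶ Z.toD)
    (h : IsNull ((quasiIso A).Q.map f ≫ φ)) :
    ∃ ψ : (cone f).toD ⟶ Z.toD, (quasiIso A).Q.map (coneInr f) ≫ ψ = φ := by
  obtain ⟨M', rM, hM', wM⟩ := exists_kproj M
  obtain ⟨N', rN, hN', wN⟩ := exists_kproj N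
  obtain ⟨f', hf'⟩ := hM'.exists_lift rN wN (rM ≫ f)
  obtain ⟨g', hg'⟩ := hN'.exists_Q_map ((quasiIso A).Q.map rN ≫ φ)
  have e : (quasiIso A).Q.map (f' ≫ g') =
      (quasiIso A).Q.map rM ≫ (quasiIso A).Q.map f ≫ φ := by
    have := Q_map_eq_of_homotopic hf'
    rw [Functor.map_comp, Functor.map_comp] at this
    rw [Functor.map_comp, hg', ← Category.assoc, this, Category.assoc]
  obtain ⟨t, ht1, ht2⟩ := hM'.nullHtpic_of_isNull (e ▸ h.comp_left _)
  obtain ⟨s, hs1, hs2⟩ := homotopic_iff.1 hf'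
  have w1 := (quasiIso A).Q_inverts _
    (quasiIso_coneMap f f' rM rN s hs1 hs2 wM wN)
  have w2 := (quasiIso A).Q_inverts _ wN
  refine ⟨inv ((quasiIso A).Q.map (coneMap f f' rM rN s hs1 hs2)) ≫
    (quasiIso A).Q.map (coneExt f' g' t ht1 fun m => ?_), ?_⟩
  · have := LinearMap.congr_fun ht2 m
    rw [homD_apply, zero_sub, koszulSign_neg_one, neg_one_smul, sub_neg_eq_add] at this
    exact this.symm
  · rw [← cancel_epi ((quasiIso A).Q.map rN), ← hg', ← Category.assoc, ← Functor.map_comp,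
      ← coneMap_inr f f' rM rN s hs1 hs2, Functor.map_comp, Category.assoc, IsIso.hom_inv_id_assoc,
      ← Functor.map_comp, coneExt_inr]

end DGModule

namespace DGModule

variable {k : Type u} [Field k] {A B : DGAlgebra.{u, v} k}

/-! ### Endomorphisms of finite rank -/

section Restriction

variable {V : DGModule B} {X : DGModule A}

/-- The pure tensor `v ⊗ x`, as an element of the dg module over `A` underlying `V ⊠ X`. -/
def rm : V.carrier →ₗ[k] X.carrier →ₗ[k] (V.box X).res.carrier :=
  TensorProduct.mk k V.carrier X.carrier

lemma rm_mem {i j n : ℤ} (h : i + j = n) {v : V.carrier} (hv : v ∈ V.grading i) {x : X.carrier}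
    (hx : x ∈ X.grading j) : rm v x ∈ (V.box X).res.grading n :=
  tm_mem h hv hx

lemma res_d_rm {i : ℤ} {v : V.carrier} (hv : v ∈ V.grading i) (x : X.carrier) :
    (V.box X).res.d (rm v x) = rm (V.d v) x + koszulSign k i • rm v (X.d x) :=
  box_d_tm hv x

lemma res_act_rm (v : V.carrier) (x : X.carrier) (a : A.carrier) :
    (V.box X).res.act (rm v x) a = rm v (X.act x a) := (tm_act V X v x a).symm

lemma res_induction {p : (V.box X).res.carrier → Prop} (t : (V.box X).res.carrier) (zero : p 0)
    (rm : ∀ i, ∀ v ∈ V.grading i, ∀ j, ∀ x ∈ X.grading j, p (rm v x))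
    (add : ∀ a b, p a → p b → p (a + b)) : p t :=
  graded_tensor_induction V.grading X.grading t zero rm add

lemma res_hom_ext {Y : Type v} [AddCommGroup Y] [Module k Y]
    {f g : (V.box X).res.carrier →ₗ[k] Y}
    (h : ∀ i, ∀ v ∈ V.grading i, ∀ x, f (rm v x) = g (rm v x)) : f = g :=
  graded_tensor_hom_ext V.grading X.grading fun i v hv _ x _ => h i v hv x

lemma isDeg_of_res {Y : DGModule A} {r : ℤ} {f : (V.box X).res.carrier →ₗ[k] Y.carrier}
    (h1 : ∀ i, ∀ v ∈ V.grading i, ∀ j, ∀ x ∈ X.grading j, f (rm v x) ∈ Y.grading (i + j + r))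
    (h2 : ∀ v x a, f (rm v (X.act x a)) = Y.act (f (rm v x)) a) :
    IsDeg (V.box X).res Y r f where
  mem {n t} ht := by
    refine tensorGrading_le (S := (Y.grading (n + r)).comap f) V.grading X.grading ?_ ht
    rintro i j rfl v hv x hx
    exact h1 i v hv j x hx
  act t a := by
    induction t using res_induction with
    | zero => simp only [map_zero, LinearMap.zero_apply]
    | add s t hs ht => simp only [map_add, LinearMap.add_apply, hs, ht]
    | rm i v hv j x hx => rw [res_act_rm, h2]

lemma isDeg_rm {i : ℤ} {v : V.carrier} (hv : v ∈ V.grading i) :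
    IsDeg X (V.box X).res i (rm v) := isDeg_tm V X hv

lemma homD_rm {i : ℤ} {v : V.carrier} (hv : v ∈ V.grading i) (hdv : V.d v = 0) :
    homD X (V.box X).res i (rm v) = 0 := by
  ext x
  rw [homD_apply, res_d_rm hv, hdv]
  simp

/-- The map `v ⊗ x ↦ g v ⊗ x`. -/
def endo (g : V.carrier →ₗ[k] V.carrier) : (V.box X).res.carrier →ₗ[k] (V.box X).res.carrier :=
  TensorProduct.map g LinearMap.id

@[simp] lemma endo_rm (g : V.carrier →ₗ[k] V.carrier) (v : V.carrier) (x : X.carrier) :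
    endo g (rm v x) = rm (g v) x := rfl

lemma isDeg_endo {g : V.carrier →ₗ[k] V.carrier} {r : ℤ}
    (hg : ∀ i, ∀ v ∈ V.grading i, g v ∈ V.grading (i + r)) :
    IsDeg (V.box X).res (V.box X).res r (endo g) :=
  isDeg_of_res (fun i v hv j x hx => rm_mem (by ring) (hg i v hv) hx)
    fun v x a => (res_act_rm (g v) x a).symm

lemma homD_endo {g : V.carrier →ₗ[k] V.carrier} {r : ℤ}
    (hg : ∀ i, ∀ v ∈ V.grading i, g v ∈ V.grading (i + r)) :
    homD (V.box X).res (V.box X).res r (endo g) = endo (homD V V r g) :=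
  res_hom_ext fun i v hv x => by
    rw [homD_apply, res_d_rm hv, map_add, map_smul, endo_rm, endo_rm, endo_rm, endo_rm,
      res_d_rm (hg i v hv), homD_apply, map_sub, map_smul, LinearMap.sub_apply,
      LinearMap.smul_apply, koszulSign_add]
    module

lemma endo_add (g h : V.carrier →ₗ[k] V.carrier) :
    (endo (g + h) : (V.box X).res.carrier →ₗ[k] _) = endo g + endo h :=
  TensorProduct.map_add_left g h _

lemma endo_smul (c : k) (g : V.carrier →ₗ[k] V.carrier) :
    (endo (c • g) : (V.box X).res.carrier →ₗ[k] _) = c • endo g :=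
  TensorProduct.map_smul_left c g _

lemma endo_zero : (endo (0 : V.carrier →ₗ[k] V.carrier) : (V.box X).res.carrier →ₗ[k] _) = 0 :=
  TensorProduct.map_zero_left _

lemma endo_comp (g h : V.carrier →ₗ[k] V.carrier) :
    (endo (g ∘ₗ h) : (V.box X).res.carrier →ₗ[k] _) = endo g ∘ₗ endo h :=
  res_hom_ext fun _ _ _ _ => rfl

/-- The map `v ⊗ x ↦ l(v) x` given by a linear form `l` on `V`. -/
def contract (l : V.carrier →ₗ[k] k) : (V.box X).res.carrier →ₗ[k] X.carrier :=
  TensorProduct.lift (LinearMap.lsmul k X.carrier ∘ₗ l)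

@[simp] lemma contract_rm (l : V.carrier →ₗ[k] k) (v : V.carrier) (x : X.carrier) :
    contract l (rm v x) = l v • x := TensorProduct.lift.tmul v x

/-- A linear form on `V` is a cocycle of degree `-i` if it vanishes on the coboundaries and on the
components of degrees other than `i`. -/
structure IsFormOfDeg (V : DGModule B) (i : ℤ) (l : V.carrier →ₗ[k] k) : Prop where
  eq_zero : ∀ j, j ≠ i → ∀ v ∈ V.grading j, l v = 0
  d : ∀ v, l (V.d v) = 0

lemma IsFormOfDeg.isDeg_contract {i : ℤ} {l : V.carrier →ₗ[k] k} (hl : IsFormOfDeg V i l) :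
    IsDeg (V.box X).res X (-i) (contract l) :=
  isDeg_of_res (fun j v hv n x hx => by
    rw [contract_rm]
    by_cases h : j = i
    · subst h
      rw [show j + n + -j = n by ring]
      exact Submodule.smul_mem _ _ hx
    · rw [hl.eq_zero j h v hv, zero_smul]
      exact zero_mem _) fun v x a => by simp

lemma IsFormOfDeg.homD_contract {i : ℤ} {l : V.carrier →ₗ[k] k} (hl : IsFormOfDeg V i l) :
    homD (V.box X).res X (-i) (contract l) = 0 :=
  res_hom_ext fun j v hv x => by
    rw [homD_apply, res_d_rm hv, map_add, map_smul, contract_rm, contract_rm, contract_rm, hl.d,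
      map_smul, DGFun.koszulSign_neg]
    by_cases h : j = i
    · subst h
      simp [smul_smul]
    · rw [hl.eq_zero j h v hv]
      simp

/-- A homogeneous vector that is not a coboundary is detected by a cocycle of the dual complex. -/
lemma exists_isFormOfDeg {i : ℤ} {v : V.carrier} (hv : v ∈ V.grading i)
    (h : ¬ ∃ u, V.d u = v) : ∃ l, IsFormOfDeg V i l ∧ l v = 1 := by
  obtain ⟨l, hl, hl'⟩ := Submodule.exists_le_ker_of_notMem (p := LinearMap.range V.d) (v := v) h
  refine ⟨(l v)⁻¹ • (l ∘ₗ V.proj i), ⟨fun j hj u hu => ?_, fun u => ?_⟩, ?_⟩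
  · simp [proj_of_mem_ne V hu hj]
  · have : V.proj i (V.d u) = V.d (V.proj (i - 1) u) := by rw [d_proj, sub_add_cancel]
    rw [LinearMap.smul_apply, LinearMap.comp_apply, this]
    have h0 : l (V.d (V.proj (i - 1) u)) = 0 := hl' ⟨_, rfl⟩
    rw [h0, smul_zero]
  · rw [LinearMap.smul_apply, LinearMap.comp_apply, proj_of_mem V hv, smul_eq_mul,
      inv_mul_cancel₀ hl]

/-- The endomorphisms of finite rank of the complex `V` that factor through a complex with zero
differential. -/
def finEnd (V : DGModule B) : Submodule k (V.carrier →ₗ[k] V.carrier) :=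
  Submodule.span k {g | ∃ i w l, w ∈ V.grading i ∧ V.d w = 0 ∧ IsFormOfDeg V i l ∧
    g = LinearMap.smulRight l w}

@[elab_as_elim]
lemma finEnd_induction {p : ∀ e : V.carrier →ₗ[k] V.carrier, e ∈ finEnd V → Prop}
    {e : V.carrier →ₗ[k] V.carrier} (he : e ∈ finEnd V) (zero : p 0 (zero_mem _))
    (rank_one : ∀ i w l (hw : w ∈ V.grading i) (hdw : V.d w = 0) (hl : IsFormOfDeg V i l),
      p (LinearMap.smulRight l w) (Submodule.subset_span ⟨i, w, l, hw, hdw, hl, rfl⟩))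
    (add : ∀ e f he hf, p e he → p f hf → p (e + f) (add_mem he hf))
    (smul : ∀ (c : k) e he, p e he → p (c • e) (Submodule.smul_mem _ _ he)) : p e he := by
  refine Submodule.span_induction (p := p) ?_ zero add smul he
  rintro _ ⟨i, w, l, hw, hdw, hl, rfl⟩
  exact rank_one i w l hw hdw hl

lemma finEnd_mem {e : V.carrier →ₗ[k] V.carrier} (he : e ∈ finEnd V) :
    ∀ i, ∀ v ∈ V.grading i, e v ∈ V.grading (i + 0) := by
  induction he using finEnd_induction with
  | zero => exact fun _ _ _ => zero_mem _
  | add e f _ _ he hf => exact fun i v hv => add_mem (he i v hv) (hf i v hv)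
  | smul c e _ he => exact fun i v hv => Submodule.smul_mem _ _ (he i v hv)
  | rank_one i w l hw hdw hl =>
    intro j v hv
    rw [add_zero, LinearMap.smulRight_apply]
    by_cases h : j = i
    · exact h ▸ Submodule.smul_mem _ _ hw
    · rw [hl.eq_zero j h v hv, zero_smul]
      exact zero_mem _

lemma finEnd_apply_d {e : V.carrier →ₗ[k] V.carrier} (he : e ∈ finEnd V) (v : V.carrier) :
    e (V.d v) = 0 := by
  induction he using finEnd_induction with
  | zero => rfl
  | add e f _ _ he hf => rw [LinearMap.add_apply, he, hf, add_zero]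
  | smul c e _ he => rw [LinearMap.smul_apply, he, smul_zero]
  | rank_one i w l hw hdw hl => rw [LinearMap.smulRight_apply, hl.d, zero_smul]

lemma d_finEnd_apply {e : V.carrier →ₗ[k] V.carrier} (he : e ∈ finEnd V) (v : V.carrier) :
    V.d (e v) = 0 := by
  induction he using finEnd_induction with
  | zero => exact map_zero _
  | add e f _ _ he hf => rw [LinearMap.add_apply, map_add, he, hf, add_zero]
  | smul c e _ he => rw [LinearMap.smul_apply, map_smul, he, smul_zero]
  | rank_one i w l hw hdw hl => rw [LinearMap.smulRight_apply, map_smul, hdw, smul_zero]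

lemma finEnd_comp {e f : V.carrier →ₗ[k] V.carrier} (he : e ∈ finEnd V) (hf : f ∈ finEnd V) :
    e ∘ₗ f ∈ finEnd V := by
  induction hf using finEnd_induction with
  | zero => simp
  | add f g _ _ hf hg => rw [LinearMap.comp_add]; exact add_mem hf hg
  | smul c f _ hf => rw [LinearMap.comp_smul]; exact Submodule.smul_mem _ _ hf
  | rank_one i w l hw hdw hl =>
    refine Submodule.subset_span ⟨i, e w, l, by simpa using finEnd_mem he i w hw,
      d_finEnd_apply he w, hl, ?_⟩
    ext v
    simp

lemma endo_smulRight (l : V.carrier →ₗ[k] k) (w : V.carrier) :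
    (endo (LinearMap.smulRight l w) : (V.box X).res.carrier →ₗ[k] _) = rm w ∘ₗ contract l :=
  res_hom_ext fun _ _ _ _ => by simp

/-- The morphism `(1 - e) ⊗ 1` of `V ⊠ X`, for an endomorphism `e` of `V` of finite rank. -/
def coFin (X : DGModule A) {e : V.carrier →ₗ[k] V.carrier} (he : e ∈ finEnd V) :
    (V.box X).res ⟶ (V.box X).res :=
  mkHom (f := LinearMap.id - endo e) ((IsDeg.id _).sub (isDeg_endo (finEnd_mem he))) (by
    rw [homD_sub, homD_endo (finEnd_mem he), show homD V V 0 e = 0 by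
      ext v
      simp [homD_apply, finEnd_apply_d he, d_finEnd_apply he], endo_zero, sub_zero]
    ext
    simp [homD_apply])

lemma coFin_apply {e : V.carrier →ₗ[k] V.carrier} (he : e ∈ finEnd V)
    (t : (V.box X).res.carrier) : (coFin X he).f t = t - endo e t := rfl

lemma coFin_comp {e f : V.carrier →ₗ[k] V.carrier} (he : e ∈ finEnd V) (hf : f ∈ finEnd V) :
    coFin X he ≫ coFin X hf =
      coFin X (sub_mem (add_mem he hf) (finEnd_comp hf he)) := by
  ext t
  rw [comp_f, coFin_apply, coFin_apply, coFin_apply, sub_eq_add_neg (e + f), endo_add, endo_add,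
    ← neg_one_smul k, endo_smul, endo_comp]
  simp only [map_sub, LinearMap.add_apply, LinearMap.smul_apply, LinearMap.comp_apply]
  module

/-- On finitely many vectors, the identity is homotopic to an endomorphism of finite rank. The
homotopy does not depend on the vectors. -/
lemma exists_finEnd_list (V : DGModule B) : ∃ h : V.carrier →ₗ[k] V.carrier,
    (∀ i, ∀ m ∈ V.grading i, h m ∈ V.grading (i + -1)) ∧
    ∀ s : Finset V.carrier, (∀ v ∈ s, ∃ i, v ∈ V.grading i) →
      ∃ e ∈ finEnd V, ∀ v ∈ s, v - e v = V.d (h v) + h (V.d v) := by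
  classical
  obtain ⟨h, h1, h2⟩ := V.exists_d_h_d
  refine ⟨h, h1, fun s => ?_⟩
  induction s using Finset.induction_on with
  | empty => exact fun _ => ⟨0, zero_mem _, by simp⟩
  | insert v s hvs ih =>
    intro hs
    obtain ⟨e, he, hes⟩ := ih fun v hv => hs v (Finset.mem_insert_of_mem hv)
    obtain ⟨i, hi⟩ := hs v (Finset.mem_insert_self v s)
    -- the operator `1 - d h - h d - e` vanishes on `s` and takes cocycle values
    let c : V.carrier →ₗ[k] V.carrier := LinearMap.id - V.d ∘ₗ h - h ∘ₗ V.d - e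
    have hc : ∀ v, c v = v - V.d (h v) - h (V.d v) - e v := fun v => rfl
    have hdc : ∀ v, V.d (c v) = 0 := fun v => by
      simp [hc, V.d_d, h2, d_finEnd_apply he]
    have hcd : ∀ v, c (V.d v) = 0 := fun v => by
      simp [hc, V.d_d, h2, finEnd_apply_d he]
    have hcm : ∀ i, ∀ v ∈ V.grading i, c v ∈ V.grading i := fun i v hv => by
      refine sub_mem (sub_mem (sub_mem hv ?_) ?_) (by simpa using finEnd_mem he i v hv)
      · have := V.d_mem (h1 i v hv)
        rwa [sub_add_cancel] at this
      · have := h1 _ _ (V.d_mem hv)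
        rwa [add_sub_cancel_right] at this
    by_cases h0 : c v = 0
    · refine ⟨e, he, fun u hu => ?_⟩
      obtain rfl | hu := Finset.mem_insert.1 hu
      · rw [hc] at h0
        rw [← sub_eq_zero, ← h0]
        abel
      · exact hes u hu
    · obtain ⟨l, hl⟩ := Module.Projective.exists_dual_ne_zero k h0
      let l' : V.carrier →ₗ[k] k := (l (c v))⁻¹ • (l ∘ₗ V.proj i ∘ₗ c)
      have hl' : IsFormOfDeg V i l' := ⟨fun j hj u hu => by
        simp [l', proj_of_mem_ne V (hcm j u hu) hj], fun u => by simp [l', hcd]⟩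
      refine ⟨e + LinearMap.smulRight l' (c v), add_mem he
        (Submodule.subset_span ⟨i, _, l', hcm i v hi, hdc v, hl', rfl⟩), fun u hu => ?_⟩
      rw [LinearMap.add_apply, LinearMap.smulRight_apply]
      obtain rfl | hu := Finset.mem_insert.1 hu
      · have : l' u = 1 := by
          simp [l', proj_of_mem V (hcm i u hi), inv_mul_cancel₀ hl]
        rw [this, one_smul, hc]
        abel
      · have : c u = 0 := by
          rw [hc, sub_sub, sub_sub, ← add_assoc, sub_eq_zero, ← sub_eq_iff_eq_add, hes u hu]
        have : l' u = 0 := by simp [l', this]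
        rw [this, zero_smul, add_zero, hes u hu]

/-- Every tensor is fixed, up to a homotopy, by an endomorphism of `V` of finite rank. -/
lemma exists_finEnd (V : DGModule B) (X : DGModule A) : ∃ h : V.carrier →ₗ[k] V.carrier,
    (∀ i, ∀ m ∈ V.grading i, h m ∈ V.grading (i + -1)) ∧ ∀ t : (V.box X).res.carrier,
      ∃ e ∈ finEnd V, t - endo e t = homD (V.box X).res (V.box X).res (-1) (endo h) t := by
  classical
  obtain ⟨h, h1, h2⟩ := exists_finEnd_list V
  refine ⟨h, h1, fun t => ?_⟩
  -- a finite set of homogeneous vectors that occur in `t`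
  obtain ⟨s, hs, hst⟩ : ∃ s : Finset V.carrier, (∀ v ∈ s, ∃ i, v ∈ V.grading i) ∧
      ∀ g : V.carrier →ₗ[k] V.carrier, (∀ v ∈ s, g v = 0) → endo g t = 0 := by
    induction t using res_induction with
    | zero => exact ⟨∅, by simp, fun g _ => map_zero _⟩
    | rm i v hv j x hx =>
      refine ⟨{v}, fun u hu => ⟨i, by rwa [Finset.mem_singleton.1 hu]⟩, fun g hg => ?_⟩
      rw [endo_rm, hg v (Finset.mem_singleton_self v), map_zero, LinearMap.zero_apply]
    | add a b ha hb =>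
      obtain ⟨s, hs, hs'⟩ := ha
      obtain ⟨s', ht, ht'⟩ := hb
      refine ⟨s ∪ s', fun v hv => (Finset.mem_union.1 hv).elim (hs v) (ht v), fun g hg => ?_⟩
      rw [map_add, hs' g fun v hv => hg v (Finset.mem_union_left _ hv),
        ht' g fun v hv => hg v (Finset.mem_union_right _ hv), add_zero]
  obtain ⟨e, he, hes⟩ := h2 s hs
  refine ⟨e, he, ?_⟩
  have key := hst (LinearMap.id + (-1 : k) • e + (-1 : k) • homD V V (-1) h) fun v hv => by
    simp only [LinearMap.add_apply, LinearMap.smul_apply, LinearMap.id_apply, homD_apply,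
      koszulSign_neg_one]
    have := hes v hv
    rw [sub_eq_iff_eq_add] at this
    nth_rewrite 1 [this]
    module
  rw [endo_add, endo_add, endo_smul, endo_smul, ← homD_endo h1] at key
  have h3 : (endo LinearMap.id : (V.box X).res.carrier →ₗ[k] _) t = t :=
    LinearMap.congr_fun (TensorProduct.map_id) t
  simp only [LinearMap.add_apply, LinearMap.smul_apply, h3] at key
  rw [sub_eq_iff_eq_add, ← sub_eq_zero, ← key]
  module

end Restriction

end DGModule

namespace DGModule

open DerivedCat

variable {k : Type u} [Field k] {A B : DGAlgebra.{u, v} k}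

/-! ### Compactness of perfect dg modules -/

/-- The shift as a dg functor; a map `f` of degree `r` is sent to `(-1)^(n r) f`. -/
def shiftDGFun (A : DGAlgebra.{u, v} k) (n : ℤ) : DGFun A A where
  obj M := M.shift n
  map M N r f := koszulSign k (n * r) • (DGFun.toShift N n ∘ₗ f ∘ₗ DGFun.ofShift M n)
  isDeg {M N r f} hf := (((DGFun.isDeg_toShift N n).comp
    (hf.comp (DGFun.isDeg_ofShift M n))).cast (by ring)).smul _
  map_id M := by
    rw [mul_zero, koszulSign_zero, one_smul]
    rfl
  map_comp {M N K r s f g} _ _ := by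
    ext m
    change koszulSign k (n * (r + s)) • g (f m) =
      koszulSign k (n * s) • g (koszulSign k (n * r) • f m)
    rw [map_smul, smul_smul, mul_add, koszulSign_add, mul_comm]
  map_add _ _ := by
    rw [LinearMap.add_comp, LinearMap.comp_add, smul_add]
  map_homD {M N r f} _ := by
    ext m
    change koszulSign k (n * (r + 1)) • (N.d (f m) - koszulSign k r • f (M.d m)) =
      koszulSign k n • N.d (koszulSign k (n * r) • f m) -
        koszulSign k r • koszulSign k (n * r) • f (koszulSign k n • M.d m)
    rw [map_smul, map_smul, mul_add, mul_one, koszulSign_add]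
    module
  acyclic {M} hM := by
    intro (x : M.carrier) hx
    obtain ⟨y, rfl⟩ := hM x ((smul_eq_zero_iff_right (koszulSign_ne_zero k n)).1 hx)
    refine ⟨koszulSign k n • y, ?_⟩
    change koszulSign k n • M.d (koszulSign k n • y) = _
    rw [map_smul, smul_smul, koszulSign_mul_self, one_smul]

lemma quasiIso_of_comp {M N K : DGModule A} (f : M ⟶ N) (g : N ⟶ K) (hf : quasiIso A f)
    (hfg : quasiIso A (f ≫ g)) : quasiIso A g := fun i => by
  have h : Hom.cohomologyMap (f ≫ g) i = Hom.cohomologyMap g i ∘ₗ Hom.cohomologyMap f i := by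
    ext x
    rfl
  have := hfg i
  rw [h, LinearMap.coe_comp] at this
  exact (Function.Bijective.of_comp_iff _ (hf i)).1 this

/-- `Y` is compact with respect to `X` if every morphism `φ` from `Y` to `V ⊠ X` is fixed by an
endomorphism `e` of finite rank of the complex `V`. The equation `φ = (e ⊗ 1) φ` is expressed as the
vanishing of `((1 - e) ⊗ 1) φ`. -/
def IsCompactFor (B : DGAlgebra.{u, v} k) (X : DGModule A) (Y : DerivedCat A) : Prop :=
  ∀ (V : DGModule B) (φ : Y ⟶ (V.box X).res.toD), ∃ e, ∃ he : e ∈ finEnd V,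
    IsNull (φ ≫ (quasiIso A).Q.map (coFin X he))

namespace IsCompactFor

variable {X : DGModule A}

lemma of_retract {Y Z : DerivedCat A} (r : Retract Y Z) (h : IsCompactFor B X Z) :
    IsCompactFor B X Y := by
  intro V φ
  obtain ⟨e, he, h1⟩ := h V (r.r ≫ φ)
  refine ⟨e, he, ?_⟩
  have := h1.comp_left r.i
  rwa [Category.assoc, r.retract_assoc] at this

lemma of_iso {Y Z : DerivedCat A} (i : Y ≅ Z) (h : IsCompactFor B X Z) : IsCompactFor B X Y :=
  of_retract (Retract.ofIso i) h

lemma of_isZero {Y : DerivedCat A} (h : Limits.IsZero Y) : IsCompactFor B X Y := fun _ _ =>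
  ⟨0, zero_mem _, Y, 𝟙 Y, _, h, Category.id_comp _⟩

/-- If `1 - e` kills the restriction of `φ` to `M`, then `((1 - e) ⊗ 1) φ` factors through the cone,
and the factor is killed by some `1 - e'`; so `(1 - e') (1 - e)` kills `φ`. -/
lemma of_cone {M N : DGModule A} (f : M ⟶ N) (h1 : IsCompactFor B X M.toD)
    (h3 : IsCompactFor B X (cone f).toD) : IsCompactFor B X N.toD := by
  intro V φ
  obtain ⟨e, he, h⟩ := h1 V ((quasiIso A).Q.map f ≫ φ)
  rw [Category.assoc] at h
  obtain ⟨ψ, hψ⟩ := exists_factor f _ h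
  obtain ⟨e', he', h'⟩ := h3 V ψ
  refine ⟨_, sub_mem (add_mem he he') (finEnd_comp he' he), ?_⟩
  rw [← coFin_comp he he', Functor.map_comp, ← Category.assoc, ← hψ, Category.assoc]
  exact h'.comp_left _

end IsCompactFor

lemma isThick_isCompactFor (B : DGAlgebra.{u, v} k) (X : DGModule A) :
    IsThick fun Y => ∀ l : ℤ, IsCompactFor B X (Y⟦l⟧) where
  zero Y h l := .of_isZero (by
    have := isThick_isZero.shift Y l h
    exact this)
  shift Y m h l := .of_iso ((shiftFunctorAdd (DerivedCat A) m l).app Y).symm (h (m + l))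
  ext := by
    rintro T ⟨M, N, f, ⟨e⟩⟩ h1 h3 l
    have e1 : T.obj₁ ≅ M.toD := (Pretriangulated.Triangle.π₁ ⋙ 𝟭 _).mapIso e
    have e2 : T.obj₂ ≅ N.toD := (Pretriangulated.Triangle.π₂ ⋙ 𝟭 _).mapIso e
    have e3 : T.obj₃ ≅ (cone f).toD := (Pretriangulated.Triangle.π₃ ⋙ 𝟭 _).mapIso e
    refine .of_iso ((shiftFunctor (DerivedCat A) l).mapIso e2 ≪≫ (shiftIso N l).symm) ?_
    refine .of_cone ((shiftDGFun A l).mapHom f) ?_ ?_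
    · exact .of_iso (shiftIso M l ≪≫ (shiftFunctor (DerivedCat A) l).mapIso e1.symm) (h1 l)
    · exact .of_iso (isoOfQuasiIso _ ((shiftDGFun A l).quasiIso_coneHom f) ≪≫
        shiftIso (cone f) l ≪≫ (shiftFunctor (DerivedCat A) l).mapIso e3.symm) (h3 l)
  summand Y Z r h l := .of_retract (r.map (shiftFunctor (DerivedCat A) l)) (h l)

lemma NullHtpic.of_shift {M N : DGModule A} {r n : ℤ} {f : M.carrier →ₗ[k] N.carrier}
    (h : NullHtpic (M.shift n) N (n + r) (f ∘ₗ DGFun.ofShift M n)) : NullHtpic M N r f :=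
  (h.comp_right (DGFun.isDeg_toShift M n) (DGFun.homD_toShift M n)).cast (by ring)

/-- A closed map of degree `r`, as a morphism from a shift. -/
def ofClosed {M N : DGModule A} {r : ℤ} {f : M.carrier →ₗ[k] N.carrier} (hf : IsDeg M N r f)
    (hdf : homD M N r f = 0) : M.shift (-r) ⟶ N :=
  mkHom (f := f ∘ₗ DGFun.ofShift M (-r)) ((hf.comp (DGFun.isDeg_ofShift M (-r))).cast (by ring)) (by
    have := homD_comp (r := -r) (s := r) (f := DGFun.ofShift M (-r)) (g := f)
    rw [hdf, DGFun.homD_ofShift, neg_add_cancel] at this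
    rw [this]
    ext
    simp)

/-- A module map of degree `r` from the free module of rank one to `V ⊠ X` is determined by one
element, which is fixed up to homotopy by an endomorphism of finite rank. -/
lemma isCompactFor_regular (X : DGModule A) (l : ℤ) :
    IsCompactFor B X (A.regular.toD⟦l⟧) := by
  refine .of_iso (shiftIso _ l).symm fun V φ => ?_
  obtain ⟨f, rfl⟩ := ((kproj_regular A).shift l).exists_Q_map φ
  obtain ⟨h, h1, h2⟩ := exists_finEnd V X
  obtain ⟨e, he, het⟩ := h2 (f.f (DGFun.toShift A.regular l (toReg A 1)))
  refine ⟨e, he, ?_⟩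
  rw [← Functor.map_comp]
  refine isNull_of_nullHtpic ⟨endo h ∘ₗ f.f, ((isDeg_endo h1).comp f.isDeg).cast (by ring), ?_⟩
  have h3 := homD_comp (r := 0) (s := -1) (f := f.f) (g := endo (X := X) h)
  rw [f.homD_eq_zero, LinearMap.comp_zero, smul_zero, add_zero, zero_add] at h3
  rw [zero_sub, h3]
  ext a
  obtain ⟨a, rfl⟩ : ∃ b : A.carrier, DGFun.toShift A.regular l (toReg A b) = a := ⟨a, rfl⟩
  have h4 : DGFun.toShift A.regular l (toReg A a) =
      (A.regular.shift l).act (DGFun.toShift A.regular l (toReg A 1)) a := (one_mul a).symm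
  have h5 : IsDeg _ _ 0 (coFin X he).f := (coFin X he).isDeg
  rw [h4, LinearMap.comp_apply, f.map_act, (isDeg_homD (isDeg_endo h1)).act, ← het, comp_f,
    f.map_act, h5.act, coFin_apply]

lemma isCompactFor_of_perf (X : DGModule A) {Y : DerivedCat A} (hY : perf A Y) (l : ℤ) :
    IsCompactFor B X (Y⟦l⟧) :=
  hY _ (isThick_isCompactFor B X) (fun Z hZ => by
    subst hZ
    exact isCompactFor_regular X) l

/-- A closed map from a perfect `K`-projective dg module to `V ⊠ X` is homotopic to its composition
with an endomorphism of `V` of finite rank. -/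
lemma KProj.exists_finEnd {P : DGModule A} (hP : KProj P) (hP' : perf A P.toD) (V : DGModule B)
    (X : DGModule A) {r : ℤ} {f : P.carrier →ₗ[k] (V.box X).res.carrier}
    (hf : IsDeg P (V.box X).res r f) (hdf : homD P (V.box X).res r f = 0) :
    ∃ e ∈ finEnd V, NullHtpic P (V.box X).res r (f - endo e ∘ₗ f) := by
  obtain ⟨e, he, h⟩ := isCompactFor_of_perf (B := B) X hP' (-r) V
    ((shiftIso P (-r)).inv ≫ (quasiIso A).Q.map (ofClosed hf hdf))
  refine ⟨e, he, NullHtpic.of_shift (n := -r) ?_⟩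
  have h1 := h.comp_left (shiftIso P (-r)).hom
  rw [← Category.assoc, Iso.hom_inv_id_assoc, ← Functor.map_comp] at h1
  exact ((hP.shift (-r)).nullHtpic_of_isNull h1).cast (by ring)

/-- If all closed maps from `P` to `X` are null-homotopic, then so are those to `V ⊠ X`. -/
lemma KProj.nullHtpic_box {P : DGModule A} (hP : KProj P) (hP' : perf A P.toD) (V : DGModule B)
    {X : DGModule A} (hX : ∀ r f, IsDeg P X r f → homD P X r f = 0 → NullHtpic P X r f) {r : ℤ}
    {f : P.carrier →ₗ[k] (V.box X).res.carrier} (hf : IsDeg P (V.box X).res r f)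
    (hdf : homD P (V.box X).res r f = 0) : NullHtpic P (V.box X).res r f := by
  obtain ⟨e, he, h⟩ := hP.exists_finEnd hP' V X hf hdf
  have h2 : NullHtpic P (V.box X).res r (endo e ∘ₗ f) := by
    clear h
    induction he using finEnd_induction with
    | zero => rw [endo_zero, LinearMap.zero_comp]; exact .zero
    | add e e' _ _ h h' => rw [endo_add, LinearMap.add_comp]; exact h.add h'
    | smul c e _ h => rw [endo_smul, LinearMap.smul_comp]; exact h.smul c
    | rank_one i w l hw hdw hl =>
      rw [endo_smulRight, LinearMap.comp_assoc]
      have h1 := homD_comp (r := r) (s := -i) (f := f) (g := contract (X := X) l)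
      rw [hdf, hl.homD_contract, LinearMap.zero_comp, LinearMap.comp_zero, smul_zero,
        add_zero] at h1
      exact ((hX _ _ (hl.isDeg_contract.comp hf) h1).comp_left (isDeg_rm hw)
        (homD_rm hw hdw)).cast (by ring)
  simpa using h.add h2

/-- `Hom_A(P, V ⊠ X)` is acyclic if there are no nonzero morphisms from `P` to the shifts
of `X`. -/
lemma acyclic_homModule_box {P : DGModule A} (hP : KProj P) (hP' : perf A P.toD) (V : DGModule B)
    {X : DGModule A} (hX : ∀ r f, IsDeg P X r f → homD P X r f = 0 → NullHtpic P X r f) :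
    (homModule P (V.box X)).Acyclic :=
  acyclic_homModule fun _ _ hf hdf => hP.nullHtpic_box hP' V hX hf hdf

/-- The chain-level form of exceptionality: the closed endomorphisms of `P` are, up to homotopy,
the multiples of the identity, which is not null-homotopic. -/
structure IsExc (P : DGModule A) : Prop where
  kproj : KProj P
  perf : DerivedCat.perf A P.toD
  nullHtpic : ∀ r f, r ≠ 0 → IsDeg P P r f → homD P P r f = 0 → NullHtpic P P r f
  scalar : ∀ f, IsDeg P P 0 f → homD P P 0 f = 0 → ∃ c : k, NullHtpic P P 0 (f - c • LinearMap.id)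
  id : ¬ NullHtpic P P 0 LinearMap.id

namespace IsExc

variable {P : DGModule A} (hP : IsExc P) (V : DGModule B)
include hP

/-- Every closed map `P → V ⊠ P` is homotopic to `p ↦ w ⊗ p` for a cocycle `w` of `V`. -/
lemma exists_rm {r : ℤ} {f : P.carrier →ₗ[k] (V.box P).res.carrier}
    (hf : IsDeg P (V.box P).res r f) (hdf : homD P (V.box P).res r f = 0) :
    ∃ w ∈ V.grading r, V.d w = 0 ∧ NullHtpic P (V.box P).res r (f - rm w) := by
  obtain ⟨e, he, h⟩ := hP.kproj.exists_finEnd hP.perf V P hf hdf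
  have h2 : ∃ w ∈ V.grading r, V.d w = 0 ∧
      NullHtpic P (V.box P).res r (endo e ∘ₗ f - rm w) := by
    clear h
    induction he using finEnd_induction with
    | zero =>
      refine ⟨0, zero_mem _, map_zero _, ?_⟩
      rw [endo_zero, LinearMap.zero_comp, map_zero, sub_zero]
      exact .zero
    | add e e' _ _ h h' =>
      obtain ⟨w, hw, hdw, h⟩ := h
      obtain ⟨w', hw', hdw', h'⟩ := h'
      refine ⟨w + w', add_mem hw hw', by rw [map_add, hdw, hdw', add_zero], ?_⟩
      rw [endo_add, LinearMap.add_comp, map_add, add_sub_add_comm]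
      exact h.add h'
    | smul c e _ h =>
      obtain ⟨w, hw, hdw, h⟩ := h
      refine ⟨c • w, Submodule.smul_mem _ _ hw, by rw [map_smul, hdw, smul_zero], ?_⟩
      rw [endo_smul, LinearMap.smul_comp, map_smul, ← smul_sub]
      exact h.smul c
    | rank_one i w l hw hdw hl =>
      rw [endo_smulRight, LinearMap.comp_assoc]
      have h1 := homD_comp (r := r) (s := -i) (f := f) (g := contract (X := P) l)
      rw [hdf, hl.homD_contract, LinearMap.zero_comp, LinearMap.comp_zero, smul_zero,
        add_zero] at h1
      have h2 := hl.isDeg_contract.comp hf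
      by_cases hri : r = i
      · subst hri
        rw [add_neg_cancel] at h1 h2
        obtain ⟨c, hc⟩ := hP.scalar _ h2 h1
        refine ⟨c • w, Submodule.smul_mem _ _ hw, by rw [map_smul, hdw, smul_zero], ?_⟩
        have h3 := (hc.comp_left (isDeg_rm hw) (homD_rm hw hdw)).cast (zero_add _)
        rw [LinearMap.comp_sub, LinearMap.comp_smul, LinearMap.comp_id] at h3
        rwa [map_smul]
      · refine ⟨0, zero_mem _, map_zero _, ?_⟩
        rw [map_zero, sub_zero]
        exact ((hP.nullHtpic _ _ (fun h => hri (by linarith)) h2 h1).comp_left (isDeg_rm hw)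
          (homD_rm hw hdw)).cast (by ring)
  obtain ⟨w, hw, hdw, h2⟩ := h2
  exact ⟨w, hw, hdw, by simpa using h.add h2⟩

/-- For an exceptional `P`, the map `V → Hom_A(P, V ⊠ P)` is a quasi-isomorphism. -/
lemma quasiIso_constHom : quasiIso B (constHom V P) := by
  intro i
  rw [bijective_cohomologyMap_iff]
  constructor
  · rintro v ⟨hv, hdv⟩ ⟨x, hx, hxv⟩
    by_contra hn
    obtain ⟨l, hl, hlv⟩ := exists_isFormOfDeg hv fun ⟨u, hu⟩ => hn
      ⟨V.proj (i - 1) u, proj_mem _ _ _, by rw [d_proj, sub_add_cancel, hu, proj_of_mem V hv]⟩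
    refine hP.id ?_
    have h1 : NullHtpic P (V.box P).res i (rm v) := ⟨homEval P (V.box P) x, isDeg_homEval hx, by
      rw [← homTotD_of_isDeg (isDeg_homEval hx)]
      exact (congrArg (homEval P (V.box P)) hxv).trans (homEval_constHom V P v)⟩
    have h2 := (h1.comp_left hl.isDeg_contract hl.homD_contract).cast (add_neg_cancel i)
    rwa [show contract l ∘ₗ rm v = (LinearMap.id : P.carrier →ₗ[k] P.carrier) by
      ext p
      simp [hlv]] at h2
  · rintro x ⟨hx, hdx⟩
    have hdx' : homD P (V.box P).res i (homEval P (V.box P) x) = 0 := by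
      rw [← homTotD_of_isDeg (isDeg_homEval hx)]
      exact congrArg Subtype.val hdx
    obtain ⟨w, hw, hdw, g, hg, hg'⟩ := hP.exists_rm V (isDeg_homEval hx) hdx'
    refine ⟨w, ⟨hw, hdw⟩, -homMk (N := V.box P) hg, neg_mem (homMk_mem (N := V.box P) hg), ?_⟩
    refine homModule_ext ?_
    rw [map_neg, map_neg, map_sub, homEval_constHom]
    refine (congrArg Neg.neg ((homTotD_of_isDeg hg).trans hg')).trans (neg_sub _ _)

/-- For an exceptional `P`, the evaluation `Hom_A(P, V ⊠ P) ⊠ P → V ⊠ P` is a quasi-isomorphism. -/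
lemma quasiIso_evHom : quasiIso (B.tensor A) (evHom P (V.box P)) := by
  obtain ⟨c, h1, hc⟩ : ∃ c : V.box P ⟶ (homModule P (V.box P)).box P, quasiIso _ c ∧
      ∀ v p, c.f (tm v p) = tm ((constHom V P).f v) p :=
    ⟨(boxRight P B).mapHom (constHom V P),
      (boxRight P B).quasiIso_mapHom _ (hP.quasiIso_constHom V), fun _ _ => rfl⟩
  have h2 : c ≫ evHom P (V.box P) = 𝟙 (V.box P) :=
    Hom.ext (box_hom_ext fun i v hv j p hp =>
      (congrArg (evHom P (V.box P)).f (hc v p)).trans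
        ((evHom_tm _ p).trans (LinearMap.congr_fun (homEval_constHom V P v) p)))
  refine quasiIso_of_comp c _ h1 ?_
  rw [h2]
  exact quasiIso_of_bijective _ Function.bijective_id

end IsExc

end DGModule

namespace DGModule

open DerivedCat

variable {k : Type u} [Field k] {A B : DGAlgebra.{u, v} k}

/-! ### Exceptional objects and their resolutions -/

lemma NullHtpic.of_subsingleton {P X : DGModule A} (hP : KProj P) {r : ℤ}
    [Subsingleton (P.toD ⟶ X.toD⟦r⟧)] {f : P.carrier →ₗ[k] X.carrier} (hf : IsDeg P X r f)
    (hdf : homD P X r f = 0) : NullHtpic P X r f := by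
  have h1 := homD_comp (r := r) (s := -r) (f := f) (g := DGFun.toShift X r)
  rw [hdf, DGFun.homD_toShift, LinearMap.zero_comp, LinearMap.comp_zero, smul_zero, add_zero,
    add_neg_cancel] at h1
  let g : P ⟶ X.shift r := mkHom (((DGFun.isDeg_toShift X r).comp hf).cast (by ring)) h1
  have h2 : (quasiIso A).Q.map g = (quasiIso A).Q.map (zeroHom P (X.shift r)) := by
    rw [← cancel_mono (shiftIso X r).hom]
    exact Subsingleton.elim _ _
  have h3 := hP.nullHtpic_of_isNull (h2 ▸ isNull_zeroHom P (X.shift r))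
  exact (h3.comp_left (DGFun.isDeg_ofShift X r) (DGFun.homD_ofShift X r)).cast (by ring)

lemma subsingleton_of_iso {C : Type*} [Category C] {X X' Y Y' : C} (e : X ≅ X') (e' : Y ≅ Y')
    (h : Subsingleton (X' ⟶ Y')) : Subsingleton (X ⟶ Y) :=
  ⟨fun f g => by
    rw [← cancel_epi e.inv, ← cancel_mono e'.hom]
    exact Subsingleton.elim _ _⟩

/-- There are no nonzero morphisms from the shifts of `P` to those of `X`, on the chain level. -/
def Orth (P X : DGModule A) : Prop :=
  ∀ r f, IsDeg P X r f → homD P X r f = 0 → NullHtpic P X r f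

lemma orth_of_subsingleton {P X E E' : DGModule A} (hP : KProj P) (e : P.toD ≅ E.toD)
    (e' : X.toD ≅ E'.toD) (h : ∀ m : ℤ, Subsingleton (E.toD ⟶ E'.toD⟦m⟧)) : Orth P X := by
  intro r f hf hdf
  have := subsingleton_of_iso e ((shiftFunctor (DerivedCat A) r).mapIso e') (h r)
  exact .of_subsingleton hP hf hdf

/-- A `K`-projective resolution of an exceptional perfect dg module. -/
lemma isExc_of_isExceptional {P E : DGModule A} (hP : KProj P) (f : P ⟶ E) (hf : quasiIso A f)
    (hE : E.IsExceptional) (hE' : perf A E.toD) : IsExc P := by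
  have hQf := (quasiIso A).Q_inverts f hf
  have hsc : ∀ c : k, f ≫ E.scalar c = P.scalar c ≫ f := fun c => by
    ext p
    exact (map_smul f.f c p).symm
  have hinj : ∀ c : k, (quasiIso A).Q.map (P.scalar c) ≫ (quasiIso A).Q.map f =
      (quasiIso A).Q.map f ≫ (quasiIso A).Q.map (E.scalar c) := fun c => by
    rw [← Functor.map_comp, ← Functor.map_comp, hsc]
  refine ⟨hP, isThick_perf.iso (isoOfQuasiIso f hf).symm hE', fun r g hr hg hdg => ?_,
    fun g hg hdg => ?_, fun h => ?_⟩
  · have := subsingleton_of_iso (isoOfQuasiIso f hf)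
      ((shiftFunctor (DerivedCat A) r).mapIso (isoOfQuasiIso f hf)) (hE.hom_eq_zero r hr)
    exact .of_subsingleton hP hg hdg
  · obtain ⟨c, hc⟩ := hE.end_eq.2
      (inv ((quasiIso A).Q.map f) ≫ (quasiIso A).Q.map (mkHom hg hdg) ≫ (quasiIso A).Q.map f)
    have h1 : (quasiIso A).Q.map (mkHom hg hdg) = (quasiIso A).Q.map (P.scalar c) := by
      rw [← cancel_mono ((quasiIso A).Q.map f), hinj]
      refine Eq.trans ?_ (congrArg ((quasiIso A).Q.map f ≫ ·) hc.symm)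
      simp
    exact ⟨c, homotopic_iff_nullHtpic.1 (hP.homotopic_of_Q_map_eq h1)⟩
  · have h1 : Homotopic (P.scalar 1) (P.scalar 0) := homotopic_iff_nullHtpic.2 (by
      have : (P.scalar 1).f - (P.scalar 0).f = (LinearMap.id : P.carrier →ₗ[k] P.carrier) := by
        ext p
        simp [scalar]
      rwa [this])
    have h2 : (quasiIso A).Q.map (E.scalar 1) = (quasiIso A).Q.map (E.scalar 0) := by
      rw [← cancel_epi ((quasiIso A).Q.map f), ← hinj, ← hinj, Q_map_eq_of_homotopic h1]
    exact one_ne_zero (hE.end_eq.1 h2)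

/-! ### Projections away from the blocks -/

lemma quasiIso_dsumι {ι : Type} (M : ι → DGModule A) (q : ι)
    (h : ∀ q', q' ≠ q → (M q').Acyclic) : quasiIso A (dsumι M q) := by
  classical
  have h1 : ∀ q', ∃ c : (M q').carrier →ₗ[k] (M q').carrier, ∀ m, q' ≠ q →
      (M q').d (c m) + c ((M q').d m) = m := fun q' => by
    by_cases hq : q' = q
    · exact ⟨0, fun _ hq' => (hq' hq).elim⟩
    · obtain ⟨c, _, hc⟩ := (h q' hq).exists_contraction
      exact ⟨c, fun m _ => hc m⟩
  choose c hc using h1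
  let H : (dsum M).carrier →ₗ[k] (dsum M).carrier := dsumDesc M fun q' =>
    if q' = q then 0 else (dsumι M q').f ∘ₗ c q'
  have hH : ∀ x, x - (dsumι M q).f ((dsumπ M q).f x) = (dsum M).d (H x) + H ((dsum M).d x) := by
    intro x
    induction x using dsum_induction with
    | zero => simp
    | add x y hx hy =>
      simp only [map_add]
      rw [add_sub_add_comm, hx, hy]
      abel
    | of q' m =>
      rw [← Hom.map_d, dsumDesc_ι, dsumDesc_ι]
      by_cases hq : q' = q
      · subst hq
        simp
      · rw [dsumπ_dsumι_ne M hq, map_zero, sub_zero, if_neg hq, LinearMap.comp_apply,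
          LinearMap.comp_apply, ← Hom.map_d, ← map_add, hc q' m hq]
  rw [quasiIso_iff_acyclic_cone]
  rintro ⟨m, y⟩ hx
  have h3 : (dsumι M q).f m + (dsum M).d y = 0 := (Prod.mk_eq_zero.1 hx).2
  have h4 : m = -(M q).d ((dsumπ M q).f y) := by
    have := congrArg (dsumπ M q).f h3
    rw [map_add, map_zero, dsumπ_dsumι_self, Hom.map_d] at this
    exact eq_neg_of_add_eq_zero_left this
  refine ⟨((dsumπ M q).f y, H (y - (dsumι M q).f ((dsumπ M q).f y))), Prod.ext h4.symm ?_⟩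
  change (dsumι M q).f ((dsumπ M q).f y) +
    (dsum M).d (H (y - (dsumι M q).f ((dsumπ M q).f y))) = y
  have h5 : (dsum M).d (y - (dsumι M q).f ((dsumπ M q).f y)) = 0 := by
    rw [map_sub, ← Hom.map_d, ← neg_neg ((M q).d _), ← h4, map_neg, sub_neg_eq_add, add_comm, h3]
  have h6 := hH (y - (dsumι M q).f ((dsumπ M q).f y))
  rw [h5, map_zero, add_zero] at h6
  rw [← h6]
  simp

section Blocks

variable {ι : Type} (P : ι → DGModule A) (hP : ∀ q, IsExc (P q)) (B)

/-- The dg functor `N ↦ Hom_A(P, N) ⊠ P`. -/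
def coev (P : DGModule A) (hP : KProj P) (B : DGAlgebra.{u, v} k) :
    DGFun (B.tensor A) (B.tensor A) := (homFun P hP B).comp (boxRight P B)

/-- The evaluation of all `Hom_A(P_q, N) ⊠ P_q` at once. -/
def evSum (N : DGModule (B.tensor A)) :
    (DGFun.dsum fun q => coev (P q) (hP q).kproj B).obj N ⟶ N :=
  dsumDescHom (fun q => (coev (P q) (hP q).kproj B).obj N) fun q => evHom (P q) N

lemma evSum_ι (N : DGModule (B.tensor A)) (q : ι)
    (x : ((coev (P q) (hP q).kproj B).obj N).carrier) :
    (evSum B P hP N).f ((dsumι (fun q => (coev (P q) (hP q).kproj B).obj N) q).f x) =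
      (evHom (P q) N).f x :=
  dsumDescHom_ι (fun q => (coev (P q) (hP q).kproj B).obj N) (fun q => evHom (P q) N) q x

/-- The cone of the evaluation `⨁_q Hom_A(P_q, N) ⊠ P_q → N`, as a dg functor of `N`. -/
def blockCone : DGFun (B.tensor A) (B.tensor A) :=
  DGFun.cone (DGFun.dsum fun q => coev (P q) (hP q).kproj B) (DGFun.id _) (evSum B P hP)
    fun {M N r f} hf => dsum_hom_ext _ fun q => by
      ext x
      have h := LinearMap.congr_fun (evHom_natural (P := P q) hf) x
      refine (congrArg f (evSum_ι B P hP M q x)).trans (h.trans ?_)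
      have h1 := dsumDesc_ι (fun q => (coev (P q) (hP q).kproj B).obj M) (fun q =>
        (dsumι (fun q => (coev (P q) (hP q).kproj B).obj N) q).f ∘ₗ
          (coev (P q) (hP q).kproj B).map M N r f) q x
      exact ((congrArg (evSum B P hP N).f h1).trans (evSum_ι B P hP N q _)).symm

variable {P B}

/-- A dg module orthogonal to all the `P_q` is not changed by the projection. -/
lemma quasiIso_inr_blockCone {N : DGModule (B.tensor A)}
    (h : ∀ q, (homModule (P q) N).Acyclic) : quasiIso _ (coneInr (evSum B P hP N)) := by
  have h0 : ((DGFun.dsum fun q => coev (P q) (hP q).kproj B).obj N).Acyclic :=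
    acyclic_dsum _ fun q => (boxRight (P q) B).acyclic (h q)
  rw [quasiIso_iff_acyclic_cone]
  rintro ⟨x, ⟨y, z⟩⟩ hx
  have h1 : -N.d x = 0 := (Prod.mk_eq_zero.1 hx).1
  have h2 : 0 + -((DGFun.dsum fun q => coev (P q) (hP q).kproj B).obj N).d y = 0 :=
    (Prod.mk_eq_zero.1 (Prod.mk_eq_zero.1 hx).2).1
  have h3 : x + ((evSum B P hP N).f y + N.d z) = 0 :=
    (Prod.mk_eq_zero.1 (Prod.mk_eq_zero.1 hx).2).2
  obtain ⟨y', rfl⟩ := h0 y (by rwa [zero_add, neg_eq_zero] at h2)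
  refine ⟨(z + (evSum B P hP N).f y', (-y', 0)), Prod.ext ?_ (Prod.ext ?_ ?_)⟩
  · change -N.d (z + (evSum B P hP N).f y') = x
    rw [map_add, ← Hom.map_d, add_comm, eq_comm]
    exact eq_neg_of_add_eq_zero_left h3
  · change 0 + -((DGFun.dsum fun q => coev (P q) (hP q).kproj B).obj N).d (-y') = _
    rw [zero_add, map_neg, neg_neg]
  · change z + (evSum B P hP N).f y' + ((evSum B P hP N).f (-y') + N.d 0) = z
    rw [map_neg, map_zero]
    abel

/-- A dg module supported at one of the `P_q` is annihilated by the projection. -/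
lemma acyclic_blockCone {q : ι} (V : DGModule B)
    (h : ∀ q', q' ≠ q → (homModule (P q') (V.box (P q))).Acyclic) :
    ((blockCone B P hP).obj (V.box (P q))).Acyclic := by
  refine (quasiIso_iff_acyclic_cone (evSum B P hP (V.box (P q)))).1 ?_
  refine quasiIso_of_comp (dsumι (fun q' => (coev (P q') (hP q').kproj B).obj (V.box (P q))) q)
    _ (quasiIso_dsumι _ q fun q' hq' => (boxRight (P q') B).acyclic (h q' hq')) ?_
  · rw [show dsumι (fun q' => (coev (P q') (hP q').kproj B).obj (V.box (P q))) q ≫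
      evSum B P hP (V.box (P q)) = evHom (P q) (V.box (P q)) from
        hom_ext fun x => evSum_ι B P hP _ q x]
    exact (hP q).quasiIso_evHom V

end Blocks

end DGModule

namespace DGModule

open DerivedCat

variable {k : Type u} [Field k] {A B : DGAlgebra.{u, v} k}

/-! ### The tower of projections -/

section Tower

variable (B) {ι : Type} (P : ι → DGModule A) (hP : ∀ q, IsExc (P q)) (lev : ι → ℕ) (n : ℕ)

/-- The block that is projected away in step `s`. -/
abbrev Block (s : ℕ) : Type := {q : ι // lev q + s = n}

/-- The projection away from the block of level `n - s`. -/
abbrev blockFun (s : ℕ) : DGFun (B.tensor A) (B.tensor A) :=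
  blockCone B (fun q : Block lev n s => P q.1) fun q => hP q.1

/-- The composition of the first `s` projections, away from the blocks of levels `n`, `n - 1`, …,
`n - s + 1`. -/
def tower : ℕ → DGFun (B.tensor A) (B.tensor A)
  | 0 => DGFun.id _
  | s + 1 => (tower s).comp (blockFun B P hP lev n s)

variable {B P lev n}
variable (horth : ∀ q q', q ≠ q' → lev q' ≤ lev q → Orth (P q) (P q')) (V : DGModule B)
include horth

lemma acyclic_homModule_of_lev (hP : ∀ q, IsExc (P q)) {q q' : ι} (h : q' ≠ q)
    (h' : lev q ≤ lev q') : (homModule (P q') (V.box (P q))).Acyclic :=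
  acyclic_homModule_box (hP q').kproj (hP q').perf V (horth q' q h h')

/-- Before its level is reached, `V ⊠ P_q` is not changed by the projections. -/
lemma tower_iso {q : ι} {s : ℕ} (h : lev q + s ≤ n) :
    Nonempty (((tower B P hP lev n s).obj (V.box (P q))).toD ≅ (V.box (P q)).toD) := by
  induction s with
  | zero => exact ⟨Iso.refl _⟩
  | succ s ih =>
    obtain ⟨e⟩ := ih (by lia)
    have h1 := quasiIso_inr_blockCone (P := fun q : Block lev n s => P q.1) (fun q => hP q.1)
      (N := V.box (P q)) fun q' => acyclic_homModule_of_lev horth V hP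
        (fun h' => by have := q'.2; rw [h'] at this; lia) (by have := q'.2; lia)
    have e2 : ((blockFun B P hP lev n s).obj (V.box (P q))).toD ≅ (V.box (P q)).toD :=
      (isoOfQuasiIso _ h1).symm
    have e1 := (blockFun B P hP lev n s).derived.mapIso e
    exact ⟨e1 ≪≫ e2⟩

/-- The projection away from the block of `P_q` annihilates `V ⊠ P_q`. -/
lemma tower_acyclic {q : ι} (hq : lev q ≤ n) {s : ℕ} (h : n < lev q + s) :
    ((tower B P hP lev n s).obj (V.box (P q))).Acyclic := by
  induction s with
  | zero => lia
  | succ s ih =>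
    by_cases h' : n < lev q + s
    · exact (blockFun B P hP lev n s).acyclic (ih h')
    · obtain ⟨e⟩ := tower_iso hP horth V (q := q) (s := s) (n := n) (by lia)
      refine acyclic_of_iso ((blockFun B P hP lev n s).derived.mapIso e).symm ?_
      exact acyclic_blockCone (P := fun q : Block lev n s => P q.1) (fun q => hP q.1)
        (q := ⟨q, by lia⟩) V fun q' hq' => acyclic_homModule_of_lev horth V hP
          (fun h => hq' (Subtype.ext h)) (by have := q'.2; lia)

/-- The coefficients of the projections of `V ⊠ P_q` are perfect: each is acyclic or
quasi-isomorphic to `V`. -/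
lemma perf_homModule_tower (hV : perf B V.toD) {q : ι} (hq : lev q ≤ n) {s : ℕ}
    (q' : Block lev n s) :
    perf B (homModule (P q'.1) ((tower B P hP lev n s).obj (V.box (P q)))).toD := by
  let H : DGFun (B.tensor A) B := homFun (P q'.1) (hP q'.1).kproj B
  by_cases h : n < lev q + s
  · exact isThick_perf.acyclic (H.acyclic (tower_acyclic hP horth V hq h))
  · obtain ⟨e⟩ := tower_iso hP horth V (q := q) (s := s) (n := n) (by lia)
    refine isThick_perf.iso (H.derived.mapIso e).symm ?_
    change perf B (homModule (P q'.1) (V.box (P q))).toD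
    by_cases hqq : q'.1 = q
    · rw [hqq]
      exact isThick_perf.iso (isoOfQuasiIso _ ((hP q).quasiIso_constHom V)) hV
    · exact isThick_perf.acyclic (acyclic_homModule_of_lev horth V hP hqq
        (by have := q'.2; lia))

end Tower

/-! ### Dévissage of the diagonal bimodule -/

/-- The comparison of the external product of the regular modules with the regular module. -/
def regularBox (B A : DGAlgebra.{u, v} k) :
    B.regular.box A.regular ⟶ (B.tensor A).regular where
  f := (toTensor B A).toLinearMap
  map_mem h := ⟨_, h, rfl⟩
  map_act t p := by
    obtain ⟨p, rfl⟩ := (toTensor B A).surjective p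
    exact (gtp_mul t p).symm
  map_d _ := rfl

lemma quasiIso_regularBox (B A : DGAlgebra.{u, v} k) : quasiIso _ (regularBox B A) :=
  quasiIso_of_bijective _ (toTensor B A).bijective

/-- A thick subcategory that contains the `A ⊠ P_q`, for generators `P_q` of `Perf(A)`, contains
the diagonal bimodule of a smooth dg algebra. -/
lemma diagonal_of_box {A : DGAlgebra.{u, v} k} (hA : A.IsSmooth) {ι : Type}
    {P : ι → DGModule A} (hfull : thickClosure (fun Y => ∃ q, Y = (P q).toD) A.regular.toD)
    {T : ObjectProperty (DerivedCat (A.op.tensor A))} (hT : IsThick T)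
    (h : ∀ q, T (A.op.regular.box (P q)).toD) : T A.diagonal.toD := by
  refine hA T hT fun X hX => ?_
  subst hX
  refine hT.iso (isoOfQuasiIso _ (quasiIso_regularBox A.op A)) ?_
  exact hfull _ (hT.comap (boxLeft A.op.regular A)) fun Y ⟨q, hY⟩ => by
    subst hY
    exact h q

end DGModule

namespace DerivedCat

variable {k : Type u} [Field k] {A : DGAlgebra.{u, v} k}

/-! ### Iterated extensions -/

lemma extensionsOf_iso {E X Y : DerivedCat A} (e : X ≅ Y) :
    ∀ {n : ℕ}, extensionsOf E n X → extensionsOf E n Y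
  | 0, ⟨r, s, c, hc, ⟨i⟩⟩ => ⟨r, s, c, hc, ⟨i ≪≫ e⟩⟩
  | _ + 1, ⟨X', Y', f, g, h, ⟨M, N, m, ⟨i⟩⟩, h1, h2⟩ => by
    have e1 : (f ≫ e.hom) ≫ e.inv = 𝟙 X' ≫ f := by simp
    have e2 : (e.inv ≫ g) ≫ 𝟙 Y' = e.inv ≫ g := by simp
    have e3 : h ≫ (shiftFunctor (DerivedCat A) (1 : ℤ)).map (𝟙 X') = 𝟙 Y' ≫ h := by simp
    exact ⟨X', Y', f ≫ e.hom, e.inv ≫ g, h, ⟨M, N, m, ⟨Pretriangulated.Triangle.isoMk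
      (.mk (f ≫ e.hom) (e.inv ≫ g) h) (.mk f g h) (Iso.refl _) e.symm (Iso.refl _) e1 e2 e3 ≪≫ i⟩⟩,
      h1, h2⟩

lemma sumsOfShifts_self (E : DerivedCat A) : sumsOfShifts E E := by
  refine ⟨1, fun _ => 0, Limits.Cofan.mk (E⟦(0 : ℤ)⟧) fun _ => 𝟙 _, ⟨?_⟩,
    ⟨(shiftFunctorZero (DerivedCat A) ℤ).app E⟩⟩
  exact Limits.Cofan.IsColimit.mk _ (fun s => s.inj 0)
    (fun s j => by
      obtain rfl := Subsingleton.elim j 0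
      exact Category.id_comp _)
    fun s m hm => by
      rw [← hm 0]
      exact (Category.id_comp _).symm

end DerivedCat

namespace DGModule

open DerivedCat

variable {k : Type u} [Field k] {A B : DGAlgebra.{u, v} k}

section Step

variable {K M Z : DGModule A} (η : K ⟶ M) (i : K ⟶ Z) (r : Z ⟶ K) (W : DGModule A)

/-- The morphism `z ↦ (η (r z), (z, 0))` from `Z` to `M ⊕ cone i ⊕ W`. -/
def stepHom : Z ⟶ M.prod ((cone i).prod W) where
  f := LinearMap.prod (η.f ∘ₗ r.f) (LinearMap.prod (coneInr i).f 0)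
  map_mem h := ⟨η.map_mem (r.map_mem h), (coneInr i).map_mem h, zero_mem _⟩
  map_act z a := Prod.ext (((r ≫ η)).map_act z a) (Prod.ext ((coneInr i).map_act z a)
    (by change 0 = W.act 0 a; simp))
  map_d z := Prod.ext ((r ≫ η).map_d z) (Prod.ext ((coneInr i).map_d z) (map_zero W.d).symm)

/-- The projection from the cone of `stepHom` to `cone η ⊕ W`. -/
def stepProj : cone (stepHom η i r W) ⟶ (cone η).prod W where
  f :=
    { toFun := fun x => ((r.f x.1, x.2.1), x.2.2.2)
      map_add' := fun x y => Prod.ext (Prod.ext (map_add r.f x.1 y.1) rfl) rfl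
      map_smul' := fun c x => Prod.ext (Prod.ext (map_smul r.f c x.1) rfl) rfl }
  map_mem h := ⟨⟨r.map_mem h.1, h.2.1⟩, h.2.2.2⟩
  map_act x a := Prod.ext (Prod.ext (r.map_act x.1 a) rfl) rfl
  map_d x := Prod.ext (Prod.ext (by
    change r.f (-Z.d x.1) = -K.d (r.f x.1)
    rw [map_neg, r.map_d]) rfl) (zero_add (W.d x.2.2.2))

variable {i r} (h : ∀ x, r.f (i.f x) = x)

/-- The inclusion of `cone η ⊕ W` in the cone of `stepHom`. -/
def stepIncl : (cone η).prod W ⟶ cone (stepHom η i r W) where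
  f :=
    { toFun := fun x => (i.f x.1.1, (x.1.2, ((-x.1.1, 0), x.2)))
      map_add' := fun x y => Prod.ext (map_add i.f x.1.1 y.1.1) (Prod.ext rfl (Prod.ext
        (Prod.ext (neg_add x.1.1 y.1.1) (add_zero (0 : Z.carrier)).symm) rfl))
      map_smul' := fun c x => Prod.ext (map_smul i.f c x.1.1) (Prod.ext rfl (Prod.ext
        (Prod.ext (smul_neg c x.1.1).symm (smul_zero (A := Z.carrier) c).symm) rfl)) }
  map_mem h := ⟨i.map_mem h.1.1, h.1.2, ⟨neg_mem h.1.1, zero_mem _⟩, h.2⟩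
  map_act x a := Prod.ext (i.map_act x.1.1 a) (Prod.ext rfl (Prod.ext (Prod.ext
    (by change -(K.act x.1.1 a) = K.act (-x.1.1) a; simp) (by change 0 = Z.act 0 a; simp)) rfl))
  map_d x := by
    refine Prod.ext ?_ (Prod.ext ?_ (Prod.ext (Prod.ext ?_ ?_) ?_))
    · change i.f (-K.d x.1.1) = -Z.d (i.f x.1.1)
      rw [map_neg, i.map_d]
    · change η.f x.1.1 + M.d x.1.2 = η.f (r.f (i.f x.1.1)) + M.d x.1.2
      rw [h]
    · change -(-K.d x.1.1) = 0 + -K.d (-x.1.1)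
      rw [zero_add, map_neg]
    · change 0 = i.f x.1.1 + (i.f (-x.1.1) + Z.d 0)
      rw [map_zero, map_neg]
      abel
    · exact (zero_add (W.d x.2)).symm

include h in
/-- If `r` is a retraction of `i`, then `Z` is `K ⊕ cone i` up to homotopy, so that the cone of
`stepHom` is `cone η ⊕ W` up to homotopy. -/
lemma quasiIso_stepProj : quasiIso A (stepProj η i r W) := by
  refine quasiIso_of_homotopyEquiv _ (stepIncl η W h) ?_ ?_
  · -- the homotopy `(z, m, (k, z'), w) ↦ (z' - i (r z'), 0, (r z', 0), 0)`, up to sign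
    let H : (cone (stepHom η i r W)).carrier →ₗ[k] (cone (stepHom η i r W)).carrier :=
      { toFun := fun x => (i.f (r.f x.2.2.1.2) - x.2.2.1.2, (0, ((-r.f x.2.2.1.2, 0), 0)))
        map_add' := fun x y => Prod.ext (by
          change i.f (r.f (x.2.2.1.2 + y.2.2.1.2)) - (x.2.2.1.2 + y.2.2.1.2) = _
          rw [map_add, map_add, add_sub_add_comm]
          rfl) (Prod.ext (add_zero 0).symm (Prod.ext (Prod.ext (by
            change -r.f (x.2.2.1.2 + y.2.2.1.2) = _
            rw [map_add, neg_add]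
            rfl) (add_zero 0).symm) (add_zero 0).symm))
        map_smul' := fun c x => Prod.ext (by
          change i.f (r.f (c • x.2.2.1.2)) - c • x.2.2.1.2 = _
          rw [map_smul, map_smul, ← smul_sub]
          rfl) (Prod.ext (smul_zero c).symm (Prod.ext (Prod.ext (by
            change -r.f (c • x.2.2.1.2) = _
            rw [map_smul, ← smul_neg]
            rfl) (smul_zero c).symm) (smul_zero c).symm)) }
    refine homotopic_iff.2 ⟨H, ⟨fun {j x} hx => ?_, fun x a => ?_⟩, fun x => ?_⟩
    · have h1 : x.2.2.1.2 ∈ Z.grading (j + -1 + 1) := by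
        rw [neg_add_cancel_right]
        exact hx.2.2.1.2
      exact ⟨sub_mem (i.map_mem (r.map_mem h1)) h1, zero_mem _,
        ⟨neg_mem (r.map_mem h1), zero_mem _⟩, zero_mem _⟩
    · refine Prod.ext ?_ (Prod.ext ?_ (Prod.ext (Prod.ext ?_ ?_) ?_))
      · change i.f (r.f (Z.act x.2.2.1.2 a)) - Z.act x.2.2.1.2 a =
          Z.act (i.f (r.f x.2.2.1.2) - x.2.2.1.2) a
        rw [r.map_act, i.map_act, map_sub, LinearMap.sub_apply]
      · change 0 = M.act 0 a
        simp
      · change -r.f (Z.act x.2.2.1.2 a) = K.act (-r.f x.2.2.1.2) a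
        rw [r.map_act, map_neg, LinearMap.neg_apply]
      · change 0 = Z.act 0 a
        simp
      · change 0 = W.act 0 a
        simp
    · refine Prod.ext ?_ (Prod.ext ?_ (Prod.ext (Prod.ext ?_ ?_) ?_))
      · change i.f (r.f x.1) - x.1 = -Z.d (i.f (r.f x.2.2.1.2) - x.2.2.1.2) +
          (i.f (r.f (x.1 + (i.f x.2.2.1.1 + Z.d x.2.2.1.2))) -
            (x.1 + (i.f x.2.2.1.1 + Z.d x.2.2.1.2)))
        simp only [map_add, map_sub, h, r.map_d, i.map_d]
        abel
      · change x.2.1 - x.2.1 = η.f (r.f (i.f (r.f x.2.2.1.2) - x.2.2.1.2)) + M.d 0 + 0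
        simp [h]
      · change -r.f x.1 - x.2.2.1.1 = (0 + -K.d (-r.f x.2.2.1.2)) +
          -r.f (x.1 + (i.f x.2.2.1.1 + Z.d x.2.2.1.2))
        simp only [map_add, map_neg, h, r.map_d]
        abel
      · change 0 - x.2.2.1.2 = ((i.f (r.f x.2.2.1.2) - x.2.2.1.2) +
          (i.f (-r.f x.2.2.1.2) + Z.d 0)) + 0
        rw [map_neg, map_zero]
        abel
      · change x.2.2.2 - x.2.2.2 = 0 + W.d 0 + 0
        simp
  · rw [show stepIncl η W h ≫ stepProj η i r W = 𝟙 _ from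
      hom_ext fun x => Prod.ext (Prod.ext (h x.1.1) rfl) rfl]
    exact .refl _

end Step

/-- A tower `M 0, M 1, …, M (n + 1)` of successive cones of morphisms from retracts of `Z`, ending
in an acyclic dg module, exhibits `M 0` as a direct summand of an `n`-fold extension of sums of
copies of `Z`. -/
lemma exists_extensionsOf {Z : DGModule A} {n : ℕ} {K M : ℕ → DGModule A} (η : ∀ s, K s ⟶ M s)
    (hM : ∀ s, M (s + 1) = cone (η s))
    (hr : ∀ s ≤ n, ∃ (i : K s ⟶ Z) (r : Z ⟶ K s), ∀ x, r.f (i.f x) = x)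
    (hn : (M (n + 1)).Acyclic) : ∀ t s : ℕ, s + t = n →
      ∃ W : DGModule A, extensionsOf Z.toD t ((M s).prod W).toD
  | 0, s, hs => by
    obtain rfl : s = n := hs
    obtain ⟨i, r, h⟩ := hr s le_rfl
    rw [hM] at hn
    have hp : ((cone (η s)).prod (zero A)).Acyclic := by
      rintro ⟨x, y⟩ hx
      obtain ⟨x', rfl⟩ := hn x (Prod.mk_eq_zero.1 hx).1
      exact ⟨(x', 0), Prod.ext rfl (Subsingleton.elim (α := (zero A).carrier) _ _)⟩
    have hf : quasiIso A (stepHom (η s) i r (zero A)) := by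
      rw [quasiIso_iff_acyclic_cone]
      exact (acyclic_iff_of_quasiIso _ (quasiIso_stepProj (η s) (zero A) h)).2 hp
    exact ⟨(cone i).prod (zero A), extensionsOf_iso (n := 0) (isoOfQuasiIso _ hf)
      (sumsOfShifts_self Z.toD)⟩
  | t + 1, s, hs => by
    obtain ⟨W, hW⟩ := exists_extensionsOf η hM hr hn t (s + 1) (by lia)
    obtain ⟨i, r, h⟩ := hr s (by lia)
    rw [hM] at hW
    exact ⟨(cone i).prod W, Z.toD, (cone (stepHom (η s) i r W)).toD, _, _, _,
      ⟨Z, _, stepHom (η s) i r W, ⟨Iso.refl _⟩⟩, sumsOfShifts_self _,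
      extensionsOf_iso (isoOfQuasiIso _ (quasiIso_stepProj (η s) W h)).symm hW⟩

/-! ### Generation of the diagonal bimodule -/

/-- The external product of two morphisms. -/
def boxHom {M M' : DGModule B} {N N' : DGModule A} (f : M ⟶ M') (g : N ⟶ N') :
    M.box N ⟶ M'.box N' :=
  mkHom (f := boxMap f.f g.f) (isDeg_of_box
    (fun i m hm j x hx => by
      rw [boxMap_tm]
      exact tm_mem (add_zero _).symm (f.map_mem hm) (g.map_mem hx))
    (fun i m hm j x hx l b hb n a ha => by
      rw [boxMap_tm, boxMap_tm, box_act_tm _ (g.map_mem hx) hb a, f.map_act, g.map_act]))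
    (box_hom_ext fun i m hm j x hx => by
      rw [homD_apply, box_d_tm hm, map_add, map_smul]
      simp only [boxMap_tm]
      rw [box_d_tm (f.map_mem hm), f.map_d, g.map_d]
      simp)

lemma boxHom_tm {M M' : DGModule B} {N N' : DGModule A} (f : M ⟶ M') (g : N ⟶ N')
    (m : M.carrier) (x : N.carrier) : (boxHom f g).f (tm m x) = tm (f.f m) (g.f x) := rfl

/-- The direct sum of external products of different summands is a retract of the external product
of the direct sums. -/
lemma exists_retract_box {ι κ β : Type} [Finite β] (F : κ → DGModule B) (G : ι → DGModule A)
    {a : β → κ} (ha : Function.Injective a) (b : β → ι) :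
    ∃ (i : (dsum fun q => (F (a q)).box (G (b q))) ⟶ (dsum F).box (dsum G))
      (r : (dsum F).box (dsum G) ⟶ dsum fun q => (F (a q)).box (G (b q))),
      ∀ x, r.f (i.f x) = x := by
  classical
  have := Fintype.ofFinite β
  let X : β → DGModule (B.tensor A) := fun q => (F (a q)).box (G (b q))
  let c : ∀ q, (dsum F).box (dsum G) ⟶ dsum X := fun q =>
    boxHom (dsumπ F (a q)) (dsumπ G (b q)) ≫ dsumι X q
  refine ⟨dsumDescHom X fun q => boxHom (dsumι F (a q)) (dsumι G (b q)),
    mkHom (f := ∑ q, (c q).f) ((homSub _ _ 0).sum_mem fun q _ => (c q).isDeg) ?_, fun x => ?_⟩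
  · ext t
    rw [homD_apply]
    simp only [koszulSign_zero, one_smul, LinearMap.sum_apply, map_sum, Hom.map_d]
    exact sub_self _
  · induction x using dsum_induction with
    | zero => simp
    | add x y hx hy => rw [map_add, map_add, hx, hy]
    | of q t =>
      rw [dsumDescHom_ι]
      refine (LinearMap.sum_apply _ _ _).trans ?_
      have key : ∀ q', (c q').f ∘ₗ (boxHom (dsumι F (a q)) (dsumι G (b q))).f =
          if q' = q then (dsumι X q).f else 0 := fun q' => by
        refine box_hom_ext fun i m hm j x hx => ?_
        rw [LinearMap.comp_apply, boxHom_tm]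
        refine (congrArg (dsumι X q').f (boxHom_tm _ _ _ _)).trans ?_
        by_cases hq : q' = q
        · subst hq
          rw [if_pos rfl, dsumπ_dsumι_self, dsumπ_dsumι_self]
        · rw [if_neg hq, dsumπ_dsumι_ne F fun h => hq (ha h.symm), map_zero,
            LinearMap.zero_apply, map_zero, LinearMap.zero_apply]
      refine (Finset.sum_eq_single q (fun q' _ hq => ?_) (by simp)).trans ?_
      · have := LinearMap.congr_fun (key q') t
        rwa [if_neg hq] at this
      · have := LinearMap.congr_fun (key q) t
        rwa [if_pos rfl] at this

/-- A dg module is a retract of its sum with another one. -/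
def retractProd (M W : DGModule A) : Retract M.toD (M.prod W).toD :=
  Retract.map { i := prodInl M W, r := prodFst M W, retract := rfl } (quasiIso A).Q

/-- The diagonal bimodule is a direct summand of an `n`-fold extension of copies of the external
product of the sum of all coefficients `Hom_A(P_q, M_s)` with the sum of all `P_q`, where `M_s` is
the image of the diagonal under the first `s` projections. -/
lemma exists_generated_diagonal {A : DGAlgebra.{u, v} k} (hA : A.IsSmooth) {n : ℕ}
    {d : Fin (n + 1) → ℕ} {E : ∀ i : Fin (n + 1), Fin (d i) → DGModule A}
    (hE : IsFullExceptionalCollection E) : ∃ (F : DGModule A.op) (G : DGModule A),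
      perf A.op F.toD ∧ perf A G.toD ∧ generated (F.box G).toD n A.diagonal.toD := by
  let ι : Type := Σ i : Fin (n + 1), Fin (d i)
  let lev : ι → ℕ := fun q => q.1.val
  have hlev : ∀ q, lev q ≤ n := fun q => Nat.lt_succ_iff.1 q.1.isLt
  choose P f hf hqf using fun q : ι => exists_kproj (E q.1 q.2)
  let e : ∀ q : ι, (P q).toD ≅ (E q.1 q.2).toD := fun q => isoOfQuasiIso (f q) (hqf q)
  have hP : ∀ q, IsExc (P q) := fun q =>
    isExc_of_isExceptional (hf q) (f q) (hqf q) (hE.exceptional _ _) (hE.perfect _ _)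
  have horth : ∀ q q', q ≠ q' → lev q' ≤ lev q → Orth (P q) (P q') := by
    rintro ⟨i, j⟩ ⟨i', j'⟩ hne (hle : i'.val ≤ i.val)
    refine orth_of_subsingleton (hf _) (e _) (e _) ?_
    obtain hlt | heq := lt_or_eq_of_le (Fin.le_def.2 hle)
    · exact hE.semiorthogonal i' i hlt j' j
    · subst heq
      exact hE.orthogonal _ j j' fun h => hne (by rw [h])
  have hfull : thickClosure (fun Y => ∃ q, Y = (P q).toD) A.regular.toD :=
    hE.full _ perf_regular _ (isThick_thickClosure _) fun Y ⟨i, j, hY⟩ => by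
      subst hY
      exact (isThick_thickClosure _).iso (e ⟨i, j⟩) (le_thickClosure _ _ ⟨⟨i, j⟩, rfl⟩)
  -- the successive projections of the diagonal bimodule
  let T : ℕ → DGFun (A.op.tensor A) (A.op.tensor A) := tower A.op P hP lev n
  let M : ℕ → DGModule (A.op.tensor A) := fun s => (T s).obj A.diagonal
  have hM : (M (n + 1)).Acyclic := by
    rw [← isZero_toD_iff]
    refine diagonal_of_box hA hfull (isThick_isZero.comap (T (n + 1))) fun q => ?_
    have h := tower_acyclic hP horth A.op.regular (n := n) (hlev q) (s := n + 1) (by lia)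
    exact isZero_toD_iff.2 h
  have hperf : ∀ s (q : Block lev n s), perf A.op (homModule (P q.1) (M s)).toD := fun s q =>
    diagonal_of_box hA hfull
      (isThick_perf.comap ((T s).comp (homFun (P q.1) (hP q.1).kproj A.op))) fun q' =>
        perf_homModule_tower hP horth _ perf_regular (hlev q') q
  -- the coefficients of all blocks, and the sum of the exceptional objects
  let κ : Type := Σ s : Fin (n + 1), Block lev n s.val
  let F : κ → DGModule A.op := fun x => homModule (P x.2.1) (M x.1.val)
  obtain ⟨W, hW⟩ := exists_extensionsOf (Z := (dsum F).box (dsum P)) (n := n)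
    (M := M) (fun s => evSum A.op (fun q : Block lev n s => P q.1) (fun q => hP q.1) (M s))
    (fun s => rfl) (fun s hs => exists_retract_box F P
      (a := fun q : Block lev n s => (⟨⟨s, Nat.lt_succ_of_le hs⟩, q⟩ : κ))
      (fun q q' h => eq_of_heq (Sigma.mk.inj h).2) fun q => q.1) hM n 0 (zero_add n)
  refine ⟨dsum F, dsum P,
    thick_dsum isThick_perf F fun x => hperf _ x.2,
    thick_dsum isThick_perf P fun q => (hP q).perf, _, hW, ⟨retractProd _ W⟩⟩

end DGModule

end

theorem mainTheorem9 {k : Type u} [Field k] (A : DGAlgebra.{u, v} k) (hA : A.IsSmooth)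
    (n : ℕ) (d : Fin (n + 1) → ℕ) (E : ∀ i : Fin (n + 1), Fin (d i) → DGModule A)
    (hE : IsFullExceptionalCollection E) :
    A.Ddim ≤ (n : ℕ∞) := by
  exact iInf₂_le n (DGModule.exists_generated_diagonal hA hE)
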